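/- **Setting.** Let $p=(p(n))_{n\ge 0}$ be a probability distribution on $\mathbb N=\{0,1,2,\dots\}$ that is non-degenerate (its support has at least two points), with mean $\mu=\sum_n n\,p(n)\in(1,\infty)$. Let $f(x)=\sum_n p(n)x^n$, let $\tau$ be the Galton–Watson (GW) tree with offspring distribution $p$ (a random ordered rooted tree, seen as a random set of vertices, i.e. of finite words), let $Z_n$ be the number of vertices of $\tau$ in generation $n$, and let $\mathfrak c\in[0,1)$ be the probability that $\tau$ has finite height. Let $(c_n)_{n\ge0}$ be a Seneta–Heyde norming: $c_n>0$, $(e^{-Z_n/c_n})_{n\ge 0}$ is a martingale and $e^{-1/c_0}>\mathfrak c$. Let $W=\lim_n Z_n/c_n$ (a.s.). The law of $W$ is $\mathfrak c\,\delta_0+w(t)\mathbf 1_{\{t>0\}}dt$ with $w$ positive and continuous on $(0,\infty)$; set $w=0$ on $(-\infty,0]$ and let $w^{*r}$ be the $r$-fold convolution of $w$. Put $\mathfrak p(k)=\mathfrak c^{k-1}p(k)$, $k\ge 0$, if $\mathfrak c>0$; if $\mathfrak c=0$ let $\mathfrak p$ be the Dirac mass at $\min\{n:p(n)>0\}$.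 For $\ell\ge 1$ with $f^{(\ell)}(\mathfrak c)>0$ put $\mathfrak p_{[\ell]}(k)=\binom k\ell\frac{\ell!}{f^{(\ell)}(\mathfrak c)}\mathfrak c^{k-\ell}p(k)$, $k\ge \ell$ (with $0^0=1$). **Extremal trees.** For $\theta>0$, the two-type tree $\hat\tau^\theta$, with types ${\rm s}$ and ${\rm e}$, is built generation by generation. Its root has type ${\rm s}$. Given the first $h$ generations, with $r$ vertices of type ${\rm s}$ in generation $h$, the vector $(s_1,\dots,s_r)$ of the numbers of children of type ${\rm s}$ of these vertices has law $$\rho_{\mu^h\theta,r}(s)=\mu\,\frac{w^{*(s_1+\dots+s_r)}(\mu^{h+1}\theta)}{w^{*r}(\mu^h\theta)}\prod_{i=1}^r\frac{f^{(s_i)}(\mathfrak c)}{s_i!},\qquad s\in\{1,2,\dots\}^r;$$ given this vector, independently for the different vertices of generation $h$, the total number of children of the $i$-th vertex of type ${\rm s}$ has law $\mathfrak p_{[s_i]}$, the positions of its $s_i$ children of type ${\rm s}$ are uniform among its children and its other children have type ${\rm e}$, while each vertex of type ${\rm e}$ has only children of type ${\rm e}$, their number having law $\mathfrak p$. The tree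 $\tau^\theta$ is $\hat\tau^\theta$ without the types. **Inhomogeneous trees.** Let $\lambda\in\mathbb R$ be such that $\mathbb E[e^{\lambda W}]<\infty$, and let $\zeta_h=\mathbb E[e^{\lambda\mu^{-h}W}]$ for $h\ge0$; then $\mathfrak c<\zeta_h<\infty$. Let $T^{(\lambda)}$ be the GW tree in which vertices of generation $h$ have offspring distribution $\tilde p_h(k)=\frac{\zeta_{h+1}^k}{\zeta_h}p(k)$, $k\ge0$. Let $\hat T^{(\lambda),{\rm e}}$ be the two-type GW tree (given the first $h$ generations, the vertices of generation $h$ have children independently, with a law that depends only on their type and on $h$) such that: the root has type ${\rm s}$ with probability $(\zeta_0-\mathfrak c)/\zeta_0$ and type ${\rm e}$ otherwise; a vertex of type ${\rm e}$ has only children of type ${\rm e}$, their number having law $\mathfrak p$; for a vertex of type ${\rm s}$ in generation $h$ the number $\ell\ge1$ of children of type ${\rm s}$ has law $\hat p_h(\ell)=\frac{(\zeta_{h+1}-\mathfrak c)^\ell}{\zeta_h-\mathfrak c}\frac{f^{(\ell)}(\mathfrak c)}{\ell!}$, and, given $\ell$, the total number of children has law $\mathfrak p_{[\ell]}$, the positions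 of the $\ell$ children of type ${\rm s}$ are uniform among the children and the other children have type ${\rm e}$. **Statement.** Let $\Theta_\lambda$ be a random variable with density $g_\lambda(\theta)=\frac{1}{\zeta_0-\mathfrak c}\,w(\theta)e^{\lambda\theta}\mathbf 1_{\{\theta>0\}}$, and let $\tau^{\Theta_\lambda}$ (resp. $\hat\tau^{\Theta_\lambda}$) be the random tree which, conditionally on $\Theta_\lambda=\theta$, is distributed as $\tau^\theta$ (resp. $\hat\tau^\theta$). Then 1. $\tau^{\Theta_\lambda}$ is distributed as $T^{(\lambda)}$ conditioned on non-extinction (infinite height); 2. $\hat\tau^{\Theta_\lambda}$ is distributed as $\hat T^{(\lambda),{\rm e}}$ conditioned on its root having type ${\rm s}$. -/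

import Mathlib

open MeasureTheory ProbabilityTheory Filter
open scoped ENNReal Topology

namespace GWTree

noncomputable section

/-! ### Vertices, generations, trees

A vertex is a finite word of natural numbers, the root being the empty word; the children of `u`
are `u ++ [0], u ++ [1], …` (so the child written `u i` with `i ≥ 1` in the usual formalism of
Neveu is `u ++ [i - 1]`). A (random) tree is the set of its vertices; a (random) tree with types in
`σ` is the set of the pairs (vertex, type of that vertex). The sets of vertices carry the product
σ-algebra, which is generated by the events that a given vertex belongs to the tree. -/

/-- The law on `α` with the mass function `m`. (If `m` is not a probability mass function there is
no such law, and the value is a Dirac mass which plays no role.) -/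
def massLaw {α : Type} [Inhabited α] (m : α → ℝ≥0∞) : PMF α :=
  open Classical in if h : HasSum m 1 then ⟨m, h⟩ else PMF.pure default

/-- One generation of a typed tree: the list of its vertices, from left to right, with types. -/
def Gen (σ : Type) : Type := List (List ℕ × σ)

instance (σ : Type) : MeasurableSpace (Gen σ) := ⊤

instance (σ : Type) : DiscreteMeasurableSpace (Gen σ) := ⟨fun _ => trivial⟩

/-- The children of the vertex `v` when their types, from left to right, are `ts`. -/
def childrenOf {σ : Type} (v : List ℕ) (ts : List σ) : List (List ℕ × σ) :=
  ts.zipIdx.map fun x => (v ++ [x.2], x.1)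

/-- The generation that follows `g` when the `j`-th vertex of `g` has children with types given
by the `j`-th entry of `c`. -/
def nextGen {σ : Type} (g : Gen σ) (c : List (List σ)) : Gen σ :=
  (List.zipWith (fun v ts => childrenOf v.1 ts) g c).flatten

/-- The passage from generation `h` to generation `h + 1`, as a kernel on the past. -/
def genKernel {σ : Type} (step : ℕ → Gen σ → PMF (List (List σ))) (h : ℕ) :
    Kernel ((_ : Finset.Iic h) → Gen σ) (Gen σ) :=
  Kernel.comap
    (⟨fun g => ((step h g).map (nextGen g)).toMeasure, measurable_from_top⟩ :
      Kernel (Gen σ) (Gen σ))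
    (fun x => x ⟨h, Finset.mem_Iic.2 le_rfl⟩) (measurable_pi_apply _)

instance {σ : Type} (step : ℕ → Gen σ → PMF (List (List σ))) (h : ℕ) :
    IsMarkovKernel (genKernel step h) := by
  unfold genKernel
  have : IsMarkovKernel (⟨fun g => ((step h g).map (nextGen g)).toMeasure,
      measurable_from_top⟩ : Kernel (Gen σ) (Gen σ)) :=
    ⟨fun g => by
      change IsProbabilityMeasure ((step h g).map (nextGen g)).toMeasure
      infer_instance⟩
  infer_instance

/-- The generation reduced to the root, of type `t`. -/
def rootGen {σ : Type} (t : σ) : Gen σ := [([], t)]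

/-- The typed tree with the given generations. -/
def treeOfGens {σ : Type} (x : ℕ → Gen σ) : Set (List ℕ × σ) :=
  {v | ∃ h, List.Mem v (x h)}

/-- The law of the random typed tree whose root has a type with law `root` and in which, given
the first `h` generations, the lists of the types of the children of the successive vertices of
generation `h`, say `g`, have joint law `step h g`. -/
def typedTreeLaw {σ : Type} (root : PMF σ) (step : ℕ → Gen σ → PMF (List (List σ))) :
    Measure (Set (List ℕ × σ)) :=
  (Kernel.trajMeasure (X := fun _ => Gen σ)
    (root.map rootGen).toMeasure (genKernel step)).map treeOfGens

/-- The tree obtained by forgetting the types. -/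
def skeleton {σ : Type} (T : Set (List ℕ × σ)) : Set (List ℕ) := Prod.fst '' T

/-- The law of a list of independent draws, the `j`-th with law `off` of the `j`-th vertex. -/
def independent {α β : Type} (off : α → PMF β) : List α → PMF (List β)
  | [] => PMF.pure []
  | v :: g => (off v).bind fun b => (independent off g).map fun l => b :: l

/-- The law of the Galton–Watson tree in which the vertices of generation `h` have offspring
distribution `q h`. -/
def gwLaw (q : ℕ → PMF ℕ) : Measure (Set (List ℕ)) :=
  (typedTreeLaw (PMF.pure ()) fun h g =>
    independent (fun _ => (q h).map fun k => List.replicate k ()) g).map skeleton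

/-- The height of a tree. -/
def height (t : Set (List ℕ)) : ℕ∞ := ⨆ u ∈ t, (u.length : ℕ∞)

/-- The size of generation `n` of a tree. -/
def genSize (n : ℕ) (t : Set (List ℕ)) : ℕ := {u ∈ t | u.length = n}.ncard

/-- The restriction of a tree to its first `n` generations. -/
def restrictTo (n : ℕ) (t : Set (List ℕ)) : Set (List ℕ) := {u ∈ t | u.length ≤ n}

theorem measurable_restrictTo (n : ℕ) : Measurable (restrictTo n) := by
  refine measurable_set_iff.2 fun u => ?_
  by_cases hu : u.length ≤ n
  · simpa [restrictTo, hu] using measurable_set_mem u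
  · simp [restrictTo, hu]

/-- The filtration of the first generations of a tree. -/
def treeFiltration : Filtration ℕ (inferInstance : MeasurableSpace (Set (List ℕ))) where
  seq n := MeasurableSpace.comap (restrictTo n) inferInstance
  mono' m n hmn := by
    have h : restrictTo m = restrictTo m ∘ restrictTo n := by
      ext t u
      simp only [restrictTo, Function.comp_apply, Set.mem_ofPred_eq]
      constructor
      · rintro ⟨h1, h2⟩
        exact ⟨⟨h1, h2.trans hmn⟩, h2⟩
      · rintro ⟨⟨h1, _⟩, h2⟩
        exact ⟨h1, h2⟩
    change MeasurableSpace.comap (restrictTo m) _ ≤ MeasurableSpace.comap (restrictTo n) _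
    rw [h, ← MeasurableSpace.comap_comp]
    exact MeasurableSpace.comap_mono (measurable_restrictTo m).comap_le
  le' n := (measurable_restrictTo n).comap_le

/-! The maps used above to transport laws are measurable. -/

theorem measurable_treeOfGens {σ : Type} : Measurable (treeOfGens (σ := σ)) := by
  refine measurable_set_iff.2 fun v => ?_
  refine measurable_to_prop ?_
  have : (fun x : ℕ → Gen σ => v ∈ treeOfGens x) ⁻¹' {True}
      = ⋃ h, (fun x : ℕ → Gen σ => x h) ⁻¹' {g | List.Mem v g} := by
    ext x
    simp only [treeOfGens, Set.mem_preimage, Set.mem_singleton_iff, eq_iff_iff, iff_true,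
      Set.mem_iUnion]
    exact Iff.rfl
  rw [this]
  exact MeasurableSet.iUnion fun h => (measurable_pi_apply h) trivial

theorem measurable_skeleton {σ : Type} [Countable σ] : Measurable (skeleton (σ := σ)) := by
  refine measurable_set_iff.2 fun u => ?_
  have : (fun T : Set (List ℕ × σ) => u ∈ skeleton T) = fun T => ∃ t : σ, (u, t) ∈ T := by
    ext T
    simp [skeleton]
  rw [this]
  exact Measurable.exists fun t => measurable_set_mem (u, t)

/-! ### Offspring distribution, extinction, and the limit variable `W` -/

/-- The mean of `p`. -/
def mean (p : PMF ℕ) : ℝ≥0∞ := ∑' k : ℕ, (k : ℝ≥0∞) * p k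

/-- The generating function of `p`. -/
def genFun (p : PMF ℕ) (x : ℝ) : ℝ := ∑' k : ℕ, (p k).toReal * x ^ k

/-- The law of the Galton–Watson tree with offspring distribution `p`. -/
def gw (p : PMF ℕ) : Measure (Set (List ℕ)) := gwLaw fun _ => p

/-- The probability of extinction. -/
def extProb (p : PMF ℕ) : ℝ≥0∞ := gw p {t | height t < ⊤}

/-- The Taylor coefficient at the extinction probability `𝔠`, that is `f⁽ˢ⁾(𝔠) / s!`. -/
def taylorCoeff (p : PMF ℕ) (s : ℕ) : ℝ≥0∞ :=
  ENNReal.ofReal (iteratedDeriv s (genFun p) (extProb p).toReal / s.factorial)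

/-- `c` is a Seneta–Heyde norming for `p`: the process `exp (- Z n / c n)` is a martingale, and
`c 0 > - 1 / log 𝔠`, where `𝔠` is the extinction probability (which reads `c 0 > 0` if `𝔠 = 0`). -/
structure IsSenetaHeyde (p : PMF ℕ) (c : ℕ → ℝ) : Prop where
  pos : ∀ n, 0 < c n
  extProb_lt : (extProb p).toReal < Real.exp (-(1 / c 0))
  martingale : Martingale (fun n t => Real.exp (-((genSize n t : ℝ) / c n))) treeFiltration (gw p)

/-- The limit `W` of `Z n / c n`, as a function of the tree. -/
def W (c : ℕ → ℝ) (t : Set (List ℕ)) : ℝ :=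
  limUnder atTop fun n => (genSize n t : ℝ) / c n

/-- The density `w` of the law of `W` on `(0, ∞)`, extended by `0`: the derivative of the
distribution function of `W`. -/
def w (p : PMF ℕ) (c : ℕ → ℝ) (x : ℝ) : ℝ≥0∞ :=
  if 0 < x then ENNReal.ofReal (deriv (fun y => (gw p).real {t | W c t ≤ y}) x) else 0

/-- The `n`-fold convolution of `g` with itself, for `n ≥ 1` (the value at `n = 0` is not used). -/
def convPow (g : ℝ → ℝ≥0∞) : ℕ → ℝ → ℝ≥0∞
  | 0 => 0
  | 1 => g
  | n + 2 => lconvolution g (convPow g (n + 1)) volume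

/-! ### Two-type trees -/

/-- The two types: `s` (survivor) and `e` (extinction). -/
inductive VType : Type
  | s : VType
  | e : VType
  deriving DecidableEq

instance : Inhabited VType := ⟨VType.s⟩

instance : Countable VType :=
  Function.Injective.countable (f := fun t : VType => if t = VType.s then (0 : ℕ) else 1) (by
    intro a b h
    cases a <;> cases b <;> simp_all)

/-- The offspring distribution `𝔭`: the Dirac mass at the minimum of the support of `p` if
`𝔠 = 0`, and `𝔭 k = 𝔠 ^ (k - 1) * p k` otherwise. -/
def extMass (p : PMF ℕ) (k : ℕ) : ℝ≥0∞ :=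
  open Classical in
  if extProb p = 0 then (if k = sInf {n | p n ≠ 0} then 1 else 0)
  else extProb p ^ k / extProb p * p k

/-- The size-biased distribution of order `l` of `𝔭`, that is
`(k choose l) * (l! / f⁽ˡ⁾(𝔠)) * 𝔠 ^ (k - l) * p k` for `k ≥ l`; this is the Dirac mass at `l` if
`𝔠 = 0` and `p l > 0`. -/
def biasedMass (p : PMF ℕ) (l k : ℕ) : ℝ≥0∞ :=
  if l ≤ k then (k.choose l : ℝ≥0∞) * extProb p ^ (k - l) * p k / taylorCoeff p l else 0

/-- The conditional probability that the children of a vertex of type `s` have the types `ts`, from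
left to right, given that it has `l` children of type `s`, where `l` is the number of `s` in `ts`:
the number of children has law `biasedMass p l`, and given this number the set of the positions of
the children of type `s` is uniform among the sets of `l` positions. -/
def survivorMass (p : PMF ℕ) (ts : List VType) : ℝ≥0∞ :=
  biasedMass p (ts.count VType.s) ts.length / (ts.length.choose (ts.count VType.s) : ℝ≥0∞)

/-- The probability that the children of a vertex of type `e` have the types `ts`: all of them have
type `e`, and their number has law `𝔭`. -/
def extinctMass (p : PMF ℕ) (ts : List VType) : ℝ≥0∞ :=
  if VType.s ∈ ts then 0 else extMass p ts.length

/-! ### The extremal trees -/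

/-- The mass function `ρ_{θ,r}`, on the lists `κ` of length `r` of positive integers. -/
def rho (p : PMF ℕ) (c : ℕ → ℝ) (θ : ℝ) (κ : List ℕ) : ℝ≥0∞ :=
  if ∀ l ∈ κ, 1 ≤ l then
    mean p * (convPow (w p c) κ.sum ((mean p).toReal * θ) / convPow (w p c) κ.length θ)
      * (κ.map (taylorCoeff p)).prod
  else 0

/-- The numbers of children of type `s` of the vertices of type `s` of `g`, in the order of `g`,
when the types of the children are given by `c`. -/
def survivorCounts (g : Gen VType) (c : List (List VType)) : List ℕ :=
  ((List.zip g c).filter fun x => x.1.2 = VType.s).map fun x => x.2.count VType.s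

/-- The joint law of the types of the children of the vertices of generation `h`, given that this
generation is `g`, in the two-type extremal tree with parameter `θ`: the vector of the numbers of
children of type `s` of the vertices of type `s` has law `ρ_{μ ^ h θ, r}`, where `r` is the number
of these vertices; given this vector, the vertices have children independently, according to
`survivorMass` and `extinctMass`. -/
def extremalStep (p : PMF ℕ) (c : ℕ → ℝ) (θ : ℝ) (h : ℕ) (g : Gen VType) :
    PMF (List (List VType)) :=
  massLaw fun d =>
    if d.length = List.length g then
      rho p c ((mean p).toReal ^ h * θ) (survivorCounts g d)
        * ((List.zip g d).map fun x =>
            match x.1.2 with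
            | VType.s => survivorMass p x.2
            | VType.e => extinctMass p x.2).prod
    else 0

/-- The law of the two-type extremal tree with parameter `θ > 0`, whose root has type `s`. -/
def extremalTypedLaw (p : PMF ℕ) (c : ℕ → ℝ) (θ : ℝ) : Measure (Set (List ℕ × VType)) :=
  typedTreeLaw (PMF.pure VType.s) (extremalStep p c θ)

/-- The law of the extremal tree with parameter `θ > 0`. -/
def extremalLaw (p : PMF ℕ) (c : ℕ → ℝ) (θ : ℝ) : Measure (Set (List ℕ)) :=
  (extremalTypedLaw p c θ).map skeleton

/-! ### The inhomogeneous trees, for `ζ 0 < ∞` -/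

/-- `ζ_h(lam) = E[exp (lam * μ ^ (- h) * W)]`. -/
def zeta (p : PMF ℕ) (c : ℕ → ℝ) (lam : ℝ) (h : ℕ) : ℝ≥0∞ :=
  ∫⁻ t, ENNReal.ofReal (Real.exp (lam / (mean p).toReal ^ h * W c t)) ∂(gw p)

/-- The offspring distribution `ζ_{h+1} ^ k / ζ_h * p k` of generation `h`. -/
def tiltedOffspring (p : PMF ℕ) (c : ℕ → ℝ) (lam : ℝ) (h : ℕ) : PMF ℕ :=
  massLaw fun k => zeta p c lam (h + 1) ^ k / zeta p c lam h * p k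

/-- The law of the inhomogeneous Galton–Watson tree `T^{(lam)}`. -/
def tiltedLaw (p : PMF ℕ) (c : ℕ → ℝ) (lam : ℝ) : Measure (Set (List ℕ)) :=
  gwLaw (tiltedOffspring p c lam)

/-- The law, on the positive integers, of the number of children of type `s` of a vertex of type
`s` of generation `h`, namely
`(ζ_{h+1} - 𝔠) ^ l / (ζ_h - 𝔠) * f⁽ˡ⁾(𝔠) / l!`. -/
def survivorOffspring (p : PMF ℕ) (c : ℕ → ℝ) (lam : ℝ) (h : ℕ) (l : ℕ) : ℝ≥0∞ :=
  if 1 ≤ l then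
    (zeta p c lam (h + 1) - extProb p) ^ l / (zeta p c lam h - extProb p) * taylorCoeff p l
  else 0

/-- The law of the type of the root. -/
def rootLaw (p : PMF ℕ) (c : ℕ → ℝ) (lam : ℝ) : PMF VType :=
  massLaw fun
    | VType.s => (zeta p c lam 0 - extProb p) / zeta p c lam 0
    | VType.e => extProb p / zeta p c lam 0

/-- The law of the types of the children of a vertex of generation `h` of the given type. -/
def typedOffspring (p : PMF ℕ) (c : ℕ → ℝ) (lam : ℝ) (h : ℕ) : VType → PMF (List VType)
  | VType.s => massLaw fun ts =>
      survivorOffspring p c lam h (ts.count VType.s) * survivorMass p ts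
  | VType.e => massLaw (extinctMass p)

/-- The law of the two-type inhomogeneous Galton–Watson tree. -/
def tiltedTypedLaw (p : PMF ℕ) (c : ℕ → ℝ) (lam : ℝ) : Measure (Set (List ℕ × VType)) :=
  typedTreeLaw (rootLaw p c lam) fun h g =>
    independent (fun v : List ℕ × VType => typedOffspring p c lam h v.2) g

/-! ### The mixing law -/

/-- The law of `Θ`: its density is `w θ * exp (lam * θ) / (ζ 0 - 𝔠)` on `(0, ∞)`. -/
def thetaLaw (p : PMF ℕ) (c : ℕ → ℝ) (lam : ℝ) : Measure ℝ :=
  volume.withDensity fun θ =>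
    w p c θ * ENNReal.ofReal (Real.exp (lam * θ)) / (zeta p c lam 0 - extProb p)

end

end GWTree

open MeasureTheory ProbabilityTheory Filter
open scoped ENNReal Topology

namespace GWTree

noncomputable section

/-! ### Markov chains of generations -/

/-! Write 𝔠 for the extinction probability, `a l = f⁽ˡ⁾(𝔠) / l!`, and ν for the law of `W`
restricted to `(0, ∞)`. Everything rests on one identity. The characteristic function φ of `W`
satisfies `φ(μ t) = f(φ(t))`; since `f(𝔠) = 𝔠`, expanding at 𝔠 shows that the image of ν under
multiplication by μ is `∑_{l ≥ 1} a l • ν^{*l}` (`map_survLaw`). For densities this becomes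
`w^{*r}(x) = μ ∑ a l₁ ⋯ a l_r w^{*(l₁ + ⋯ + l_r)}(μ x)` for almost every `x` (`ae_convPow_eq`),
which is the normalisation of ρ. Integrated against exponentials it becomes `ζ_h - 𝔠 = ∑ a l
(ζ_{h+1} - 𝔠)^l` (`survZeta_eq_sgf`), which is the normalisation of the survivors' offspring law.

Consequently both two-type chains are Doob transforms of the same weight `stepMass` on transitions.
If `r` is the number of vertices of type s in generation `h`, the transforming function is `μ^h
w^{*r}(μ^h θ)` for the extremal tree (`ae_extremalStep`) and `(ζ_h - 𝔠)^r` for the inhomogeneous one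
(`mul_tiltedStep`). The probability of a path started from a root of type s telescopes in both
cases, and `∫ μ^n w^{*r}(μ^n θ) e^{λθ} dθ = (ζ_n - 𝔠)^r` turns the mixture of the first into the
conditioned second (`bind_chainLaw`). Since Θ has a density, identities for almost every θ suffice.

For the trees without types, one checks that in the inhomogeneous tree the types of generation `n`
are independent given the untyped past (`chainLaw_erase`), so that forgetting them gives `T^{(λ)}`.
A root of type s forces infinite height, and its probability `1 - 𝔠 / ζ_0` is also that of infinite
height; the two conditionings therefore agree (`ae_height_iff`).

The analytic input is that ν has a density. The bounded martingale limit shows that `W` is finite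
and has an atom of mass 𝔠 at 0. By non-degeneracy `|ν̂(t)| < 1 - 𝔠` for `t ≠ 0`, and iterating `y ↦
f(𝔠 + y) - 𝔠`, a contraction to 0 below `1 - 𝔠`, gives polynomial decay of `ν̂`. So high convolution
powers of ν have integrable characteristic functions and are absolutely continuous; feeding this
back into the identity for ν yields absolute continuity of ν itself
(`survLaw_absolutelyContinuous`). -/

instance {σ : Type} [Countable σ] : Countable (Gen σ) :=
  inferInstanceAs (Countable (List (List ℕ × σ)))

instance {σ : Type} : Inhabited (Gen σ) := ⟨([] : List (List ℕ × σ))⟩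

/-- The event that the first generations are those of `x`. -/
def pathSet {E : Type} (n : ℕ) (x : ℕ → E) : Set (ℕ → E) := {y | ∀ i ≤ n, y i = x i}

section Path

variable {E : Type} [MeasurableSpace E] [DiscreteMeasurableSpace E]

theorem measurableSet_pathSet (n : ℕ) (x : ℕ → E) : MeasurableSet (pathSet n x) := by
  have : pathSet n x = ⋂ i ∈ Set.Iic n, (fun y : ℕ → E => y i) ⁻¹' {x i} := by
    ext y; simp [pathSet]
  rw [this]
  exact MeasurableSet.biInter (Set.to_countable _) fun i _ => measurable_pi_apply i (.of_discrete)

variable [Countable E] [Inhabited E]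

/-- The extension of a finite path by a default value. -/
def extendPath {n : ℕ} (z : (_ : Finset.Iic n) → E) (i : ℕ) : E :=
  if h : i ≤ n then z ⟨i, Finset.mem_Iic.2 h⟩ else default

/-- As `E` is countable, a cylinder is a countable disjoint union of path events. Laws on sequences
can thus be compared, and their measurability in a parameter checked, on path events alone. -/
theorem measure_cylinder_eq_tsum (μ : Measure (ℕ → E)) (n : ℕ)
    (S : Set ((_ : Finset.Iic n) → E)) :
    μ (cylinder (Finset.Iic n) S) = ∑' z : S, μ (pathSet n (extendPath z.1)) := by
  have : cylinder (Finset.Iic n) S = ⋃ z : S, pathSet n (extendPath z.1) := by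
    ext y
    simp only [mem_cylinder, Set.mem_iUnion, pathSet, Set.mem_ofPred_eq, extendPath]
    constructor
    · intro h
      exact ⟨⟨_, h⟩, fun i hi => by simp [hi]⟩
    · rintro ⟨⟨z, hz⟩, h⟩
      convert hz
      ext i
      have hi := Finset.mem_Iic.1 i.2
      simpa [hi] using h i hi
  rw [this, measure_iUnion]
  · intro z z' hzz
    refine Set.disjoint_left.2 fun y hy hy' => hzz ?_
    ext i
    have hi := Finset.mem_Iic.1 i.2
    have h1 := hy i hi
    have h2 := hy' i hi
    rw [h1] at h2
    simpa [extendPath, hi] using h2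
  · exact fun z => measurableSet_pathSet _ _

theorem measure_ext_of_pathSet {μ ν : Measure (ℕ → E)} [IsFiniteMeasure μ]
    (h : ∀ n x, μ (pathSet n x) = ν (pathSet n x)) : μ = ν := by
  have hc : ∀ n S, μ (cylinder (Finset.Iic n) S) = ν (cylinder (Finset.Iic n) S) := by
    intro n S
    rw [measure_cylinder_eq_tsum, measure_cylinder_eq_tsum]
    exact tsum_congr fun z => h _ _
  refine ext_of_generate_finite (measurableCylinders fun _ : ℕ => E)
    generateFrom_measurableCylinders.symm isPiSystem_measurableCylinders ?_ ?_
  · intro s hs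
    rw [measurableCylinders_nat] at hs
    simp only [Set.mem_iUnion, Set.mem_singleton_iff] at hs
    obtain ⟨n, S, -, rfl⟩ := hs
    exact hc n S
  · have := hc 0 Set.univ
    rwa [cylinder_univ] at this

/-- Provides the measurability in θ without which `Measure.bind` could not be computed. -/
theorem measurable_of_pathSet {Θ : Type} [MeasurableSpace Θ] (μ : Θ → Measure (ℕ → E))
    [∀ θ, IsProbabilityMeasure (μ θ)] (h : ∀ n x, Measurable fun θ => μ θ (pathSet n x)) :
    Measurable μ := by
  refine Measurable.measure_of_isPiSystem_of_isProbabilityMeasure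
    (S := measurableCylinders fun _ : ℕ => E)
    generateFrom_measurableCylinders.symm isPiSystem_measurableCylinders ?_
  intro s hs
  rw [measurableCylinders_nat] at hs
  simp only [Set.mem_iUnion, Set.mem_singleton_iff] at hs
  obtain ⟨n, S, -, rfl⟩ := hs
  simp_rw [measure_cylinder_eq_tsum]
  exact Measurable.tsum fun z => h _ _

end Path

section Chain

variable {σ : Type}

/-- The law of the sequence of the generations of a typed tree. -/
def chainLaw (root : PMF σ) (step : ℕ → Gen σ → PMF (List (List σ))) : Measure (ℕ → Gen σ) :=
  Kernel.trajMeasure (X := fun _ => Gen σ) (root.map rootGen).toMeasure (genKernel step)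

instance (root : PMF σ) (step : ℕ → Gen σ → PMF (List (List σ))) :
    IsProbabilityMeasure (chainLaw root step) := by
  unfold chainLaw; infer_instance

theorem chainLaw_zero [Countable σ] (root : PMF σ) (step : ℕ → Gen σ → PMF (List (List σ)))
    (g : Gen σ) :
    chainLaw root step {x | x 0 = g} = (root.map rootGen) g := by
  have h : (chainLaw root step).map (Preorder.frestrictLe (π := fun _ => Gen σ) 0)
      = (root.map rootGen).toMeasure.map (MeasurableEquiv.piUnique _).symm := by
    rw [chainLaw, Kernel.trajMeasure, Measure.map_comp _ _ (by fun_prop),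
      Kernel.traj_map_frestrictLe, Kernel.partialTraj_self, Measure.id_comp]
  have hm : MeasurableSet {z : (_ : Finset.Iic 0) → Gen σ | z ⟨0, by simp⟩ = g} :=
    measurable_pi_apply (X := fun _ : Finset.Iic 0 => Gen σ) ⟨0, by simp⟩ (t := {g}) trivial
  have h2 := congrArg (fun m => m {z | z ⟨0, by simp⟩ = g}) h
  rw [Measure.map_apply (by fun_prop) hm, Measure.map_apply (by fun_prop) hm] at h2
  refine h2.trans ?_
  rw [← PMF.toMeasure_apply_singleton _ g trivial]
  rfl

/-- The law of the generation that follows `g`. -/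
def stepLaw (step : ℕ → Gen σ → PMF (List (List σ))) (h : ℕ) (g : Gen σ) : PMF (Gen σ) :=
  (step h g).map (nextGen g)

/-- The Markov property. The event `B` on the past is arbitrary because, when types are erased, the
past is only known up to its types. -/
theorem chainLaw_step [Countable σ] (root : PMF σ) (step : ℕ → Gen σ → PMF (List (List σ)))
    (n : ℕ) {B : Set ((_ : Finset.Iic n) → Gen σ)} (hB : MeasurableSet B) (g g' : Gen σ) :
    chainLaw root step {x | Preorder.frestrictLe (π := fun _ => Gen σ) n x ∈ B ∧ x n = g ∧
        x (n + 1) = g'}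
      = chainLaw root step {x | Preorder.frestrictLe (π := fun _ => Gen σ) n x ∈ B ∧ x n = g}
        * stepLaw step n g g' := by
  have h := Kernel.map_frestrictLe_trajMeasure_compProd_eq_map_trajMeasure
    (X := fun _ => Gen σ) (μ₀ := (root.map rootGen).toMeasure) (κ := genKernel step) (a := n)
  have hB' : MeasurableSet (B ∩ {z | z ⟨n, by simp⟩ = g}) :=
    hB.inter (measurable_pi_apply (X := fun _ : Finset.Iic n => Gen σ) ⟨n, by simp⟩
      (t := {g}) trivial)
  have hg : MeasurableSet ({g'} : Set (Gen σ)) := trivial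
  have h2 := congrArg (fun m => m ((B ∩ {z | z ⟨n, by simp⟩ = g}) ×ˢ {g'})) h
  rw [Measure.map_apply (by fun_prop) (hB'.prod hg), Measure.compProd_apply_prod hB' hg] at h2
  have h3 : ∫⁻ a in B ∩ {z | z ⟨n, by simp⟩ = g}, (genKernel step n) a {g'}
      ∂((chainLaw root step).map (Preorder.frestrictLe (π := fun _ => Gen σ) n))
      = ∫⁻ a in B ∩ {z | z ⟨n, by simp⟩ = g}, stepLaw step n g g'
      ∂((chainLaw root step).map (Preorder.frestrictLe (π := fun _ => Gen σ) n)) := by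
    refine setLIntegral_congr_fun hB' fun a ha => ?_
    have : a ⟨n, by simp⟩ = g := ha.2
    simp only [genKernel, Kernel.comap_apply, Kernel.coe_mk, this]
    rw [PMF.toMeasure_apply_singleton _ _ hg]
    rfl
  rw [show (Kernel.trajMeasure (X := fun _ => Gen σ) (root.map rootGen).toMeasure
    (genKernel step)) = chainLaw root step from rfl] at h2
  rw [h3, setLIntegral_const, Measure.map_apply (by fun_prop) hB'] at h2
  rw [mul_comm]
  refine Eq.trans ?_ (h2.symm.trans ?_)
  · congr 1; ext x
    simp only [Set.mem_ofPred_eq, Set.mem_preimage, Set.mem_prod, Set.mem_inter_iff,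
      Set.mem_singleton_iff, and_assoc]
    rfl
  · rfl

theorem chainLaw_pathSet_succ [Countable σ] (root : PMF σ)
    (step : ℕ → Gen σ → PMF (List (List σ))) (n : ℕ) (x : ℕ → Gen σ) :
    chainLaw root step (pathSet (n + 1) x)
      = chainLaw root step (pathSet n x) * stepLaw step n (x n) (x (n + 1)) := by
  have hB : MeasurableSet {z : (_ : Finset.Iic n) → Gen σ | ∀ i, z i = x i} :=
    MeasurableSet.of_discrete
  have := chainLaw_step root step n hB (x n) (x (n + 1))
  convert this using 3
  · ext y
    simp only [pathSet, Set.mem_ofPred_eq, Subtype.forall, Finset.mem_Iic,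
      Preorder.frestrictLe_apply]
    constructor
    · intro h
      exact ⟨fun i hi => h i (by omega), h n (by omega), h _ le_rfl⟩
    · rintro ⟨h1, h2, h3⟩ i hi
      rcases hi.lt_or_eq with h | rfl
      · exact h1 i (by omega)
      · exact h3
  · ext y
    simp only [pathSet, Set.mem_ofPred_eq, Subtype.forall, Finset.mem_Iic,
      Preorder.frestrictLe_apply]
    exact ⟨fun h => ⟨h, h n le_rfl⟩, fun h => h.1⟩

theorem chainLaw_pathSet_zero [Countable σ] (root : PMF σ)
    (step : ℕ → Gen σ → PMF (List (List σ))) (x : ℕ → Gen σ) :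
    chainLaw root step (pathSet 0 x) = (root.map rootGen) (x 0) := by
  rw [← chainLaw_zero root step]
  congr 1; ext y; simp [pathSet]

/-- The law of generation `n`. -/
def genLaw (root : PMF σ) (step : ℕ → Gen σ → PMF (List (List σ))) : ℕ → PMF (Gen σ)
  | 0 => root.map rootGen
  | n + 1 => (genLaw root step n).bind (stepLaw step n)

theorem chainLaw_apply_eq [Countable σ] (root : PMF σ)
    (step : ℕ → Gen σ → PMF (List (List σ))) (n : ℕ) (g : Gen σ) :
    chainLaw root step {x | x n = g} = genLaw root step n g := by
  induction n generalizing g with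
  | zero => exact chainLaw_zero _ _ _
  | succ n ih =>
    have h : {x : ℕ → Gen σ | x (n + 1) = g} = ⋃ g', {x | x n = g' ∧ x (n + 1) = g} := by
      ext x; simp
    have hm : ∀ (n : ℕ) (g : Gen σ), MeasurableSet {x : ℕ → Gen σ | x n = g} := fun n g =>
      measurable_pi_apply (X := fun _ : ℕ => Gen σ) n (t := {g}) trivial
    rw [h, measure_iUnion, genLaw, PMF.bind_apply]
    · refine tsum_congr fun g' => ?_
      rw [← ih]
      have := chainLaw_step root step n MeasurableSet.univ g' g
      simpa using this
    · intro a b hab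
      exact Set.disjoint_left.2 fun y hy hy' => hab (hy.1.symm.trans hy'.1)
    · exact fun g' => (hm n g').inter (hm (n + 1) g)

theorem ae_step_mem_support [Countable σ] (root : PMF σ)
    (step : ℕ → Gen σ → PMF (List (List σ))) :
    ∀ᵐ x ∂chainLaw root step, x 0 ∈ (root.map rootGen).support ∧
      ∀ n, x (n + 1) ∈ (stepLaw step n (x n)).support := by
  have hx : ∀ n (g : Gen σ), (genLaw root step n) g = 0 → ∀ᵐ x ∂chainLaw root step, x n ≠ g := by
    intro n g hg
    rw [← chainLaw_apply_eq] at hg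
    simpa [ae_iff] using hg
  have h0 : ∀ᵐ x ∂chainLaw root step, x 0 ∈ (root.map rootGen).support := by
    have : ∀ g : Gen σ, ∀ᵐ x ∂chainLaw root step, g ∉ (root.map rootGen).support → x 0 ≠ g := by
      intro g
      by_cases h : g ∈ (root.map rootGen).support
      · exact ae_of_all _ fun x h' => absurd h h'
      · filter_upwards [hx 0 g (of_not_not h)] with x hx _ using hx
    filter_upwards [ae_all_iff.2 this] with x hx
    by_contra h
    exact hx _ h rfl
  refine h0.and (ae_all_iff.2 fun n => ?_)
  have : ∀ g g' : Gen σ, ∀ᵐ x ∂chainLaw root step,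
      stepLaw step n g g' = 0 → ¬ (x n = g ∧ x (n + 1) = g') := by
    intro g g'
    by_cases h : stepLaw step n g g' = 0
    · have h2 := chainLaw_step root step n MeasurableSet.univ g g'
      rw [h, mul_zero] at h2
      simp only [h, true_imp_iff]
      simpa [ae_iff] using h2
    · simp [h]
  filter_upwards [ae_all_iff.2 fun g => ae_all_iff.2 (this g)] with x hx
  rw [PMF.mem_support_iff]
  intro h
  exact hx _ _ h ⟨rfl, rfl⟩

end Chain

/-! ### The vertices of a generation -/

section Levels

variable {σ : Type}

/-- The list of the vertices of a generation. -/
def Gen.toList (g : Gen σ) : List (List ℕ × σ) := g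

/-- `nextGen` as a function on lists. -/
def nextList (g : List (List ℕ × σ)) (c : List (List σ)) : List (List ℕ × σ) :=
  (List.zipWith (fun v ts => childrenOf v.1 ts) g c).flatten

theorem toList_nextGen (g : Gen σ) (d : List (List σ)) :
    (nextGen g d).toList = nextList g.toList d := rfl

theorem toList_rootGen (t : σ) : (rootGen t).toList = [([], t)] := rfl

theorem nextList_nil (d : List (List σ)) : nextList [] d = [] := by
  simp [nextList]

theorem nextList_cons (v : List ℕ × σ) (g : List (List ℕ × σ)) (ts : List σ) (d : List (List σ)) :
    nextList (v :: g) (ts :: d) = childrenOf v.1 ts ++ nextList g d := by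
  simp [nextList]

theorem nextList_nil_right (g : List (List ℕ × σ)) : nextList g [] = [] := by
  simp [nextList]

theorem length_childrenOf (v : List ℕ) (ts : List σ) : (childrenOf v ts).length = ts.length := by
  simp [childrenOf]

theorem map_snd_childrenOf (v : List ℕ) (ts : List σ) : (childrenOf v ts).map Prod.snd = ts := by
  simp only [childrenOf, List.map_map]
  exact List.zipIdx_map_fst 0 ts

theorem map_fst_childrenOf (v : List ℕ) (ts : List σ) :
    (childrenOf v ts).map Prod.fst = (List.range ts.length).map fun i => v ++ [i] := by
  simp only [childrenOf, List.map_map]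
  rw [List.range_eq_range', ← List.zipIdx_map_snd 0 ts, List.map_map]
  rfl

theorem exists_of_mem_nextGen (g : List (List ℕ × σ)) (d : List (List σ)) (u : List ℕ)
    (hu : u ∈ (nextList g d).map Prod.fst) : ∃ v ∈ g.map Prod.fst, ∃ i, u = v ++ [i] := by
  induction g generalizing d with
  | nil => simp [nextList_nil] at hu
  | cons v g ih =>
    cases d with
    | nil => simp [nextList_nil_right] at hu
    | cons ts d =>
      rw [nextList_cons, List.map_append, List.mem_append, map_fst_childrenOf] at hu
      rcases hu with hu | hu
      · obtain ⟨i, -, rfl⟩ := List.mem_map.1 hu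
        exact ⟨v.1, by simp, i, rfl⟩
      · obtain ⟨w, hw, i, rfl⟩ := ih d hu
        exact ⟨w, by simp only [List.map_cons, List.mem_cons]; exact Or.inr hw, i, rfl⟩

/-- The vertices of `g` are distinct words of length `n`. -/
def IsLevel (n : ℕ) (g : Gen σ) : Prop :=
  (∀ u ∈ g.toList.map Prod.fst, u.length = n) ∧ (g.toList.map Prod.fst).Nodup

theorem isLevel_rootGen (t : σ) : IsLevel 0 (rootGen t) := by
  simp [IsLevel, toList_rootGen]

theorem IsLevel.nextGen {n : ℕ} {g : Gen σ} (hg : IsLevel n g) (d : List (List σ)) :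
    IsLevel (n + 1) (nextGen g d) := by
  refine ⟨fun u hu => ?_, ?_⟩
  · obtain ⟨v, hv, i, rfl⟩ := exists_of_mem_nextGen g d u hu
    simp [hg.1 v hv]
  · replace hg := hg.2
    rw [toList_nextGen]
    generalize g.toList = g at hg
    induction g generalizing d with
    | nil => simp [nextList_nil]
    | cons v g ih =>
      cases d with
      | nil => simp [nextList_nil_right]
      | cons ts d =>
        rw [List.map_cons, List.nodup_cons] at hg
        rw [nextList_cons, List.map_append, map_fst_childrenOf]
        refine List.Nodup.append ?_ (ih d hg.2) ?_
        · exact List.nodup_range.map fun i j h => by simpa using h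
        · intro u hu hu'
          obtain ⟨i, -, rfl⟩ := List.mem_map.1 hu
          obtain ⟨w, hw, j, h⟩ := exists_of_mem_nextGen g d _ hu'
          have h2 := (List.append_inj' h rfl).1
          exact hg.1 (h2 ▸ hw)

theorem ae_isLevel [Countable σ] (root : PMF σ) (step : ℕ → Gen σ → PMF (List (List σ))) :
    ∀ᵐ x ∂chainLaw root step, (∀ n, IsLevel n (x n)) ∧
      ∀ n, ∃ d ∈ (step n (x n)).support, x (n + 1) = nextGen (x n) d := by
  filter_upwards [ae_step_mem_support root step] with x hx
  have h : ∀ n, ∃ d ∈ (step n (x n)).support, x (n + 1) = nextGen (x n) d := by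
    intro n
    have := hx.2 n
    rw [stepLaw, PMF.support_map] at this
    obtain ⟨d, hd, h⟩ := this
    exact ⟨d, hd, h.symm⟩
  refine ⟨fun n => ?_, h⟩
  induction n with
  | zero =>
    have := hx.1
    rw [PMF.support_map] at this
    obtain ⟨t, -, ht⟩ := this
    rw [← ht]; exact isLevel_rootGen t
  | succ n ih =>
    obtain ⟨d, -, h⟩ := h n
    rw [h]; exact ih.nextGen d

/-- A set of vertices does not record generations, but the length of a word does, as soon as
generation `n` consists of words of length `n`. -/
theorem mem_skeleton_treeOfGens {x : ℕ → Gen σ} (hx : ∀ n, IsLevel n (x n)) (u : List ℕ) :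
    u ∈ skeleton (treeOfGens x) ↔ u ∈ (x u.length).toList.map Prod.fst := by
  simp only [skeleton, treeOfGens, Set.mem_image, Set.mem_ofPred_eq]
  constructor
  · rintro ⟨v, ⟨h, hv⟩, rfl⟩
    have h1 : v.1 ∈ (x h).toList.map Prod.fst := List.mem_map.2 ⟨v, hv, rfl⟩
    rwa [(hx h).1 _ h1]
  · intro hu
    obtain ⟨v, hv, h⟩ := List.mem_map.1 hu
    exact ⟨v, ⟨_, hv⟩, h⟩

theorem genSize_treeOfGens {x : ℕ → Gen σ} (hx : ∀ n, IsLevel n (x n)) (n : ℕ) :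
    genSize n (skeleton (treeOfGens x)) = (x n).toList.length := by
  have : {u ∈ skeleton (treeOfGens x) | u.length = n}
      = (((x n).toList.map Prod.fst).toFinset : Set (List ℕ)) := by
    ext u
    simp only [Set.mem_ofPred_eq, mem_skeleton_treeOfGens hx, List.coe_toFinset]
    constructor
    · rintro ⟨h, rfl⟩; exact h
    · intro h
      have := (hx n).1 u h
      exact ⟨by rwa [this], this⟩
  rw [genSize, this, Set.ncard_coe_finset, List.toFinset_card_of_nodup (hx n).2, List.length_map]

theorem height_eq_top_iff (t : Set (List ℕ)) : height t = ⊤ ↔ ∀ n : ℕ, ∃ u ∈ t, n < u.length := by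
  rw [height, iSup₂_eq_top]
  constructor
  · intro h n
    obtain ⟨u, hu, h⟩ := h n (ENat.natCast_lt_top n)
    exact ⟨u, hu, by exact_mod_cast h⟩
  · intro h b hb
    lift b to ℕ using hb.ne
    obtain ⟨u, hu, h⟩ := h b
    exact ⟨u, hu, by exact_mod_cast h⟩

theorem measurableSet_height_eq_top : MeasurableSet {t : Set (List ℕ) | height t = ⊤} := by
  simp_rw [height_eq_top_iff]
  have : {t : Set (List ℕ) | ∀ n : ℕ, ∃ u ∈ t, n < u.length}
      = ⋂ n : ℕ, ⋃ u : {u : List ℕ // n < u.length}, {t | u.1 ∈ t} := by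
    ext t; simp [and_comm]
  rw [this]
  exact MeasurableSet.iInter fun n => MeasurableSet.iUnion fun u =>
    measurable_set_mem u.1 (t := {True}) trivial |>.congr (by ext; simp)

/-- An empty generation has only empty successors. -/
theorem height_treeOfGens_eq_top_iff {x : ℕ → Gen σ} (hx : ∀ n, IsLevel n (x n))
    (h : ∀ n, ∃ d, x (n + 1) = nextGen (x n) d) :
    height (skeleton (treeOfGens x)) = ⊤ ↔ ∀ n, (x n).toList.length ≠ 0 := by
  have h0 : ∀ n, (x n).toList.length = 0 → ∀ m, (x (n + m)).toList.length = 0 := by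
    intro n hn m
    induction m with
    | zero => exact hn
    | succ m ih =>
      obtain ⟨d, hd⟩ := h (n + m)
      rw [← add_assoc, hd, toList_nextGen, List.length_eq_zero_iff.1 ih, nextList_nil]
      rfl
  rw [height_eq_top_iff]
  constructor
  · intro H n hn
    obtain ⟨u, hu, hl⟩ := H n
    rw [mem_skeleton_treeOfGens hx] at hu
    obtain ⟨m, hm⟩ := Nat.exists_eq_add_of_lt hl
    have := h0 n hn (m + 1)
    rw [← add_assoc, ← hm, List.length_eq_zero_iff] at this
    rw [this] at hu
    simp at hu
  · intro H n
    obtain ⟨v, hv⟩ := List.exists_mem_of_length_pos (Nat.pos_of_ne_zero (H (n + 1)))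
    have h1 : v.1 ∈ (x (n + 1)).toList.map Prod.fst := List.mem_map.2 ⟨v, hv, rfl⟩
    have h2 := (hx (n + 1)).1 _ h1
    exact ⟨v.1, (mem_skeleton_treeOfGens hx _).2 (by rwa [h2]), by omega⟩

end Levels

/-! ### Generating functions -/

section Expectation

variable {α β : Type}

theorem tsum_bind_mul (π : PMF α) (κ : α → PMF β) (φ : β → ℝ≥0∞) :
    ∑' b, π.bind κ b * φ b = ∑' a, π a * ∑' b, κ a b * φ b := by
  simp_rw [PMF.bind_apply, ← ENNReal.tsum_mul_right, ← ENNReal.tsum_mul_left]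
  rw [ENNReal.tsum_comm]
  simp_rw [mul_assoc]

theorem tsum_pure_mul (a : α) (φ : α → ℝ≥0∞) : ∑' b, PMF.pure a b * φ b = φ a := by
  rw [tsum_eq_single a]
  · simp
  · intro b hb; simp [hb]

theorem tsum_map_mul (π : PMF α) (f : α → β) (φ : β → ℝ≥0∞) :
    ∑' b, π.map f b * φ b = ∑' a, π a * φ (f a) := by
  rw [← PMF.bind_pure_comp, tsum_bind_mul]
  simp_rw [Function.comp_apply, tsum_pure_mul]

variable {𝕜 : Type} [RCLike 𝕜]

theorem summable_pmf_mul (π : PMF α) {φ : α → 𝕜} (hφ : ∀ a, ‖φ a‖ ≤ 1) :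
    Summable fun a => ((π a).toReal : 𝕜) * φ a := by
  have h : Summable fun a => (π a).toReal := ENNReal.summable_toReal π.tsum_coe_ne_top
  refine h.of_norm_bounded fun a => ?_
  rw [norm_mul, RCLike.norm_ofReal, abs_of_nonneg ENNReal.toReal_nonneg]
  exact mul_le_of_le_one_right ENNReal.toReal_nonneg (hφ a)

theorem norm_tsum_pmf_mul_le (π : PMF α) {φ : α → 𝕜} (hφ : ∀ a, ‖φ a‖ ≤ 1) :
    ‖∑' a, ((π a).toReal : 𝕜) * φ a‖ ≤ 1 := by
  have h : Summable fun a => (π a).toReal := ENNReal.summable_toReal π.tsum_coe_ne_top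
  refine tsum_of_norm_bounded (g := fun a => (π a).toReal) ?_ fun a => ?_
  · convert h.hasSum
    rw [← ENNReal.tsum_toReal_eq (fun a => π.apply_ne_top a), π.tsum_coe, ENNReal.toReal_one]
  · rw [norm_mul, RCLike.norm_ofReal, abs_of_nonneg ENNReal.toReal_nonneg]
    exact mul_le_of_le_one_right ENNReal.toReal_nonneg (hφ a)

theorem tsum_pmf_bind_mul (π : PMF α) (κ : α → PMF β) {φ : β → 𝕜} (hφ : ∀ b, ‖φ b‖ ≤ 1) :
    ∑' b, ((π.bind κ b).toReal : 𝕜) * φ b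
      = ∑' a, ((π a).toReal : 𝕜) * ∑' b, ((κ a b).toReal : 𝕜) * φ b := by
  have hs : Summable fun x : α × β => ((π x.1).toReal : 𝕜) * (((κ x.1 x.2).toReal : 𝕜) * φ x.2) := by
    have h1 : Summable fun x : α × β => (π x.1 * κ x.1 x.2).toReal := by
      refine ENNReal.summable_toReal ?_
      rw [ENNReal.tsum_prod (f := fun a b => π a * κ a b)]
      simp_rw [ENNReal.tsum_mul_left, PMF.tsum_coe, mul_one]
      simp
    refine h1.of_norm_bounded fun x => ?_
    rw [norm_mul, norm_mul, RCLike.norm_ofReal, RCLike.norm_ofReal,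
      abs_of_nonneg ENNReal.toReal_nonneg, abs_of_nonneg ENNReal.toReal_nonneg, ENNReal.toReal_mul]
    exact mul_le_mul_of_nonneg_left (mul_le_of_le_one_right ENNReal.toReal_nonneg (hφ _))
      ENNReal.toReal_nonneg
  have hc : ∑' b, ∑' a, ((π a).toReal : 𝕜) * (((κ a b).toReal : 𝕜) * φ b)
      = ∑' a, ∑' b, ((π a).toReal : 𝕜) * (((κ a b).toReal : 𝕜) * φ b) :=
    Summable.tsum_comm (f := fun a b => ((π a).toReal : 𝕜) * (((κ a b).toReal : 𝕜) * φ b)) hs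
  simp_rw [← tsum_mul_left]
  rw [← hc]
  refine tsum_congr fun b => ?_
  rw [PMF.bind_apply, ENNReal.tsum_toReal_eq]
  · rw [RCLike.ofReal_tsum, ← tsum_mul_right]
    exact tsum_congr fun a => by rw [ENNReal.toReal_mul, RCLike.ofReal_mul, mul_assoc]
  · exact fun a => ENNReal.mul_ne_top (π.apply_ne_top a) ((κ a).apply_ne_top b)

theorem tsum_pmf_pure_mul (a : α) (φ : α → 𝕜) :
    ∑' b, ((PMF.pure a b).toReal : 𝕜) * φ b = φ a := by
  rw [tsum_eq_single a]
  · simp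
  · intro b hb; simp [hb]

theorem tsum_pmf_map_mul (π : PMF α) (f : α → β) {φ : β → 𝕜} (hφ : ∀ b, ‖φ b‖ ≤ 1) :
    ∑' b, ((π.map f b).toReal : 𝕜) * φ b = ∑' a, ((π a).toReal : 𝕜) * φ (f a) := by
  rw [← PMF.bind_pure_comp, tsum_pmf_bind_mul _ _ hφ]
  simp_rw [Function.comp_apply, tsum_pmf_pure_mul]

end Expectation

/-! ### Generation sizes and the probability of extinction -/

section Size

/-- The law of a sum of `r` independent variables with law `q`. -/
def total (q : PMF ℕ) : ℕ → PMF ℕ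
  | 0 => PMF.pure 0
  | r + 1 => q.bind fun k => (total q r).map (k + ·)

/-- The generating function of `q`, with values in `ℝ≥0∞`. -/
def egf (q : PMF ℕ) (x : ℝ≥0∞) : ℝ≥0∞ := ∑' k, q k * x ^ k

/-- The generating function of `q` on the unit disc. -/
def pgf {𝕜 : Type} [RCLike 𝕜] (q : PMF ℕ) (z : 𝕜) : 𝕜 := ∑' k, ((q k).toReal : 𝕜) * z ^ k

theorem tsum_total_mul_pow (q : PMF ℕ) (r : ℕ) (x : ℝ≥0∞) :
    ∑' k, total q r k * x ^ k = egf q x ^ r := by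
  induction r with
  | zero => rw [total, tsum_pure_mul]; simp
  | succ r ih =>
    rw [total, tsum_bind_mul]
    simp_rw [tsum_map_mul, pow_add, mul_left_comm _ (x ^ _) (x ^ _), ENNReal.tsum_mul_left, ih]
    simp_rw [← mul_assoc, ENNReal.tsum_mul_right]
    rw [pow_one, mul_comm]; rfl

variable {𝕜 : Type} [RCLike 𝕜]

theorem norm_pow_le_one {z : 𝕜} (hz : ‖z‖ ≤ 1) (k : ℕ) : ‖z ^ k‖ ≤ 1 := by
  rw [norm_pow]; exact pow_le_one₀ (norm_nonneg _) hz

theorem norm_pgf_le_one (q : PMF ℕ) {z : 𝕜} (hz : ‖z‖ ≤ 1) : ‖pgf q z‖ ≤ 1 :=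
  norm_tsum_pmf_mul_le q (norm_pow_le_one hz)

theorem tsum_pmf_total_mul_pow (q : PMF ℕ) (r : ℕ) {z : 𝕜} (hz : ‖z‖ ≤ 1) :
    ∑' k, ((total q r k).toReal : 𝕜) * z ^ k = pgf q z ^ r := by
  induction r with
  | zero => rw [total, tsum_pmf_pure_mul]; simp
  | succ r ih =>
    rw [total, tsum_pmf_bind_mul _ _ (norm_pow_le_one hz)]
    simp_rw [tsum_pmf_map_mul _ _ (norm_pow_le_one hz), pow_add, mul_left_comm _ (z ^ _),
      tsum_mul_left, ih]
    simp_rw [← mul_assoc, tsum_mul_right]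
    rw [pow_one, mul_comm]; rfl

/-- The law of the size of generation `n` of a Galton–Watson tree. -/
def sizeLaw (q : ℕ → PMF ℕ) : ℕ → PMF ℕ
  | 0 => PMF.pure 1
  | n + 1 => (sizeLaw q n).bind (total (q n))

theorem egf_sizeLaw_succ (q : ℕ → PMF ℕ) (n : ℕ) (x : ℝ≥0∞) :
    egf (sizeLaw q (n + 1)) x = egf (sizeLaw q n) (egf (q n) x) := by
  rw [egf, sizeLaw, tsum_bind_mul]
  simp_rw [tsum_total_mul_pow]
  rfl

theorem pgf_sizeLaw_succ (q : ℕ → PMF ℕ) (n : ℕ) {z : 𝕜} (hz : ‖z‖ ≤ 1) :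
    pgf (sizeLaw q (n + 1)) z = pgf (sizeLaw q n) (pgf (q n) z) := by
  rw [pgf, sizeLaw, tsum_pmf_bind_mul _ _ (norm_pow_le_one hz)]
  simp_rw [tsum_pmf_total_mul_pow _ _ hz]
  rfl

theorem pgf_sizeLaw_const (p : PMF ℕ) (n : ℕ) {z : 𝕜} (hz : ‖z‖ ≤ 1) :
    pgf (sizeLaw (fun _ => p) n) z = (pgf p)^[n] z := by
  induction n generalizing z with
  | zero =>
    rw [pgf, sizeLaw, tsum_pmf_pure_mul]; simp
  | succ n ih =>
    rw [pgf_sizeLaw_succ _ _ hz, ih (norm_pgf_le_one p hz), Function.iterate_succ_apply]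

/-- The offspring laws of the untyped tree. -/
def gwStep (q : ℕ → PMF ℕ) (h : ℕ) (g : Gen Unit) : PMF (List (List Unit)) :=
  independent (fun _ => (q h).map fun k => List.replicate k ()) g

theorem gwLaw_eq (q : ℕ → PMF ℕ) :
    gwLaw q = ((chainLaw (PMF.pure ()) (gwStep q)).map treeOfGens).map skeleton := rfl

theorem map_length_independent (q : PMF ℕ) (g : List (List ℕ × Unit)) :
    (independent (fun _ => q.map fun k => List.replicate k ()) g).map
      (fun d => (nextList g d).length) = total q g.length := by
  induction g with
  | nil =>
    rw [independent, PMF.pure_map]; rfl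
  | cons v g ih =>
    rw [independent, PMF.map_bind, PMF.bind_map, List.length_cons, total]
    congr 1
    ext1 k
    rw [Function.comp_apply, PMF.map_comp, ← ih, PMF.map_comp]
    congr 1
    ext1 d
    simp [nextList_cons, length_childrenOf]

theorem map_length_genLaw (q : ℕ → PMF ℕ) (n : ℕ) :
    (genLaw (PMF.pure ()) (gwStep q) n).map (fun g => g.toList.length) = sizeLaw q n := by
  induction n with
  | zero => rw [genLaw, PMF.pure_map, PMF.pure_map]; rfl
  | succ n ih =>
    rw [genLaw, PMF.map_bind, sizeLaw, ← ih, PMF.bind_map]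
    congr 1
    ext1 g
    rw [stepLaw, PMF.map_comp]
    exact map_length_independent (q n) g

theorem map_length_chainLaw (q : ℕ → PMF ℕ) (n : ℕ) :
    (chainLaw (PMF.pure ()) (gwStep q)).map (fun x => (x n).toList.length)
      = (sizeLaw q n).toMeasure := by
  have h : (chainLaw (PMF.pure ()) (gwStep q)).map (fun x => x n)
      = (genLaw (PMF.pure ()) (gwStep q) n).toMeasure := by
    refine Measure.ext_of_singleton fun g => ?_
    rw [Measure.map_apply (measurable_pi_apply n) (MeasurableSet.singleton _),
      PMF.toMeasure_apply_singleton _ _ (MeasurableSet.singleton _), ← chainLaw_apply_eq]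
    rfl
  rw [← map_length_genLaw, ← PMF.toMeasure_map _ _ (measurable_of_countable _), ← h,
    Measure.map_map (g := fun g : Gen Unit => g.toList.length) (f := fun x : ℕ → Gen Unit => x n)
      (measurable_of_countable _) (measurable_pi_apply n)]
  rfl

instance (q : ℕ → PMF ℕ) : IsProbabilityMeasure (gwLaw q) := by
  rw [gwLaw_eq, Measure.map_map measurable_skeleton measurable_treeOfGens]
  exact Measure.isProbabilityMeasure_map
    (measurable_skeleton.comp measurable_treeOfGens).aemeasurable

theorem gwLaw_height_lt_top (q : ℕ → PMF ℕ) :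
    Tendsto (fun n => sizeLaw q n 0) atTop (𝓝 (gwLaw q {t | height t < ⊤})) := by
  set P := chainLaw (PMF.pure ()) (gwStep q)
  have h1 : gwLaw q {t | height t < ⊤} = P {x | ∃ n, (x n).toList.length = 0} := by
    have hm : MeasurableSet {t : Set (List ℕ) | height t < ⊤} := by
      simpa [Set.compl_def, lt_top_iff_ne_top] using measurableSet_height_eq_top.compl
    rw [gwLaw_eq, Measure.map_map measurable_skeleton measurable_treeOfGens,
      Measure.map_apply (measurable_skeleton.comp measurable_treeOfGens) hm]
    refine measure_congr ?_
    filter_upwards [ae_isLevel (PMF.pure ()) (gwStep q)] with x hx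
    have := height_treeOfGens_eq_top_iff hx.1 fun n => (hx.2 n).imp fun d hd => hd.2
    refine propext ?_
    change height (skeleton (treeOfGens x)) < ⊤ ↔ ∃ n, (x n).toList.length = 0
    rw [lt_top_iff_ne_top, Ne, this]
    simp
  have h2 : ∀ n, sizeLaw q n 0 = P {x | (x n).toList.length = 0} := by
    intro n
    rw [← PMF.toMeasure_apply_singleton _ _ (MeasurableSet.singleton _), ← map_length_chainLaw,
      Measure.map_apply (f := fun x : ℕ → Gen Unit => (x n).toList.length)
        ((measurable_of_countable fun g : Gen Unit => g.toList.length).comp (measurable_pi_apply n))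
        (MeasurableSet.singleton _)]
    rfl
  have h3 : P {x | ∃ n, (x n).toList.length = 0}
      = P (⋃ n, {x | ∃ m ≤ n, (x m).toList.length = 0}) := by
    congr 1; ext x
    simp only [Set.mem_ofPred_eq, Set.mem_iUnion]
    exact ⟨fun ⟨n, h⟩ => ⟨n, n, le_rfl, h⟩, fun ⟨_, m, _, h⟩ => ⟨m, h⟩⟩
  rw [h1, h3]
  -- Emptiness of generation `n` is an increasing event only up to a null set. The union over `m ≤
  -- n` has the same probability and is increasing everywhere, as continuity from below requires.
  have h4 : ∀ n, sizeLaw q n 0 = P {x | ∃ m ≤ n, (x m).toList.length = 0} := by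
    intro n
    rw [h2]
    refine measure_congr ?_
    filter_upwards [ae_isLevel (PMF.pure ()) (gwStep q)] with x hx
    refine propext ⟨fun h => ⟨n, le_rfl, h⟩, ?_⟩
    rintro ⟨m, hm, h⟩
    obtain ⟨k, rfl⟩ := Nat.exists_eq_add_of_le hm
    change (x (m + k)).toList.length = 0
    induction k with
    | zero => exact h
    | succ k ih =>
      obtain ⟨d, -, hd⟩ := hx.2 (m + k)
      rw [← add_assoc, hd, toList_nextGen, List.length_eq_zero_iff.1 (ih (by omega)), nextList_nil]
      rfl
  simp_rw [h4]
  refine tendsto_measure_iUnion_atTop fun m n hmn x => ?_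
  rintro ⟨k, hk, h⟩
  exact ⟨k, hk.trans hmn, h⟩

end Size

/-! ### Taylor expansion of the generating function -/

section Shift

/-- The Taylor coefficients at `c` of the generating function of `p`. -/
def shiftCoeff (p : PMF ℕ) (c : ℝ≥0∞) (l : ℕ) : ℝ≥0∞ := ∑' k : ℕ, k.choose l * c ^ (k - l) * p k

theorem add_pow_eq_tsum (c y : ℝ≥0∞) (k : ℕ) :
    (c + y) ^ k = ∑' l : ℕ, k.choose l * c ^ (k - l) * y ^ l := by
  rw [add_comm, add_pow, tsum_eq_sum (s := Finset.range (k + 1))]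
  · exact Finset.sum_congr rfl fun l _ => by ring
  · intro l hl
    rw [Nat.choose_eq_zero_of_lt (by simpa using hl)]; simp

theorem egf_add (p : PMF ℕ) (c y : ℝ≥0∞) :
    egf p (c + y) = ∑' l, shiftCoeff p c l * y ^ l := by
  simp_rw [egf, shiftCoeff, add_pow_eq_tsum, ← ENNReal.tsum_mul_left, ← ENNReal.tsum_mul_right]
  rw [ENNReal.tsum_comm]
  exact tsum_congr fun l => tsum_congr fun k => by ring

theorem egf_mono (p : PMF ℕ) : Monotone (egf p) := fun x y h =>
  ENNReal.tsum_le_tsum fun k => by gcongr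

theorem egf_one (p : PMF ℕ) : egf p 1 = 1 := by simp [egf]

theorem egf_le_one (p : PMF ℕ) {x : ℝ≥0∞} (hx : x ≤ 1) : egf p x ≤ 1 :=
  (egf_mono p hx).trans (egf_one p).le

theorem ofReal_pgf (p : PMF ℕ) {x : ℝ} (hx : 0 ≤ x) (hx1 : x ≤ 1) :
    ENNReal.ofReal (pgf p x) = egf p (ENNReal.ofReal x) := by
  rw [pgf, egf, ENNReal.ofReal_tsum_of_nonneg]
  · refine tsum_congr fun k => ?_
    rw [RCLike.ofReal_real_eq_id, id, ENNReal.ofReal_mul ENNReal.toReal_nonneg,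
      ENNReal.ofReal_toReal (p.apply_ne_top k), ENNReal.ofReal_pow hx]
  · intro k
    rw [RCLike.ofReal_real_eq_id, id]
    positivity
  · exact summable_pmf_mul p (norm_pow_le_one (by rwa [Real.norm_of_nonneg hx]))

/-- Fubini for the double series obtained by expanding `(c + z) ^ k`: the moduli of its terms add up
to `egf p (c + ‖z‖ₑ) ≤ 1`. -/
theorem hasSum_shiftCoeff {𝕜 : Type} [RCLike 𝕜] (p : PMF ℕ) {c : ℝ≥0∞} {z : 𝕜}
    (hz : c + ‖z‖ₑ ≤ 1) :
    HasSum (fun l => ((shiftCoeff p c l).toReal : 𝕜) * z ^ l) (pgf p ((c.toReal : 𝕜) + z)) := by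
  have hc : c ≠ ⊤ := ne_top_of_le_ne_top ENNReal.one_ne_top (le_self_add.trans hz)
  set F : ℕ × ℕ → 𝕜 := fun x =>
    ((p x.1).toReal : 𝕜) * ((x.1.choose x.2 : 𝕜) * (c.toReal : 𝕜) ^ (x.1 - x.2) * z ^ x.2)
  have hF : ∀ x : ℕ × ℕ, ‖F x‖ₑ = p x.1 * (x.1.choose x.2 * c ^ (x.1 - x.2) * ‖z‖ₑ ^ x.2) := by
    intro x
    have h1 : ∀ r : ℝ≥0∞, r ≠ ⊤ → ‖(r.toReal : 𝕜)‖ₑ = r := by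
      intro r hr
      rw [enorm_eq_iff_norm_eq.2 (by simp : ‖(r.toReal : 𝕜)‖ = ‖r.toReal‖),
        Real.enorm_of_nonneg ENNReal.toReal_nonneg, ENNReal.ofReal_toReal hr]
    have h2 : ∀ n : ℕ, ‖(n : 𝕜)‖ₑ = n := by
      intro n
      have := h1 n (ENNReal.natCast_ne_top n)
      simpa using this
    simp only [F, enorm_mul, enorm_pow, h1 _ (p.apply_ne_top x.1), h1 _ hc, h2]
  have hs : Summable F := by
    refine Summable.of_enorm ?_
    simp_rw [hF]
    rw [ENNReal.tsum_prod (f := fun k l => p k * (k.choose l * c ^ (k - l) * ‖z‖ₑ ^ l))]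
    simp_rw [ENNReal.tsum_mul_left, ← add_pow_eq_tsum]
    exact ne_top_of_le_ne_top ENNReal.one_ne_top (egf_le_one p hz)
  have h1 : ∀ k, HasSum (fun l => F (k, l)) (((p k).toReal : 𝕜) * ((c.toReal : 𝕜) + z) ^ k) := by
    intro k
    refine HasSum.mul_left _ ?_
    rw [add_comm, add_pow]
    convert! hasSum_sum_of_ne_finset_zero (s := Finset.range (k + 1)) (L := .unconditional ℕ)
      (f := fun l => (k.choose l : 𝕜) * (c.toReal : 𝕜) ^ (k - l) * z ^ l) ?_ using 1
    · exact Finset.sum_congr rfl fun l _ => by ring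
    · intro l hl
      rw [Nat.choose_eq_zero_of_lt (by simpa using hl)]; simp
  have h2 : HasSum F (pgf p ((c.toReal : 𝕜) + z)) := by
    have := hs.hasSum.prod_fiberwise h1
    rw [pgf, this.tsum_eq]
    exact hs.hasSum
  have h3 : ∀ l, HasSum (fun k => F (k, l)) (((shiftCoeff p c l).toReal : 𝕜) * z ^ l) := by
    intro l
    by_cases hz0 : z ^ l = 0
    · simp [F, hz0]
    have hsl : Summable fun k => F (k, l) := hs.comp_injective (i := fun k => (k, l)) fun a b h => by
      simpa using h
    have h4 : ∀ k, (k.choose l * c ^ (k - l) * p k : ℝ≥0∞) ≠ ⊤ := fun k => by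
      refine ENNReal.mul_ne_top (ENNReal.mul_ne_top (ENNReal.natCast_ne_top _)
        (ENNReal.pow_ne_top hc)) (p.apply_ne_top k)
    rw [shiftCoeff, ENNReal.tsum_toReal_eq h4, RCLike.ofReal_tsum, ← tsum_mul_right]
    convert! hsl.hasSum using 1
    refine tsum_congr fun k => ?_
    simp only [F, ENNReal.toReal_mul, ENNReal.toReal_pow, ENNReal.toReal_natCast]
    push_cast; ring
  exact (((Equiv.prodComm ℕ ℕ).hasSum_iff.2 h2).prod_fiberwise h3)

/-- A single term of the expansion at `c` of `egf p 1 = 1` is at most 1. -/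
theorem shiftCoeff_ne_top (p : PMF ℕ) {c : ℝ≥0∞} (hc : c < 1) (l : ℕ) :
    shiftCoeff p c l ≠ ⊤ := by
  have h : shiftCoeff p c l * (1 - c) ^ l ≤ 1 := by
    refine le_trans ?_ (egf_le_one p (le_of_eq (add_tsub_cancel_of_le hc.le)))
    rw [egf_add]
    exact ENNReal.le_tsum (f := fun l => shiftCoeff p c l * (1 - c) ^ l) l
  intro h'
  rw [h', ENNReal.top_mul] at h
  · simp at h
  · exact pow_ne_zero _ (tsub_pos_of_lt hc).ne'

theorem genFun_eq_pgf (p : PMF ℕ) : genFun p = pgf p := by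
  ext x; simp [genFun, pgf]

/-- The expansion at 𝔠 converges on the ball of radius `(1 - 𝔠) / 2`, so uniqueness of power series
identifies its coefficients with the derivatives. From here on the coefficients are nonnegative
series in `ℝ≥0∞`, free of derivatives. -/
theorem taylorCoeff_eq (p : PMF ℕ) (h1 : extProb p < 1) (l : ℕ) :
    taylorCoeff p l = shiftCoeff p (extProb p) l := by
  set c := extProb p with hc
  have hct : c ≠ ⊤ := h1.ne_top
  set ρ : ℝ := (1 - c.toReal) / 2
  have hc1 : c.toReal < 1 := by
    rw [← ENNReal.toReal_one]; exact (ENNReal.toReal_lt_toReal hct ENNReal.one_ne_top).2 h1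
  have hρ : 0 < ρ := by simp only [ρ]; linarith
  have hle : ∀ y : ℝ, |y| ≤ ρ → c + ‖y‖ₑ ≤ 1 := by
    intro y hy
    rw [← ofReal_norm, Real.norm_eq_abs, ← ENNReal.ofReal_toReal hct, ← ENNReal.ofReal_add
      ENNReal.toReal_nonneg (abs_nonneg _), ← ENNReal.ofReal_one]
    refine ENNReal.ofReal_le_ofReal ?_
    simp only [ρ] at hy; linarith
  have hps : HasFPowerSeriesOnBall (genFun p)
      (FormalMultilinearSeries.ofScalars ℝ fun l => (shiftCoeff p c l).toReal) c.toReal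
      (ENNReal.ofReal ρ) := by
    refine ⟨?_, by simpa using hρ, ?_⟩
    · have := (hasSum_shiftCoeff p (hle ρ (by rw [abs_of_pos hρ]))).summable
      refine FormalMultilinearSeries.le_radius_of_summable_norm (r := ρ.toNNReal) _ ?_
      convert! this using 1
      ext n
      rw [FormalMultilinearSeries.ofScalars_norm, Real.norm_of_nonneg ENNReal.toReal_nonneg,
        Real.coe_toNNReal _ hρ.le]
      rfl
    · intro y hy
      have hy' : |y| ≤ ρ := by
        rw [Metric.eball_ofReal] at hy
        have h := Metric.mem_ball.1 hy
        rw [Real.dist_eq, sub_zero] at h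
        exact h.le
      rw [genFun_eq_pgf]
      convert! hasSum_shiftCoeff p (hle y hy') using 1
      ext n
      rw [FormalMultilinearSeries.ofScalars_apply_eq]
      simp
  have h := hps.factorial_smul 1 l
  rw [FormalMultilinearSeries.ofScalars_apply_eq] at h
  rw [taylorCoeff, iteratedDeriv, ← h]
  simp only [one_pow, smul_eq_mul, mul_one, nsmul_eq_mul]
  rw [mul_div_cancel_left₀ _ (by positivity), ENNReal.ofReal_toReal (shiftCoeff_ne_top p h1 l)]

end Shift

/-! ### Fixed points of the generating function -/

section FixedPoint

variable {p : PMF ℕ}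

theorem hasSum_toReal_pmf (p : PMF ℕ) : HasSum (fun k => (p k).toReal) 1 := by
  convert! (ENNReal.summable_toReal p.tsum_coe_ne_top).hasSum
  rw [← ENNReal.tsum_toReal_eq (fun a => p.apply_ne_top a), p.tsum_coe, ENNReal.toReal_one]

theorem hasSum_pgf {𝕜 : Type} [RCLike 𝕜] (p : PMF ℕ) {z : 𝕜} (hz : ‖z‖ ≤ 1) :
    HasSum (fun k => ((p k).toReal : 𝕜) * z ^ k) (pgf p z) :=
  (summable_pmf_mul p (norm_pow_le_one hz)).hasSum

theorem hasSum_pgf_real (p : PMF ℕ) {x : ℝ} (h0 : 0 ≤ x) (h1 : x ≤ 1) :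
    HasSum (fun k => (p k).toReal * x ^ k) (pgf p x) := by
  simpa using hasSum_pgf p (z := x) (by rwa [Real.norm_of_nonneg h0])

theorem pgf_nonneg (p : PMF ℕ) {x : ℝ} (h0 : 0 ≤ x) (h1 : x ≤ 1) : 0 ≤ pgf p x :=
  (hasSum_pgf_real p h0 h1).nonneg fun k => by positivity

theorem pgf_le_one (p : PMF ℕ) {x : ℝ} (h0 : 0 ≤ x) (h1 : x ≤ 1) : pgf p x ≤ 1 :=
  (le_abs_self _).trans (norm_pgf_le_one p (by rwa [Real.norm_of_nonneg h0]))

theorem pgf_le_pgf (p : PMF ℕ) {x y : ℝ} (h0 : 0 ≤ x) (hxy : x ≤ y) (h1 : y ≤ 1) :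
    pgf p x ≤ pgf p y :=
  hasSum_le (fun k => by gcongr) (hasSum_pgf_real p h0 (hxy.trans h1))
    (hasSum_pgf_real p (h0.trans hxy) h1)

theorem continuousOn_pgf {𝕜 : Type} [RCLike 𝕜] (p : PMF ℕ) :
    ContinuousOn (pgf p : 𝕜 → 𝕜) (Metric.closedBall 0 1) := by
  refine continuousOn_tsum (u := fun k => (p k).toReal) (fun k => by fun_prop)
    (hasSum_toReal_pmf p).summable fun k z hz => ?_
  rw [norm_mul, RCLike.norm_ofReal, abs_of_nonneg ENNReal.toReal_nonneg]
  exact mul_le_of_le_one_right ENNReal.toReal_nonneg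
    (norm_pow_le_one (by simpa using hz) k)

theorem exists_two_le (hsup : 1 < mean p) : ∃ k, 2 ≤ k ∧ p k ≠ 0 := by
  by_contra! h
  refine hsup.not_ge ?_
  rw [mean, ← p.tsum_coe]
  refine ENNReal.tsum_le_tsum fun k => ?_
  rcases Nat.lt_or_ge k 2 with hk | hk
  · interval_cases k <;> simp
  · simp [h k hk]

theorem pgf_lt_pgf (hsup : 1 < mean p) {x y : ℝ} (h0 : 0 ≤ x) (hxy : x < y) (h1 : y ≤ 1) :
    pgf p x < pgf p y := by
  obtain ⟨k, hk, hpk⟩ := exists_two_le hsup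
  refine hasSum_lt (i := k) (fun k => by gcongr) ?_ (hasSum_pgf_real p h0 (hxy.le.trans h1))
    (hasSum_pgf_real p (h0.trans hxy.le) h1)
  have : 0 < (p k).toReal := ENNReal.toReal_pos hpk (p.apply_ne_top k)
  have := pow_lt_pow_left₀ hxy h0 (by omega : k ≠ 0)
  gcongr

/-- The slope of the generating function between `x` and `1`. -/
def slopeOne (p : PMF ℕ) (x : ℝ) : ℝ := ∑' k, (p k).toReal * ∑ j ∈ Finset.range k, x ^ j

theorem hasSum_mean (hfin : mean p < ⊤) :
    HasSum (fun k => (p k).toReal * k) (mean p).toReal := by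
  have h : ∀ k : ℕ, (k : ℝ≥0∞) * p k ≠ ⊤ := fun k =>
    ENNReal.mul_ne_top (ENNReal.natCast_ne_top k) (p.apply_ne_top k)
  rw [mean, ENNReal.tsum_toReal_eq h]
  convert! (ENNReal.summable_toReal (f := fun k : ℕ => (k : ℝ≥0∞) * p k) hfin.ne).hasSum using 1
  ext k
  rw [ENNReal.toReal_mul, mul_comm]; simp

theorem sum_pow_le {x : ℝ} (h0 : 0 ≤ x) (h1 : x ≤ 1) (k : ℕ) :
    ∑ j ∈ Finset.range k, x ^ j ≤ k := by
  calc ∑ j ∈ Finset.range k, x ^ j ≤ ∑ j ∈ Finset.range k, (1 : ℝ) :=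
        Finset.sum_le_sum fun j _ => pow_le_one₀ h0 h1
    _ = k := by simp

theorem hasSum_slopeOne (hfin : mean p < ⊤) {x : ℝ} (h0 : 0 ≤ x) (h1 : x ≤ 1) :
    HasSum (fun k => (p k).toReal * ∑ j ∈ Finset.range k, x ^ j) (slopeOne p x) := by
  refine Summable.hasSum ((hasSum_mean hfin).summable.of_nonneg_of_le (fun k => ?_) fun k => ?_)
  · exact mul_nonneg ENNReal.toReal_nonneg (Finset.sum_nonneg fun j _ => by positivity)
  · exact mul_le_mul_of_nonneg_left (sum_pow_le h0 h1 k) ENNReal.toReal_nonneg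

theorem one_sub_pgf (hfin : mean p < ⊤) {x : ℝ} (h0 : 0 ≤ x) (h1 : x ≤ 1) :
    1 - pgf p x = (1 - x) * slopeOne p x := by
  refine ((hasSum_toReal_pmf p).sub (hasSum_pgf_real p h0 h1)).unique ?_
  convert! (hasSum_slopeOne hfin h0 h1).mul_left (1 - x) using 1
  ext k
  have := geom_sum_mul x k
  linear_combination (p k).toReal * (this)

theorem tendsto_slopeOne (hfin : mean p < ⊤) {ι : Type} {l : Filter ι} {x : ι → ℝ}
    (hx : Tendsto x l (𝓝 1)) (h0 : ∀ᶠ i in l, 0 ≤ x i) (h1 : ∀ᶠ i in l, x i ≤ 1) :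
    Tendsto (fun i => slopeOne p (x i)) l (𝓝 (mean p).toReal) := by
  rw [← (hasSum_mean hfin).tsum_eq]
  refine tendsto_tsum_of_dominated_convergence (hasSum_mean hfin).summable (fun k => ?_) ?_
  · have : Tendsto (fun i => (p k).toReal * ∑ j ∈ Finset.range k, x i ^ j) l
        (𝓝 ((p k).toReal * ∑ j ∈ Finset.range k, 1 ^ j)) :=
      (tendsto_finsetSum _ fun j _ => hx.pow j).const_mul _
    simpa using this
  · filter_upwards [h0, h1] with i h0 h1 k
    rw [Real.norm_of_nonneg (mul_nonneg ENNReal.toReal_nonneg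
      (Finset.sum_nonneg fun j _ => by positivity))]
    exact mul_le_mul_of_nonneg_left (sum_pow_le h0 h1 k) ENNReal.toReal_nonneg

/-- Strict convexity: some `k ≥ 2` is charged by `p`, and its geometric sum contains the strictly
increasing term `x ^ 1`. -/
theorem slopeOne_lt (hsup : 1 < mean p) (hfin : mean p < ⊤) {x y : ℝ} (h0 : 0 ≤ x) (hxy : x < y)
    (h1 : y ≤ 1) : slopeOne p x < slopeOne p y := by
  obtain ⟨k, hk, hpk⟩ := exists_two_le hsup
  refine hasSum_lt (i := k) (fun k => ?_) ?_ (hasSum_slopeOne hfin h0 (hxy.le.trans h1))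
    (hasSum_slopeOne hfin (h0.trans hxy.le) h1)
  · exact mul_le_mul_of_nonneg_left (Finset.sum_le_sum fun j _ => by gcongr) ENNReal.toReal_nonneg
  · have : 0 < (p k).toReal := ENNReal.toReal_pos hpk (p.apply_ne_top k)
    refine mul_lt_mul_of_pos_left (Finset.sum_lt_sum (fun j _ => by gcongr)
      ⟨1, by simp; omega, by simpa⟩) this

/-- At a fixed point below 1 the chord to 1 has slope 1; to the right of it the slope exceeds 1,
which puts the graph below the diagonal. -/
theorem pgf_lt_self_of_fixed (hsup : 1 < mean p) (hfin : mean p < ⊤) {c x : ℝ} (h0 : 0 ≤ c)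
    (hc : pgf p c = c) (hcx : c < x) (h1 : x < 1) : pgf p x < x := by
  have h2 := one_sub_pgf hfin h0 (hcx.trans h1).le
  have h3 := one_sub_pgf hfin (h0.trans hcx.le) h1.le
  have h4 := slopeOne_lt hsup hfin h0 hcx h1.le
  rw [hc] at h2
  have h5 : slopeOne p c = 1 := by
    have : (1 - c) ≠ 0 := by linarith
    field_simp at h2
    linarith
  nlinarith

instance (p : PMF ℕ) : IsProbabilityMeasure (gw p) :=
  inferInstanceAs (IsProbabilityMeasure (gwLaw fun _ => p))

theorem extProb_le_one (p : PMF ℕ) : extProb p ≤ 1 := prob_le_one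

theorem tendsto_iterate_pgf_zero (p : PMF ℕ) :
    Tendsto (fun n => (pgf p)^[n] (0 : ℝ)) atTop (𝓝 (extProb p).toReal) := by
  have h := gwLaw_height_lt_top fun _ => p
  have h2 := (ENNReal.tendsto_toReal (prob_le_one.trans_lt ENNReal.one_lt_top).ne).comp h
  refine h2.congr fun n => ?_
  rw [← pgf_sizeLaw_const p n (by simp), pgf, tsum_eq_single 0]
  · simp
  · intro k hk; simp [hk]

theorem pgf_extProb (p : PMF ℕ) : pgf p (extProb p).toReal = (extProb p).toReal := by
  have h1 : ∀ n, (pgf p)^[n] (0 : ℝ) ∈ Metric.closedBall (0 : ℝ) 1 := by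
    intro n
    rw [← pgf_sizeLaw_const p n (by simp)]
    simpa using norm_pgf_le_one (sizeLaw (fun _ => p) n) (z := (0 : ℝ)) (by simp)
  have h2 := tendsto_iterate_pgf_zero p
  have h3 : (extProb p).toReal ∈ Metric.closedBall (0 : ℝ) 1 :=
    Metric.isClosed_closedBall.mem_of_tendsto h2 (Eventually.of_forall h1)
  have h4 := (continuousOn_pgf p _ h3).tendsto.comp
    (tendsto_nhdsWithin_iff.2 ⟨h2, Eventually.of_forall h1⟩)
  refine tendsto_nhds_unique h4 ?_
  refine ((tendsto_add_atTop_iff_nat 1).2 h2).congr fun n => ?_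
  rw [Function.iterate_succ_apply']; rfl

theorem extProb_le_of_fixed (p : PMF ℕ) {x : ℝ} (h0 : 0 ≤ x) (h1 : x ≤ 1) (hx : pgf p x = x) :
    (extProb p).toReal ≤ x := by
  refine le_of_tendsto (tendsto_iterate_pgf_zero p) (Eventually.of_forall fun n => ?_)
  rw [← Function.iterate_fixed hx n, ← pgf_sizeLaw_const p n (by simp),
    ← pgf_sizeLaw_const p n (by rwa [Real.norm_of_nonneg h0])]
  exact pgf_le_pgf _ le_rfl h0 h1

/-- The tool that evaluates limits below: a fixed point in `[0, 1]` is either 𝔠 or 1, so one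
inequality decides which. -/
theorem eq_extProb_of_fixed (hsup : 1 < mean p) (hfin : mean p < ⊤) {x : ℝ} (h0 : 0 ≤ x)
    (h1 : x < 1) (hx : pgf p x = x) : x = (extProb p).toReal := by
  refine ((extProb_le_of_fixed p h0 h1.le hx).eq_or_lt.resolve_right fun h => ?_).symm
  have := pgf_lt_self_of_fixed hsup hfin ENNReal.toReal_nonneg (pgf_extProb p) h h1
  exact this.ne hx

theorem egf_extProb (p : PMF ℕ) : egf p (extProb p) = extProb p := by
  have h := ofReal_pgf p (x := (extProb p).toReal) ENNReal.toReal_nonneg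
    (by simpa using ENNReal.toReal_mono ENNReal.one_ne_top (extProb_le_one p))
  rw [pgf_extProb, ENNReal.ofReal_toReal
    ((extProb_le_one p).trans_lt ENNReal.one_lt_top).ne] at h
  exact h.symm

theorem egf_lt_self (hsup : 1 < mean p) (hfin : mean p < ⊤) {x : ℝ≥0∞} (hcx : extProb p < x)
    (h1 : x < 1) : egf p x < x := by
  have hx : x ≠ ⊤ := h1.ne_top
  have hx1 : x.toReal < 1 := by
    simpa using (ENNReal.toReal_lt_toReal hx ENNReal.one_ne_top).2 h1
  rw [← ENNReal.ofReal_toReal hx, ← ofReal_pgf p ENNReal.toReal_nonneg hx1.le]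
  refine (ENNReal.ofReal_lt_ofReal_iff_of_nonneg (pgf_nonneg p ENNReal.toReal_nonneg hx1.le)).2 ?_
  exact pgf_lt_self_of_fixed hsup hfin ENNReal.toReal_nonneg (pgf_extProb p)
    ((ENNReal.toReal_lt_toReal hcx.ne_top hx).2 hcx) hx1

end FixedPoint

/-! ### The generating function seen from its fixed point 𝔠 -/

section Survivors

variable {p : PMF ℕ}

/-- The Taylor coefficients at `𝔠` of the generating function, without the constant one. -/
def survCoeff (p : PMF ℕ) (l : ℕ) : ℝ≥0∞ := if 1 ≤ l then taylorCoeff p l else 0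

/-- The function `f (𝔠 + y) - 𝔠`, as a power series. -/
def sgf (p : PMF ℕ) (y : ℝ≥0∞) : ℝ≥0∞ := ∑' l, survCoeff p l * y ^ l

theorem survCoeff_ne_top (p : PMF ℕ) (l : ℕ) : survCoeff p l ≠ ⊤ := by
  rw [survCoeff]; split_ifs
  · exact ENNReal.ofReal_ne_top
  · simp

theorem taylorCoeff_zero (h1 : extProb p < 1) : taylorCoeff p 0 = extProb p := by
  rw [taylorCoeff_eq p h1, shiftCoeff]
  simp only [Nat.choose_zero_right, Nat.cast_one, one_mul, Nat.sub_zero]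
  conv_rhs => rw [← egf_extProb p]
  exact tsum_congr fun k => mul_comm _ _

/-- The constant coefficient at 𝔠 is `f(𝔠) = 𝔠`; the remaining ones make up `sgf`. -/
theorem egf_extProb_add (h1 : extProb p < 1) (y : ℝ≥0∞) :
    egf p (extProb p + y) = extProb p + sgf p y := by
  have h : sgf p y = ∑' l, survCoeff p (l + 1) * y ^ (l + 1) := by
    rw [sgf, tsum_eq_zero_add' ENNReal.summable]; simp [survCoeff]
  rw [egf_add, h, tsum_eq_zero_add' ENNReal.summable]
  simp [survCoeff, ← taylorCoeff_eq p h1, taylorCoeff_zero h1]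

theorem hasSum_survCoeff {𝕜 : Type} [RCLike 𝕜] (h1 : extProb p < 1) {z : 𝕜}
    (hz : extProb p + ‖z‖ₑ ≤ 1) :
    HasSum (fun l => ((survCoeff p l).toReal : 𝕜) * z ^ l)
      (pgf p (((extProb p).toReal : 𝕜) + z) - (extProb p).toReal) := by
  have h := hasSum_shiftCoeff p hz
  rw [← hasSum_nat_add_iff' 1] at h ⊢
  simpa [survCoeff, ← taylorCoeff_eq p h1, taylorCoeff_zero h1] using h

theorem sgf_one_sub (h1 : extProb p < 1) : sgf p (1 - extProb p) = 1 - extProb p := by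
  have := egf_extProb_add h1 (1 - extProb p)
  rw [add_tsub_cancel_of_le h1.le, egf_one] at this
  exact ENNReal.eq_sub_of_add_eq h1.ne_top (by rw [add_comm]; exact this.symm)

/-- Without constant term and with nonnegative coefficients, `sgf p y / y` is nondecreasing, so its
value at `r` serves as κ. It is below 1 because `f(x) < x` on `(𝔠, 1)`. -/
theorem exists_sgf_le_mul (hsup : 1 < mean p) (hfin : mean p < ⊤) (h1 : extProb p < 1)
    {r : ℝ≥0∞} (hr0 : r ≠ 0) (hr : extProb p + r < 1) :
    ∃ κ : ℝ≥0∞, κ < 1 ∧ ∀ y ≤ r, sgf p y ≤ κ * y := by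
  have hrt : r ≠ ⊤ := (lt_of_le_of_lt le_add_self hr).ne_top
  have h2 : sgf p r < r := by
    have := egf_lt_self hsup hfin (ENNReal.lt_add_right h1.ne_top hr0) hr
    rw [egf_extProb_add h1] at this
    exact (ENNReal.add_lt_add_iff_left h1.ne_top).1 this
  refine ⟨sgf p r / r, ?_, fun y hy => ?_⟩
  · exact (ENNReal.div_lt_iff (Or.inl hr0) (Or.inl hrt)).2 (by simpa using h2)
  · rw [ENNReal.div_eq_inv_mul, mul_assoc, mul_comm, ← div_eq_mul_inv,
      ENNReal.le_div_iff_mul_le (Or.inl hr0) (Or.inl hrt), sgf, sgf, ← ENNReal.tsum_mul_right,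
      ← ENNReal.tsum_mul_right]
    refine ENNReal.tsum_le_tsum fun l => ?_
    rcases l with _ | l
    · simp [survCoeff]
    · rw [mul_assoc, mul_assoc, pow_succ, pow_succ, mul_assoc, mul_assoc, mul_comm y r]
      gcongr

end Survivors

/-! ### The limit of the normalised generation sizes -/

section Limit

variable {p : PMF ℕ} {c : ℕ → ℝ}

/-- Adaptedness of the martingale makes `exp (-Z n / c n)` measurable; a logarithm recovers `Z n` as
a real number, and the floor brings it back to `ℕ`. -/
theorem IsSenetaHeyde.measurable_genSize (hc : IsSenetaHeyde p c) (n : ℕ) :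
    Measurable (genSize n) := by
  have h1 : Measurable fun t => Real.exp (-((genSize n t : ℝ) / c n)) :=
    ((hc.martingale.stronglyAdapted n).measurable).mono (treeFiltration.le n) le_rfl
  have h2 : genSize n = fun t => ⌊-(c n) * Real.log (Real.exp (-((genSize n t : ℝ) / c n)))⌋₊ := by
    ext t
    have := (hc.pos n).ne'
    rw [Real.log_exp, show -c n * -((genSize n t : ℝ) / c n) = genSize n t by field_simp,
      Nat.floor_natCast]
  rw [h2]
  exact Nat.measurable_floor.comp ((Real.measurable_log.comp h1).const_mul _)

theorem IsSenetaHeyde.map_genSize (hc : IsSenetaHeyde p c) (n : ℕ) :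
    (gw p).map (genSize n) = (sizeLaw (fun _ => p) n).toMeasure := by
  have hm := hc.measurable_genSize n
  rw [gw, gwLaw_eq, Measure.map_map measurable_skeleton measurable_treeOfGens,
    Measure.map_map hm (measurable_skeleton.comp measurable_treeOfGens), ← map_length_chainLaw]
  refine Measure.map_congr ?_
  filter_upwards [ae_isLevel (PMF.pure ()) (gwStep fun _ => p)] with x hx
  exact genSize_treeOfGens hx.1 n

theorem IsSenetaHeyde.integral_pow_genSize {𝕜 : Type} [RCLike 𝕜] (hc : IsSenetaHeyde p c) (n : ℕ)
    {z : 𝕜} (hz : ‖z‖ ≤ 1) : ∫ t, z ^ genSize n t ∂gw p = (pgf p)^[n] z := by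
  have h : ∫ t, z ^ genSize n t ∂gw p = ∫ k, z ^ k ∂(gw p).map (genSize n) :=
    (integral_map (f := fun k : ℕ => z ^ k) (hc.measurable_genSize n).aemeasurable
      (measurable_of_countable _).aestronglyMeasurable).symm
  rw [h, hc.map_genSize, PMF.integral_eq_tsum, ← pgf_sizeLaw_const p n hz, pgf]
  · exact tsum_congr fun k => RCLike.real_smul_eq_coe_mul _ _
  · refine Integrable.of_bound (measurable_of_countable _).aestronglyMeasurable 1
      (ae_of_all _ fun k => norm_pow_le_one hz k)

/-- The base `exp (- 1 / c n)` of the martingale. -/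
def normBase (c : ℕ → ℝ) (n : ℕ) : ℝ := Real.exp (-(1 / c n))

theorem exp_genSize_eq (c : ℕ → ℝ) (n k : ℕ) :
    Real.exp (-((k : ℝ) / c n)) = normBase c n ^ k := by
  rw [normBase, ← Real.exp_nat_mul]; congr 1; ring

theorem normBase_pos (c : ℕ → ℝ) (n : ℕ) : 0 < normBase c n := Real.exp_pos _

theorem IsSenetaHeyde.normBase_lt_one (hc : IsSenetaHeyde p c) (n : ℕ) : normBase c n < 1 := by
  have := hc.pos n
  rw [normBase, Real.exp_lt_one_iff]
  simpa using this

theorem IsSenetaHeyde.log_normBase (n : ℕ) : Real.log (normBase c n) = -(1 / c n) := Real.log_exp _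

theorem IsSenetaHeyde.iterate_normBase (hc : IsSenetaHeyde p c) (n : ℕ) :
    (pgf p)^[n] (normBase c n) = normBase c 0 := by
  have h1 : ∀ n, ∫ t, Real.exp (-((genSize n t : ℝ) / c n)) ∂gw p
      = (pgf p)^[n] (normBase c n) := by
    intro n
    simp_rw [exp_genSize_eq]
    exact hc.integral_pow_genSize n (by
      rw [Real.norm_of_nonneg (normBase_pos c n).le]; exact (hc.normBase_lt_one n).le)
  have h2 := hc.martingale.setIntegral_eq (Nat.zero_le n) (s := Set.univ) MeasurableSet.univ
  rw [setIntegral_univ, setIntegral_univ, h1, h1] at h2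
  exact h2.symm

theorem mapsTo_pgf (p : PMF ℕ) : Set.MapsTo (pgf p) (Set.Icc (0 : ℝ) 1) (Set.Icc 0 1) :=
  fun _ hx => ⟨pgf_nonneg p hx.1 hx.2, pgf_le_one p hx.1 hx.2⟩

theorem IsSenetaHeyde.normBase_mem (hc : IsSenetaHeyde p c) (n : ℕ) :
    normBase c n ∈ Set.Icc (0 : ℝ) 1 := ⟨(normBase_pos c n).le, (hc.normBase_lt_one n).le⟩

/-- Constancy of the expectation says that the `n`-th iterate of `f` sends `normBase c n` to
`normBase c 0`. Comparing ranks `n` and `n + 1` and cancelling `n` iterates, by injectivity of `f`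
on `[0, 1]`, leaves one step. -/
theorem IsSenetaHeyde.pgf_normBase_succ (hc : IsSenetaHeyde p c) (hsup : 1 < mean p) (n : ℕ) :
    pgf p (normBase c (n + 1)) = normBase c n := by
  have hinj : Set.InjOn (pgf p) (Set.Icc (0 : ℝ) 1) :=
    StrictMonoOn.injOn fun x hx y hy hxy => pgf_lt_pgf hsup hx.1 hxy hy.2
  refine hinj.iterate (mapsTo_pgf p) n (mapsTo_pgf p (hc.normBase_mem _)) (hc.normBase_mem n) ?_
  rw [hc.iterate_normBase, ← Function.iterate_succ_apply, hc.iterate_normBase]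

theorem IsSenetaHeyde.lt_normBase (hc : IsSenetaHeyde p c) (hsup : 1 < mean p) (n : ℕ) :
    (extProb p).toReal < normBase c n := by
  induction n with
  | zero => exact hc.extProb_lt
  | succ n ih =>
    by_contra! h
    have := pgf_le_pgf p (normBase_pos c _).le h
      (by simpa using ENNReal.toReal_mono ENNReal.one_ne_top (extProb_le_one p))
    rw [hc.pgf_normBase_succ hsup, pgf_extProb] at this
    linarith

/-- The sequence is a backward orbit of `f` in `(𝔠, 1)`, hence increasing, and its limit is a fixed
point above 𝔠. -/
theorem IsSenetaHeyde.tendsto_normBase (hc : IsSenetaHeyde p c) (hsup : 1 < mean p)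
    (hfin : mean p < ⊤) : Tendsto (normBase c) atTop (𝓝 1) := by
  have hlt := hc.lt_normBase hsup
  have hmono : Monotone (normBase c) := monotone_nat_of_le_succ fun n => by
    rw [← hc.pgf_normBase_succ hsup n]
    exact (pgf_lt_self_of_fixed hsup hfin ENNReal.toReal_nonneg (pgf_extProb p) (hlt _)
      (hc.normBase_lt_one _)).le
  have hbdd : BddAbove (Set.range (normBase c)) :=
    ⟨1, by rintro _ ⟨n, rfl⟩; exact (hc.normBase_lt_one n).le⟩
  have hl := tendsto_atTop_ciSup hmono hbdd
  set a := ⨆ n, normBase c n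
  have ha : a ∈ Set.Icc (0 : ℝ) 1 :=
    isClosed_Icc.mem_of_tendsto hl (Eventually.of_forall hc.normBase_mem)
  have hb : Set.Icc (0 : ℝ) 1 ⊆ Metric.closedBall 0 1 := fun x hx => by
    simpa [abs_of_nonneg hx.1] using hx.2
  have h1 := ((continuousOn_pgf p).mono hb a ha).tendsto.comp (tendsto_nhdsWithin_iff.2
    ⟨(tendsto_add_atTop_iff_nat 1).2 hl, Eventually.of_forall fun n => hc.normBase_mem (n + 1)⟩)
  have h2 : pgf p a = a := by
    refine tendsto_nhds_unique h1 (hl.congr fun n => ?_)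
    exact (hc.pgf_normBase_succ hsup n).symm
  rcases ha.2.lt_or_eq with h | h
  · have h3 := eq_extProb_of_fixed hsup hfin ha.1 h h2
    have h4 := hmono.ge_of_tendsto hl 0
    have := hlt 0
    linarith
  · rwa [h] at hl

/-- With `b n = normBase c n` tending to 1, `1 / c n = -log (b n)` is equivalent to `1 - b n`, and
`1 - b n = (1 - b (n + 1)) * slopeOne p (b (n + 1))`, whose last factor tends to μ. -/
theorem IsSenetaHeyde.tendsto_ratio (hc : IsSenetaHeyde p c) (hsup : 1 < mean p)
    (hfin : mean p < ⊤) :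
    Tendsto (fun n => c n / c (n + 1)) atTop (𝓝 ((mean p).toReal)⁻¹) := by
  have hx := hc.tendsto_normBase hsup hfin
  have hx' : Tendsto (normBase c) atTop (𝓝[≠] 1) := tendsto_nhdsWithin_iff.2
    ⟨hx, Eventually.of_forall fun n => (hc.normBase_lt_one n).ne⟩
  have h1 := (hasDerivAt_iff_tendsto_slope.1 (Real.hasDerivAt_log one_ne_zero)).comp hx'
  rw [inv_one] at h1
  have h2 := (tendsto_add_atTop_iff_nat 1).2 h1
  have h3 := tendsto_slopeOne hfin ((tendsto_add_atTop_iff_nat 1).2 hx)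
    (Eventually.of_forall fun n => (normBase_pos c _).le)
    (Eventually.of_forall fun n => (hc.normBase_lt_one _).le)
  have hmu : (mean p).toReal ≠ 0 := (ENNReal.toReal_pos (zero_lt_one.trans hsup).ne' hfin.ne).ne'
  have h4 := (h2.div h1 one_ne_zero).div h3 hmu
  rw [div_one, one_div] at h4
  refine h4.congr fun n => ?_
  have e1 := one_sub_pgf hfin (normBase_pos c (n + 1)).le (hc.normBase_lt_one (n + 1)).le
  rw [hc.pgf_normBase_succ hsup] at e1
  have p0 := hc.pos n
  have p1 := hc.pos (n + 1)
  have q0 := hc.normBase_lt_one n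
  have q1 := hc.normBase_lt_one (n + 1)
  simp only [Pi.div_apply, Function.comp_apply, slope_def_field, Real.log_one, sub_zero,
    IsSenetaHeyde.log_normBase]
  have hs : slopeOne p (normBase c (n + 1)) ≠ 0 := by
    intro h; rw [h] at e1; linarith
  have r0 : normBase c n - 1 ≠ 0 := by linarith
  have r1 : normBase c (n + 1) - 1 ≠ 0 := by linarith
  field_simp
  linear_combination -e1

/-- The almost sure limit of the martingale. -/
def limitExp (p : PMF ℕ) (c : ℕ → ℝ) : Set (List ℕ) → ℝ :=
  treeFiltration.limitProcess (fun n t => Real.exp (-((genSize n t : ℝ) / c n))) (gw p)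

theorem measurable_limitExp : Measurable (limitExp p c) :=
  (Filtration.stronglyMeasurable_limit_process').measurable

theorem IsSenetaHeyde.ae_tendsto_limitExp (hc : IsSenetaHeyde p c) :
    ∀ᵐ t ∂gw p, Tendsto (fun n => normBase c n ^ genSize n t) atTop (𝓝 (limitExp p c t)) := by
  have := hc.martingale.submartingale.ae_tendsto_limitProcess (R := 1) fun n => by
    refine (eLpNorm_le_of_ae_bound (C := 1) (ae_of_all _ fun t => ?_)).trans ?_
    · rw [Real.norm_of_nonneg (Real.exp_pos _).le, exp_genSize_eq]
      exact pow_le_one₀ (normBase_pos c n).le (hc.normBase_lt_one n).le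
    · simp
  simp_rw [exp_genSize_eq] at this
  simpa only [limitExp, exp_genSize_eq] using this

theorem IsSenetaHeyde.ae_limitExp_mem (hc : IsSenetaHeyde p c) :
    ∀ᵐ t ∂gw p, limitExp p c t ∈ Set.Icc (0 : ℝ) 1 := by
  filter_upwards [hc.ae_tendsto_limitExp] with t ht
  exact isClosed_Icc.mem_of_tendsto ht (Eventually.of_forall fun n =>
    ⟨pow_nonneg (normBase_pos c n).le _, pow_le_one₀ (normBase_pos c n).le
      (hc.normBase_lt_one n).le⟩)

/-- The Laplace transform of the limit. -/
def limitLaplace (p : PMF ℕ) (c : ℕ → ℝ) (s : ℝ) : ℝ := ∫ t, limitExp p c t ^ s ∂gw p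

/-- The exponent may vary with `n`, since passing from rank `n + 1` to rank `n` replaces `s` by `s *
(c n / c (n + 1))`. -/
theorem IsSenetaHeyde.tendsto_iterate_rpow (hc : IsSenetaHeyde p c) {s : ℕ → ℝ} {a : ℝ}
    (hs : Tendsto s atTop (𝓝 a)) (hs0 : ∀ n, 0 ≤ s n) (ha : 0 < a) :
    Tendsto (fun n => (pgf p)^[n] (normBase c n ^ s n)) atTop (𝓝 (limitLaplace p c a)) := by
  have h1 : ∀ n, (pgf p)^[n] (normBase c n ^ s n)
      = ∫ t, (normBase c n ^ genSize n t) ^ s n ∂gw p := by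
    intro n
    have hn : 0 ≤ normBase c n ^ s n := Real.rpow_nonneg (normBase_pos c n).le _
    rw [← hc.integral_pow_genSize n]
    · refine integral_congr_ae (ae_of_all _ fun t => ?_)
      simp only
      rw [← Real.rpow_natCast, ← Real.rpow_natCast, ← Real.rpow_mul (normBase_pos c n).le,
        ← Real.rpow_mul (normBase_pos c n).le, mul_comm]
    · rw [Real.norm_of_nonneg hn]
      exact Real.rpow_le_one (normBase_pos c n).le (hc.normBase_lt_one n).le (hs0 n)
  simp_rw [h1]
  refine tendsto_integral_of_dominated_convergence (fun _ => 1) (fun n => ?_)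
    (integrable_const 1) (fun n => ae_of_all _ fun t => ?_) ?_
  · have := (measurable_of_countable fun k : ℕ => (normBase c n ^ k) ^ s n).comp
      (hc.measurable_genSize n)
    exact this.aestronglyMeasurable
  · have h0 : 0 ≤ normBase c n ^ genSize n t := pow_nonneg (normBase_pos c n).le _
    rw [Real.norm_of_nonneg (Real.rpow_nonneg h0 _)]
    exact Real.rpow_le_one h0 (pow_le_one₀ (normBase_pos c n).le (hc.normBase_lt_one n).le) (hs0 n)
  · filter_upwards [hc.ae_tendsto_limitExp] with t ht
    exact ht.rpow hs (Or.inr ha)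

theorem IsSenetaHeyde.mean_toReal_pos (hsup : 1 < mean p) (hfin : mean p < ⊤) :
    1 < (mean p).toReal := by
  simpa using (ENNReal.toReal_lt_toReal ENNReal.one_ne_top hfin.ne).2 hsup

theorem IsSenetaHeyde.limitLaplace_mem (hc : IsSenetaHeyde p c) {s : ℝ} (hs : 0 ≤ s) :
    limitLaplace p c s ∈ Set.Icc (0 : ℝ) 1 := by
  constructor
  · refine integral_nonneg_of_ae ?_
    filter_upwards [hc.ae_limitExp_mem] with t ht using Real.rpow_nonneg ht.1 _
  · rw [limitLaplace]
    calc ∫ t, limitExp p c t ^ s ∂gw p ≤ ∫ t, 1 ∂gw p := by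
          refine integral_mono_of_nonneg ?_ (integrable_const _) ?_
          · filter_upwards [hc.ae_limitExp_mem] with t ht using Real.rpow_nonneg ht.1 _
          · filter_upwards [hc.ae_limitExp_mem] with t ht using Real.rpow_le_one ht.1 ht.2 hs
      _ = 1 := by simp

theorem Icc_subset_closedBall : Set.Icc (0 : ℝ) 1 ⊆ Metric.closedBall 0 1 := fun x hx => by
  simpa [abs_of_nonneg hx.1] using hx.2

theorem tendsto_pgf {p : PMF ℕ} {x : ℕ → ℝ} {a : ℝ} (hx : Tendsto x atTop (𝓝 a))
    (h : ∀ n, x n ∈ Set.Icc (0 : ℝ) 1) : Tendsto (fun n => pgf p (x n)) atTop (𝓝 (pgf p a)) :=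
  ((continuousOn_pgf p).mono Icc_subset_closedBall a
    (isClosed_Icc.mem_of_tendsto hx (Eventually.of_forall h))).tendsto.comp
    (tendsto_nhdsWithin_iff.2 ⟨hx, Eventually.of_forall h⟩)

theorem mapsTo_iterate_pgf (p : PMF ℕ) (n : ℕ) :
    Set.MapsTo (pgf p)^[n] (Set.Icc (0 : ℝ) 1) (Set.Icc 0 1) := (mapsTo_pgf p).iterate n

/-- The Poincaré functional equation. The iterates of rank `n + 1` at `normBase c (n + 1) ^ s` have
the transform at `s` as limit; peeling off the outermost `f` leaves rank `n` with an exponent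
tending to `s / μ`. -/
theorem limitLaplace_eq (hc : IsSenetaHeyde p c) (hsup : 1 < mean p) (hfin : mean p < ⊤)
    {s : ℝ} (hs : 0 < s) :
    limitLaplace p c s = pgf p (limitLaplace p c (s / (mean p).toReal)) := by
  have hmu : 0 < (mean p).toReal := ENNReal.toReal_pos (zero_lt_one.trans hsup).ne' hfin.ne
  have h1 := (tendsto_add_atTop_iff_nat 1).2 (hc.tendsto_iterate_rpow (s := fun _ => s)
    tendsto_const_nhds (fun _ => hs.le) hs)
  have hr : ∀ n, 0 ≤ s * (c n / c (n + 1)) := fun n =>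
    mul_nonneg hs.le (div_nonneg (hc.pos _).le (hc.pos _).le)
  have h2 := hc.tendsto_iterate_rpow (s := fun n => s * (c n / c (n + 1)))
    ((hc.tendsto_ratio hsup hfin).const_mul s) hr (mul_pos hs (inv_pos.2 hmu))
  rw [← div_eq_mul_inv] at h2
  refine tendsto_nhds_unique h1 ((tendsto_pgf h2 fun n => ?_).congr fun n => ?_)
  · exact mapsTo_iterate_pgf p n ⟨Real.rpow_nonneg (normBase_pos c n).le _,
      Real.rpow_le_one (normBase_pos c n).le (hc.normBase_lt_one n).le (hr n)⟩
  -- `normBase c (n + 1) ^ s` is `normBase c n` to the power `s * (c n / c (n + 1))`.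
  · rw [Function.iterate_succ_apply']
    congr 2
    rw [normBase, normBase, ← Real.exp_mul, ← Real.exp_mul]
    have := (hc.pos n).ne'
    congr 1; field_simp

theorem limitLaplace_one (hc : IsSenetaHeyde p c) : limitLaplace p c 1 = normBase c 0 := by
  have h1 := hc.tendsto_iterate_rpow (s := fun _ => 1) tendsto_const_nhds (fun _ => zero_le_one)
    one_pos
  simp_rw [Real.rpow_one, hc.iterate_normBase] at h1
  exact tendsto_nhds_unique h1 tendsto_const_nhds

theorem tendsto_limitLaplace (hc : IsSenetaHeyde p c) {s : ℕ → ℝ} (hs : ∀ n, 0 ≤ s n)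
    {A : Set ℝ} (hA : MeasurableSet A)
    (h : ∀ y ∈ Set.Icc (0 : ℝ) 1, Tendsto (fun n => y ^ s n) atTop (𝓝 (A.indicator 1 y))) :
    Tendsto (fun n => limitLaplace p c (s n)) atTop
      (𝓝 ((gw p).real {t | limitExp p c t ∈ A})) := by
  have h1 : (gw p).real {t | limitExp p c t ∈ A}
      = ∫ t, A.indicator 1 (limitExp p c t) ∂gw p := by
    have : (fun t => A.indicator (1 : ℝ → ℝ) (limitExp p c t))
        = {t | limitExp p c t ∈ A}.indicator 1 := by
      ext t; simp [Set.indicator]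
    rw [this]
    exact (integral_indicator_one (measurable_limitExp hA)).symm
  rw [h1]
  refine tendsto_integral_of_dominated_convergence (fun _ => 1) (fun n => ?_)
    (integrable_const 1) (fun n => ?_) ?_
  · exact (measurable_limitExp.pow_const _).aestronglyMeasurable
  · filter_upwards [hc.ae_limitExp_mem] with t ht
    rw [Real.norm_of_nonneg (Real.rpow_nonneg ht.1 _)]
    exact Real.rpow_le_one ht.1 ht.2 (hs n)
  · filter_upwards [hc.ae_limitExp_mem] with t ht using h _ ht

/-- This gives finiteness of `W`. Along exponents `μ ^ (-n)` the transform tends to the probability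
that the limit is positive; by the functional equation this is a fixed point of `f`, and it is at
least `normBase c 0 > 𝔠`, so it equals 1. -/
theorem IsSenetaHeyde.real_limitExp_pos (hc : IsSenetaHeyde p c) (hsup : 1 < mean p)
    (hfin : mean p < ⊤) : (gw p).real {t | limitExp p c t ∈ Set.Ioi 0} = 1 := by
  have hmu := IsSenetaHeyde.mean_toReal_pos hsup hfin
  have hmu0 : 0 < (mean p).toReal := one_pos.trans hmu
  have hlim : Tendsto (fun n : ℕ => (mean p).toReal⁻¹ ^ n) atTop (𝓝 0) :=
    tendsto_pow_atTop_nhds_zero_of_lt_one (by positivity) (inv_lt_one_of_one_lt₀ hmu)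
  have h1 := tendsto_limitLaplace hc (s := fun n : ℕ => (mean p).toReal⁻¹ ^ n)
    (fun n => by positivity) measurableSet_Ioi (A := Set.Ioi 0) fun y hy => by
      rcases hy.1.eq_or_lt with h | h
      · rw [← h]
        simp only [Set.mem_Ioi, lt_self_iff_false, not_false_eq_true, Set.indicator_of_notMem]
        refine tendsto_const_nhds.congr fun n => ?_
        rw [Real.zero_rpow (by positivity)]
      · rw [Set.indicator_of_mem (by exact h)]
        have := (tendsto_const_nhds (x := y)).rpow hlim (Or.inl h.ne')
        simpa using this
  set q := (gw p).real {t | limitExp p c t ∈ Set.Ioi 0}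
  have hfix : pgf p q = q := by
    refine tendsto_nhds_unique (tendsto_pgf ((tendsto_add_atTop_iff_nat 1).2 h1)
      fun n => hc.limitLaplace_mem (by positivity)) (h1.congr fun n => ?_)
    rw [limitLaplace_eq hc hsup hfin (by positivity), pow_succ, div_eq_mul_inv]
  have hge : normBase c 0 ≤ q := by
    rw [← limitLaplace_one hc]
    refine ge_of_tendsto h1 (Eventually.of_forall fun n => ?_)
    refine integral_mono_of_nonneg ?_ ?_ ?_
    · filter_upwards [hc.ae_limitExp_mem] with t ht using Real.rpow_nonneg ht.1 _
    · refine Integrable.of_bound (measurable_limitExp.pow_const _).aestronglyMeasurable 1 ?_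
      filter_upwards [hc.ae_limitExp_mem] with t ht
      rw [Real.norm_of_nonneg (Real.rpow_nonneg ht.1 _)]
      exact Real.rpow_le_one ht.1 ht.2 (by positivity)
    · filter_upwards [hc.ae_limitExp_mem] with t ht
      refine Real.rpow_le_rpow_of_exponent_ge' ht.1 ht.2 (by positivity) ?_
      exact pow_le_one₀ (by positivity) (inv_le_one_of_one_le₀ hmu.le)
  by_contra hne
  have hq : q < 1 := lt_of_le_of_ne measureReal_le_one hne
  have := eq_extProb_of_fixed hsup hfin measureReal_nonneg hq hfix
  have := hc.lt_normBase hsup 0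
  linarith

/-- The same argument along exponents `μ ^ n` computes the probability that `W = 0`: a fixed point
of `f`, at most `normBase c 0 < 1`, so it is 𝔠. -/
theorem IsSenetaHeyde.real_limitExp_eq_one (hc : IsSenetaHeyde p c) (hsup : 1 < mean p)
    (hfin : mean p < ⊤) : (gw p).real {t | limitExp p c t ∈ ({1} : Set ℝ)} = (extProb p).toReal := by
  have hmu := IsSenetaHeyde.mean_toReal_pos hsup hfin
  have hmu0 : 0 < (mean p).toReal := one_pos.trans hmu
  have hlim : Tendsto (fun n : ℕ => (mean p).toReal ^ n) atTop atTop :=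
    tendsto_pow_atTop_atTop_of_one_lt hmu
  have h1 := tendsto_limitLaplace hc (s := fun n : ℕ => (mean p).toReal ^ n)
    (fun n => by positivity) (measurableSet_singleton 1) (A := {1}) fun y hy => by
      rcases hy.2.eq_or_lt with h | h
      · simp [h]
      · rw [Set.indicator_of_notMem (by simpa using h.ne)]
        exact (tendsto_rpow_atTop_of_base_lt_one y (by linarith [hy.1]) h).comp hlim
  set q := (gw p).real {t | limitExp p c t ∈ ({1} : Set ℝ)}
  have hfix : pgf p q = q := by
    refine tendsto_nhds_unique (tendsto_pgf h1 fun n => hc.limitLaplace_mem (by positivity))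
      (((tendsto_add_atTop_iff_nat 1).2 h1).congr fun n => ?_)
    rw [limitLaplace_eq hc hsup hfin (by positivity), pow_succ, mul_div_cancel_right₀ _ hmu0.ne']
  refine eq_extProb_of_fixed hsup hfin measureReal_nonneg ?_ hfix
  refine lt_of_le_of_lt ?_ (hc.normBase_lt_one 0)
  rw [← limitLaplace_one hc]
  refine le_of_tendsto h1 (Eventually.of_forall fun n => ?_)
  refine integral_mono_of_nonneg ?_ ?_ ?_
  · filter_upwards [hc.ae_limitExp_mem] with t ht using Real.rpow_nonneg ht.1 _
  · refine Integrable.of_bound (measurable_limitExp.pow_const _).aestronglyMeasurable 1 ?_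
    filter_upwards [hc.ae_limitExp_mem] with t ht
    rw [Real.norm_of_nonneg (Real.rpow_nonneg ht.1 _)]
    exact Real.rpow_le_one ht.1 ht.2 (by positivity)
  · filter_upwards [hc.ae_limitExp_mem] with t ht
    refine Real.rpow_le_rpow_of_exponent_ge' ht.1 ht.2 zero_le_one (one_le_pow₀ hmu.le)

theorem IsSenetaHeyde.ae_limitExp_pos (hc : IsSenetaHeyde p c) (hsup : 1 < mean p)
    (hfin : mean p < ⊤) : ∀ᵐ t ∂gw p, 0 < limitExp p c t := by
  have h := hc.real_limitExp_pos hsup hfin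
  have h2 : gw p {t | limitExp p c t ∈ Set.Ioi 0} = 1 := by
    rw [measureReal_def] at h
    simpa using congrArg ENNReal.ofReal h
  exact (prob_compl_eq_zero_iff (measurable_limitExp measurableSet_Ioi)).2 h2

theorem IsSenetaHeyde.ae_W_eq (hc : IsSenetaHeyde p c) (hsup : 1 < mean p)
    (hfin : mean p < ⊤) : ∀ᵐ t ∂gw p,
      Tendsto (fun n => (genSize n t : ℝ) / c n) atTop (𝓝 (W c t)) ∧
        W c t = -Real.log (limitExp p c t) := by
  filter_upwards [hc.ae_limitExp_pos hsup hfin, hc.ae_tendsto_limitExp] with t h0 ht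
  have h1 : Tendsto (fun n => (genSize n t : ℝ) / c n) atTop
      (𝓝 (-Real.log (limitExp p c t))) := by
    refine ((Real.continuousAt_log h0.ne').tendsto.comp ht).neg.congr fun n => ?_
    rw [Function.comp_apply, ← exp_genSize_eq, Real.log_exp, neg_neg]
  have h2 : W c t = -Real.log (limitExp p c t) := h1.limUnder_eq
  exact ⟨h2 ▸ h1, h2⟩

theorem IsSenetaHeyde.aemeasurable_W (hc : IsSenetaHeyde p c) (hsup : 1 < mean p)
    (hfin : mean p < ⊤) : AEMeasurable (W c) (gw p) :=
  ⟨fun t => -Real.log (limitExp p c t), (Real.measurable_log.comp measurable_limitExp).neg,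
    (hc.ae_W_eq hsup hfin).mono fun _ h => h.2⟩

/-- The law of `W`. -/
def lawW (p : PMF ℕ) (c : ℕ → ℝ) : Measure ℝ := (gw p).map (W c)

theorem IsSenetaHeyde.isProbabilityMeasure_lawW (hc : IsSenetaHeyde p c) (hsup : 1 < mean p)
    (hfin : mean p < ⊤) : IsProbabilityMeasure (lawW p c) :=
  Measure.isProbabilityMeasure_map (hc.aemeasurable_W hsup hfin)

theorem IsSenetaHeyde.lawW_Iio (hc : IsSenetaHeyde p c) (hsup : 1 < mean p)
    (hfin : mean p < ⊤) : lawW p c (Set.Iio 0) = 0 := by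
  rw [lawW, Measure.map_apply_of_aemeasurable (hc.aemeasurable_W hsup hfin) measurableSet_Iio]
  refine measure_eq_zero_iff_ae_notMem.2 ?_
  filter_upwards [hc.ae_W_eq hsup hfin, hc.ae_limitExp_mem] with t h1 h2
  simp only [Set.mem_preimage, Set.mem_Iio, not_lt, h1.2]
  have := Real.log_nonpos h2.1 h2.2
  linarith

theorem IsSenetaHeyde.lawW_singleton_zero (hc : IsSenetaHeyde p c) (hsup : 1 < mean p)
    (hfin : mean p < ⊤) : lawW p c {0} = extProb p := by
  rw [lawW, Measure.map_apply_of_aemeasurable (hc.aemeasurable_W hsup hfin)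
    (measurableSet_singleton _)]
  have h := hc.real_limitExp_eq_one hsup hfin
  have h2 : gw p {t | limitExp p c t ∈ ({1} : Set ℝ)} = extProb p :=
    (ENNReal.toReal_eq_toReal_iff' (measure_ne_top _ _)
      ((extProb_le_one p).trans_lt ENNReal.one_lt_top).ne).1 h
  rw [← h2]
  refine measure_congr ?_
  filter_upwards [hc.ae_W_eq hsup hfin, hc.ae_limitExp_mem, hc.ae_limitExp_pos hsup hfin]
    with t h1 h2 h3
  refine propext ?_
  change W c t = 0 ↔ limitExp p c t = 1
  rw [h1.2, neg_eq_zero, Real.log_eq_zero]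
  constructor
  · rintro (h | h | h) <;> linarith
  · exact fun h => Or.inr (Or.inl h)

theorem IsSenetaHeyde.tendsto_iterate_charFun (hc : IsSenetaHeyde p c) (hsup : 1 < mean p)
    (hfin : mean p < ⊤) {s : ℕ → ℝ} {a : ℝ} (hs : Tendsto s atTop (𝓝 a)) :
    Tendsto (fun n => (pgf p)^[n] (Complex.exp ((s n / c n : ℝ) * Complex.I))) atTop
      (𝓝 (charFun (lawW p c) a)) := by
  have h1 : ∀ n, (pgf p)^[n] (Complex.exp ((s n / c n : ℝ) * Complex.I))
      = ∫ t, Complex.exp (((s n * (genSize n t / c n) : ℝ) : ℂ) * Complex.I) ∂gw p := by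
    intro n
    rw [← hc.integral_pow_genSize n (Complex.norm_exp_ofReal_mul_I _).le]
    refine integral_congr_ae (ae_of_all _ fun t => ?_)
    simp only
    rw [← Complex.exp_nat_mul]
    congr 1
    push_cast; ring
  simp_rw [h1]
  rw [charFun_apply_real, lawW, integral_map (hc.aemeasurable_W hsup hfin) (by fun_prop)]
  refine tendsto_integral_of_dominated_convergence (fun _ => 1) (fun n => ?_)
    (integrable_const 1) (fun n => ae_of_all _ fun t => (Complex.norm_exp_ofReal_mul_I _).le) ?_
  · have := (measurable_of_countable fun k : ℕ =>
      Complex.exp (((s n * (k / c n) : ℝ) : ℂ) * Complex.I)).comp (hc.measurable_genSize n)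
    exact this.aestronglyMeasurable
  · filter_upwards [hc.ae_W_eq hsup hfin] with t ht
    have h2 : Continuous fun x : ℝ => Complex.exp ((x : ℂ) * Complex.I) := by fun_prop
    have h3 := (h2.tendsto _).comp (hs.mul ht.1)
    simpa [Function.comp_def] using h3

/-- The functional equation again, on the imaginary axis, where the characteristic function can
identify measures. -/
theorem IsSenetaHeyde.charFun_mean_mul (hc : IsSenetaHeyde p c) (hsup : 1 < mean p)
    (hfin : mean p < ⊤) (t : ℝ) :
    charFun (lawW p c) ((mean p).toReal * t) = pgf p (charFun (lawW p c) t) := by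
  have hmu : 0 < (mean p).toReal := ENNReal.toReal_pos (zero_lt_one.trans hsup).ne' hfin.ne
  have := hc.isProbabilityMeasure_lawW hsup hfin
  set a := (mean p).toReal * t
  have h1 := (tendsto_add_atTop_iff_nat 1).2 (hc.tendsto_iterate_charFun hsup hfin (s := fun _ => a)
    tendsto_const_nhds)
  have h2 := hc.tendsto_iterate_charFun hsup hfin (s := fun n => a * (c n / c (n + 1)))
    ((hc.tendsto_ratio hsup hfin).const_mul a)
  have h3 : a * (mean p).toReal⁻¹ = t := by simp only [a]; field_simp
  rw [h3] at h2
  have hb : ∀ n, (pgf p)^[n] (Complex.exp ((a * (c n / c (n + 1)) / c n : ℝ) * Complex.I))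
      ∈ Metric.closedBall (0 : ℂ) 1 := by
    intro n
    have hz := (Complex.norm_exp_ofReal_mul_I (a * (c n / c (n + 1)) / c n)).le
    rw [← pgf_sizeLaw_const p n hz]
    simpa using norm_pgf_le_one _ hz
  have h4 := (continuousOn_pgf (𝕜 := ℂ) p (charFun (lawW p c) t)
    (by simpa using norm_charFun_le_one t)).tendsto.comp
    (tendsto_nhdsWithin_iff.2 ⟨h2, Eventually.of_forall hb⟩)
  refine tendsto_nhds_unique h1 (h4.congr fun n => ?_)
  rw [Function.iterate_succ_apply']
  simp only [Function.comp_apply]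
  congr 5
  have := (hc.pos n).ne'
  field_simp

end Limit

/-! ### The law of `W` on the positive half-line -/

/-! ### Convolution powers of a finite measure -/

section ConvolutionPowers

/-- The convolution powers of a measure on the line. -/
def mpow (ν : Measure ℝ) : ℕ → Measure ℝ
  | 0 => Measure.dirac 0
  | n + 1 => ν.conv (mpow ν n)

variable (ν : Measure ℝ) [IsFiniteMeasure ν]

instance isFiniteMeasure_mpow (n : ℕ) : IsFiniteMeasure (mpow ν n) := by
  induction n with
  | zero => unfold mpow; infer_instance
  | succ n ih => unfold mpow; infer_instance

theorem mpow_one : mpow ν 1 = ν := Measure.conv_dirac_zero ν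

theorem mpow_add (m n : ℕ) : mpow ν (m + n) = (mpow ν m).conv (mpow ν n) := by
  induction m with
  | zero => rw [zero_add, mpow, Measure.dirac_zero_conv]
  | succ m ih => rw [Nat.succ_add, mpow, ih, mpow, Measure.conv_assoc]

theorem charFun_mpow (n : ℕ) (t : ℝ) : charFun (mpow ν n) t = charFun ν t ^ n := by
  induction n with
  | zero => simp [mpow]
  | succ n ih => rw [mpow, charFun_conv, ih, pow_succ']

theorem mpow_univ (n : ℕ) : mpow ν n Set.univ = ν Set.univ ^ n := by
  induction n with
  | zero => simp [mpow]
  | succ n ih =>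
    rw [mpow, Measure.conv, Measure.map_apply (by fun_prop) MeasurableSet.univ, Set.preimage_univ,
      Measure.prod_apply MeasurableSet.univ]
    simp [ih, pow_succ, mul_comm]

theorem conv_sum_right {ι : Type} [Countable ι] (μ : Measure ℝ) [SFinite μ] (m : ι → Measure ℝ)
    [∀ i, SFinite (m i)] : μ.conv (Measure.sum m) = Measure.sum fun i => μ.conv (m i) := by
  rw [Measure.conv, Measure.prod_sum_right, Measure.map_sum (by fun_prop)]
  rfl

theorem conv_smul_right (μ m : Measure ℝ) [SFinite μ] [SFinite m] (a : ℝ≥0∞) :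
    μ.conv (a • m) = a • μ.conv m := by
  rw [Measure.conv, Measure.prod_smul_right, Measure.map_smul]
  rfl

theorem map_mul_conv (r : ℝ) (μ m : Measure ℝ) [SFinite μ] [SFinite m] :
    (μ.conv m).map (r * ·) = (μ.map (r * ·)).conv (m.map (r * ·)) := by
  exact Measure.map_conv_continuousLinearMap (μ := μ) (ν := m) (ContinuousLinearMap.mul ℝ ℝ r)

theorem map_mul_mpow (r : ℝ) (n : ℕ) : (mpow ν n).map (r * ·) = mpow (ν.map (r * ·)) n := by
  induction n with
  | zero => rw [mpow, mpow, Measure.map_dirac' (by fun_prop : Measurable (r * ·)), mul_zero]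
  | succ n ih => rw [mpow, mpow, map_mul_conv, ih]

theorem charFun_sum {ι : Type} [Countable ι] (m : ι → Measure ℝ) [IsFiniteMeasure (Measure.sum m)]
    (t : ℝ) : HasSum (fun i => charFun (m i) t) (charFun (Measure.sum m) t) := by
  simp_rw [charFun_apply_real]
  refine hasSum_integral_measure (Integrable.of_bound (by fun_prop) 1 (ae_of_all _ fun x => ?_))
  rw [← Complex.ofReal_mul]
  exact (Complex.norm_exp_ofReal_mul_I _).le

end ConvolutionPowers

/-! ### The self-similarity of the law of `W` on survival -/

section SurvLaw

variable {p : PMF ℕ} {c : ℕ → ℝ}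

/-- The law of `W` on the event of survival. -/
def survLaw (p : PMF ℕ) (c : ℕ → ℝ) : Measure ℝ := (lawW p c).restrict (Set.Ioi 0)

instance : IsFiniteMeasure (lawW p c) := by unfold lawW; infer_instance

instance : IsFiniteMeasure (survLaw p c) := by unfold survLaw; infer_instance

theorem IsSenetaHeyde.extProb_lt_one (hc : IsSenetaHeyde p c) : extProb p < 1 := by
  refine (extProb_le_one p).lt_of_ne fun h => ?_
  have h1 := hc.extProb_lt
  have h2 := hc.normBase_lt_one 0
  rw [normBase] at h2
  rw [h, ENNReal.toReal_one] at h1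
  linarith

theorem IsSenetaHeyde.lawW_eq (hc : IsSenetaHeyde p c) (hsup : 1 < mean p)
    (hfin : mean p < ⊤) :
    lawW p c = extProb p • Measure.dirac 0 + survLaw p c := by
  have h0 := hc.lawW_Iio hsup hfin
  have h1 : (lawW p c).restrict (Set.Iic 0) = extProb p • Measure.dirac 0 := by
    rw [← Set.Iio_union_right, Measure.restrict_union (by simp) (measurableSet_singleton _),
      Measure.restrict_eq_zero.2 h0, zero_add, Measure.restrict_singleton,
      hc.lawW_singleton_zero hsup hfin]
  rw [← h1, survLaw, ← Set.compl_Iic, Measure.restrict_add_restrict_compl measurableSet_Iic]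

theorem IsSenetaHeyde.survLaw_univ (hc : IsSenetaHeyde p c) (hsup : 1 < mean p)
    (hfin : mean p < ⊤) : survLaw p c Set.univ = 1 - extProb p := by
  have := hc.isProbabilityMeasure_lawW hsup hfin
  have h := congrArg (fun m => m Set.univ) (hc.lawW_eq hsup hfin)
  simp only [measure_univ, Measure.coe_add, Pi.add_apply, Measure.smul_apply, smul_eq_mul,
    mul_one] at h
  refine ENNReal.eq_sub_of_add_eq hc.extProb_lt_one.ne_top ?_
  rw [add_comm]; exact h.symm

theorem IsSenetaHeyde.charFun_lawW (hc : IsSenetaHeyde p c) (hsup : 1 < mean p)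
    (hfin : mean p < ⊤) (t : ℝ) :
    charFun (lawW p c) t = (extProb p).toReal + charFun (survLaw p c) t := by
  have hi : ∀ m : Measure ℝ, IsFiniteMeasure m →
      Integrable (fun x : ℝ => Complex.exp (t * x * Complex.I)) m := by
    intro m hm
    refine Integrable.of_bound (by fun_prop) 1 (ae_of_all _ fun x => ?_)
    rw [← Complex.ofReal_mul]
    exact (Complex.norm_exp_ofReal_mul_I _).le
  have : IsFiniteMeasure (extProb p • Measure.dirac (0 : ℝ)) :=
    Measure.smul_finite _ hc.extProb_lt_one.ne_top
  rw [hc.lawW_eq hsup hfin, charFun_apply_real, integral_add_measure (hi _ this)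
    (hi _ inferInstance), integral_smul_measure, charFun_apply_real]
  simp

theorem IsSenetaHeyde.enorm_charFun_survLaw_le (hc : IsSenetaHeyde p c) (hsup : 1 < mean p)
    (hfin : mean p < ⊤) (t : ℝ) : extProb p + ‖charFun (survLaw p c) t‖ₑ ≤ 1 := by
  have h : ‖charFun (survLaw p c) t‖ₑ ≤ 1 - extProb p := by
    rw [← hc.survLaw_univ hsup hfin, ← ofReal_norm, ← ENNReal.ofReal_toReal (measure_ne_top _ _)]
    exact ENNReal.ofReal_le_ofReal (norm_charFun_le t)
  calc _ ≤ extProb p + (1 - extProb p) := by gcongr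
    _ = 1 := add_tsub_cancel_of_le hc.extProb_lt_one.le

theorem IsSenetaHeyde.hasSum_charFun_survLaw (hc : IsSenetaHeyde p c) (hsup : 1 < mean p)
    (hfin : mean p < ⊤) (t : ℝ) :
    HasSum (fun l => ((survCoeff p l).toReal : ℂ) * charFun (survLaw p c) t ^ l)
      (charFun (survLaw p c) ((mean p).toReal * t)) := by
  have h := hasSum_survCoeff hc.extProb_lt_one (hc.enorm_charFun_survLaw_le hsup hfin t)
  have h2 := hc.charFun_mean_mul hsup hfin t
  rw [hc.charFun_lawW hsup hfin, hc.charFun_lawW hsup hfin] at h2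
  convert! h using 1
  exact eq_sub_of_add_eq' h2

/-- The central identity: `μ W` on survival is a sum of `l` independent positive limits, `l` being
the number of surviving children. Both sides are finite measures, and their characteristic functions
agree by expanding `f(𝔠 + ·) - 𝔠` at the characteristic function of `survLaw`. -/
theorem IsSenetaHeyde.map_survLaw (hc : IsSenetaHeyde p c) (hsup : 1 < mean p)
    (hfin : mean p < ⊤) :
    (survLaw p c).map ((mean p).toReal * ·)
      = Measure.sum fun l => survCoeff p l • mpow (survLaw p c) l := by
  have hfm : IsFiniteMeasure (Measure.sum fun l => survCoeff p l • mpow (survLaw p c) l) := by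
    refine ⟨?_⟩
    rw [Measure.sum_apply _ MeasurableSet.univ]
    simp only [Measure.smul_apply, mpow_univ, hc.survLaw_univ hsup hfin, smul_eq_mul]
    have := sgf_one_sub hc.extProb_lt_one
    rw [sgf] at this
    rw [this]
    exact lt_of_le_of_lt tsub_le_self ENNReal.one_lt_top
  refine Measure.ext_of_charFun (funext fun t => ?_)
  rw [charFun_map_mul]
  refine (hc.hasSum_charFun_survLaw hsup hfin t).unique ?_
  convert! charFun_sum (fun l => survCoeff p l • mpow (survLaw p c) l) t using 1
  ext l
  rw [← charFun_mpow, charFun_apply_real, charFun_apply_real, integral_smul_measure]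
  exact (Complex.real_smul ..).symm

end SurvLaw

/-! ### Integrable characteristic functions and absolute continuity -/

section IntegrableCharFun

theorem exists_smooth_bump {K U : Set ℝ} (hK : IsCompact K) (hU : IsOpen U) (hKU : K ⊆ U) :
    ∃ ψ : ℝ → ℝ, ContDiff ℝ (⊤ : ℕ∞) ψ ∧ HasCompactSupport ψ ∧ (∀ x, ψ x ∈ Set.Icc 0 1) ∧
      (∀ x ∈ K, ψ x = 1) ∧ ∀ x, x ∉ U → ψ x = 0 := by
  obtain ⟨V, hV, hKV, hVU, hVc⟩ := exists_open_between_and_isCompact_closure hK hU hKU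
  obtain ⟨f, h0, h1, h2⟩ := exists_contMDiffMap_zero_one_of_isClosed (n := (⊤ : ℕ∞))
    (modelWithCornersSelf ℝ ℝ) hV.isClosed_compl hK.isClosed
    (Set.disjoint_compl_left_iff_subset.2 hKV)
  refine ⟨f, f.contMDiff.contDiff, ?_, h2, fun x hx => h1 hx, fun x hx => h0 fun h =>
    hx (hVU (subset_closure h))⟩
  refine HasCompactSupport.intro hVc fun x hx => h0 fun h => hx (subset_closure h)

open scoped FourierTransform SchwartzMap

/-- Fourier inversion of ψ and Fubini write the integral as one of `charFun m` against the Fourier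
transform of ψ, which is bounded by the `L¹` norm of ψ. -/
theorem norm_integral_schwartz_le (m : Measure ℝ) [IsFiniteMeasure m]
    (hm : Integrable (charFun m)) (ψ : 𝓢(ℝ, ℂ)) :
    ‖∫ x, ψ x ∂m‖ ≤ (∫ x, ‖ψ x‖) * ∫ ξ, ‖charFun m (2 * Real.pi * ξ)‖ := by
  have hi : ∀ x, ψ x = ∫ ξ, Complex.exp (((2 * Real.pi * (ξ * x) : ℝ) : ℂ) * Complex.I) * 𝓕 (ψ : ℝ → ℂ) ξ := by
    intro x
    have h := congrFun (ψ.continuous.fourierInv_fourier_eq ψ.integrable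
      (by rw [← SchwartzMap.fourier_coe]; exact (𝓕 ψ).integrable)) x
    rw [Real.fourierInv_eq'] at h
    rw [← h]
    refine integral_congr_ae (ae_of_all _ fun ξ => ?_)
    simp [mul_comm]
  have hF : Integrable (𝓕 (ψ : ℝ → ℂ)) := by
    rw [← SchwartzMap.fourier_coe]; exact (𝓕 ψ).integrable
  have hprod : Integrable (fun x : ℝ × ℝ =>
      Complex.exp (((2 * Real.pi * (x.2 * x.1) : ℝ) : ℂ) * Complex.I) * 𝓕 (ψ : ℝ → ℂ) x.2)
      (m.prod volume) := by
    refine (hF.comp_snd m).norm.mono' ?_ (ae_of_all _ fun x => ?_)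
    · refine AEStronglyMeasurable.mul ?_ (hF.comp_snd m).aestronglyMeasurable
      exact Continuous.aestronglyMeasurable (by fun_prop)
    · rw [norm_mul, Complex.norm_exp_ofReal_mul_I, one_mul]
  have h1 : ∫ x, ψ x ∂m = ∫ ξ, charFun m (2 * Real.pi * ξ) * 𝓕 (ψ : ℝ → ℂ) ξ := by
    simp_rw [hi]
    rw [integral_integral_swap hprod]
    refine integral_congr_ae (ae_of_all _ fun ξ => ?_)
    simp only
    rw [integral_mul_const, charFun_apply_real]
    congr 1
    refine integral_congr_ae (ae_of_all _ fun x => ?_)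
    simp only
    congr 2
    push_cast; ring
  have h2 : Integrable fun ξ => charFun m (2 * Real.pi * ξ) :=
    hm.comp_mul_left' (by positivity)
  rw [h1, ← integral_const_mul]
  refine norm_integral_le_of_norm_le (h2.norm.const_mul _) (ae_of_all _ fun ξ => ?_)
  rw [norm_mul, mul_comm]
  refine mul_le_mul_of_nonneg_right ?_ (norm_nonneg _)
  exact VectorFourier.norm_fourierIntegral_le_integral_norm _ _ _ _ _

theorem measure_compact_le_of_integrable_charFun (m : Measure ℝ) [IsFiniteMeasure m]
    (hm : Integrable (charFun m)) {K U : Set ℝ} (hK : IsCompact K) (hU : IsOpen U) (hKU : K ⊆ U) :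
    m K ≤ ENNReal.ofReal (∫ ξ, ‖charFun m (2 * Real.pi * ξ)‖) * volume U := by
  obtain ⟨ψ, h1, h2, h3, h4, h5⟩ := exists_smooth_bump hK hU hKU
  have hψi : Integrable ψ := h1.continuous.integrable_of_hasCompactSupport h2
  have hψm : Integrable ψ m := h1.continuous.integrable_of_hasCompactSupport h2
  have e1 : m K ≤ ENNReal.ofReal (∫ x, ψ x ∂m) := by
    rw [ofReal_integral_eq_lintegral_ofReal hψm (ae_of_all _ fun x => (h3 x).1),
      ← lintegral_indicator_one hK.measurableSet]
    refine lintegral_mono fun x => ?_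
    by_cases hx : x ∈ K
    · simp [hx, h4 x hx]
    · simp [hx]
  have e2 : ENNReal.ofReal (∫ x, ψ x) ≤ volume U := by
    rw [ofReal_integral_eq_lintegral_ofReal hψi (ae_of_all _ fun x => (h3 x).1),
      ← lintegral_indicator_one hU.measurableSet]
    refine lintegral_mono fun x => ?_
    by_cases hx : x ∈ U
    · simpa [hx] using (h3 x).2
    · simp [hx, h5 x hx]
  have hc1 : HasCompactSupport fun x => (ψ x : ℂ) := h2.comp_left (g := fun y : ℝ => (y : ℂ)) rfl
  have hc2 : ContDiff ℝ (⊤ : ℕ∞) fun x => (ψ x : ℂ) := Complex.ofRealCLM.contDiff.comp h1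
  have h6 := norm_integral_schwartz_le m hm (hc1.toSchwartzMap hc2)
  simp only [HasCompactSupport.toSchwartzMap_toFun] at h6
  have h7 : ∀ x, ‖ψ x‖ = ψ x := fun x => Real.norm_of_nonneg (h3 x).1
  rw [integral_complex_ofReal] at h6
  simp only [Complex.norm_real, h7,
    Real.norm_of_nonneg (integral_nonneg (μ := m) fun x => (h3 x).1)] at h6
  refine e1.trans ((ENNReal.ofReal_le_ofReal h6).trans ?_)
  rw [ENNReal.ofReal_mul (integral_nonneg fun x => (h3 x).1), mul_comm]
  gcongr

theorem absolutelyContinuous_of_integrable_charFun (m : Measure ℝ) [IsFiniteMeasure m]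
    (hm : Integrable (charFun m)) : m ≪ volume := by
  refine Measure.AbsolutelyContinuous.mk fun N hN h0 => ?_
  rw [hN.measure_eq_iSup_isCompact_of_ne_top (measure_ne_top m N)]
  simp only [ENNReal.iSup_eq_zero]
  intro K hKN hK
  by_contra hne
  set C := ENNReal.ofReal (∫ ξ, ‖charFun m (2 * Real.pi * ξ)‖)
  have hCt : C ≠ ⊤ := ENNReal.ofReal_ne_top
  -- The 1 added to `C` keeps the denominator nonzero even if `C = 0`.
  have hpos : 0 < m K / (C + 1) := ENNReal.div_pos hne (by simp [hCt])
  obtain ⟨U, hKU, hU, hvU⟩ := Set.exists_isOpen_lt_of_lt (μ := volume) K (m K / (C + 1))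
    (by rwa [measure_mono_null hKN h0])
  have h1 := measure_compact_le_of_integrable_charFun m hm hK hU hKU
  have h2 : (C + 1) * volume U < m K := by
    rw [mul_comm]
    exact (ENNReal.lt_div_iff_mul_lt (Or.inl (by simp)) (Or.inl (by simp [hCt]))).1 hvU
  refine absurd (h1.trans_lt' (lt_of_le_of_lt ?_ h2)) (lt_irrefl _)
  gcongr
  exact le_self_add

end IntegrableCharFun

/-! ### Strict bound on the characteristic function away from 0 -/

section Lattice

/-- Equality in the triangle inequality: after a rotation by `u` the function `1 - Re (u e^{isx})`
is nonnegative with integral 0. -/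
theorem ae_eq_of_norm_charFun_eq (ν : Measure ℝ) [IsFiniteMeasure ν] {s : ℝ}
    (h : ‖charFun ν s‖ = ν.real Set.univ) :
    ∃ u : ℂ, ∀ᵐ x : ℝ ∂ν, Complex.exp (s * x * Complex.I) = u := by
  have hnorm : ∀ x : ℝ, ‖Complex.exp (s * x * Complex.I)‖ = 1 := fun x => by
    rw [← Complex.ofReal_mul]; exact Complex.norm_exp_ofReal_mul_I _
  have hint : Integrable (fun x : ℝ => Complex.exp (s * x * Complex.I)) ν :=
    Integrable.of_bound (by fun_prop) 1 (ae_of_all _ fun x => (hnorm x).le)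
  obtain ⟨u, hu, hu2⟩ : ∃ u : ℂ, ‖u‖ = 1 ∧ u * charFun ν s = ‖charFun ν s‖ := by
    by_cases h0 : charFun ν s = 0
    · exact ⟨1, by simp, by simp [h0]⟩
    · refine ⟨(‖charFun ν s‖ : ℂ) / charFun ν s, ?_, by field_simp⟩
      rw [norm_div, Complex.norm_real, norm_norm, div_self (norm_ne_zero_iff.2 h0)]
  have h1 : ∫ x, (1 - (u * Complex.exp (s * x * Complex.I)).re) ∂ν = 0 := by
    have hi2 : Integrable (fun x : ℝ => u * Complex.exp (s * x * Complex.I)) ν := hint.const_mul u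
    have hi3 : Integrable (fun x : ℝ => (u * Complex.exp (s * x * Complex.I)).re) ν := hi2.re
    rw [integral_sub (integrable_const 1) hi3]
    have : ∫ x, (u * Complex.exp (s * x * Complex.I)).re ∂ν
        = (∫ x, u * Complex.exp (s * x * Complex.I) ∂ν).re := integral_re hi2
    rw [this, integral_const_mul, ← charFun_apply_real, hu2, h]
    simp
  have h2 : ∀ x : ℝ, ‖u * Complex.exp (s * x * Complex.I)‖ = 1 := fun x => by
    rw [norm_mul, hu, hnorm, one_mul]
  have h3 : ∀ x : ℝ, 0 ≤ 1 - (u * Complex.exp (s * x * Complex.I)).re := fun x => by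
    have := (Complex.re_le_norm (u * Complex.exp (s * x * Complex.I))).trans (h2 x).le
    linarith
  rw [integral_eq_zero_iff_of_nonneg h3
    ((integrable_const 1).sub (hint.const_mul u).re)] at h1
  refine ⟨u⁻¹, ?_⟩
  filter_upwards [h1] with x hx
  have hre : (u * Complex.exp (s * x * Complex.I)).re = 1 := by
    simp only [Pi.zero_apply] at hx; linarith
  have him : (u * Complex.exp (s * x * Complex.I)).im = 0 := by
    have := h2 x
    rw [← sq_eq_sq₀ (norm_nonneg _) zero_le_one, Complex.sq_norm, Complex.normSq_apply, hre] at this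
    nlinarith
  have : u * Complex.exp (s * x * Complex.I) = 1 := Complex.ext hre him
  exact eq_inv_of_mul_eq_one_right this

/-- For almost every `x`, all the `s n * (x - a)` are multiples of `2π`. As they tend to 0, one of
them vanishes, and `x = a`. -/
theorem exists_eq_smul_dirac_of_norm_charFun (ν : Measure ℝ) [IsFiniteMeasure ν] (hν : ν ≠ 0)
    {s : ℕ → ℝ} (hs0 : ∀ n, s n ≠ 0) (hs : Tendsto s atTop (𝓝 0))
    (h : ∀ n, ‖charFun ν (s n)‖ = ν.real Set.univ) :
    ∃ a, ν = ν Set.univ • Measure.dirac a := by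
  choose u hu using fun n => ae_eq_of_norm_charFun_eq ν (h n)
  have hall := ae_all_iff.2 hu
  have : NeBot (ae ν) := ae_neBot.2 hν
  obtain ⟨a, ha⟩ := hall.exists
  refine ⟨a, ?_⟩
  have hae : ∀ᵐ x ∂ν, x ∈ ({a} : Set ℝ) := by
    filter_upwards [hall] with x hx
    by_contra hne
    have hd : x - a ≠ 0 := sub_ne_zero.2 hne
    have h1 : Tendsto (fun n => |s n * (x - a)|) atTop (𝓝 0) := by
      have := (hs.mul_const (x - a)).abs
      simpa using this
    obtain ⟨n, hn⟩ := (h1.eventually (gt_mem_nhds Real.two_pi_pos)).exists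
    have h2 : Complex.exp (((s n * (x - a) : ℝ) : ℂ) * Complex.I) = 1 := by
      have e1 := (hx n).trans (ha n).symm
      have : ((s n * (x - a) : ℝ) : ℂ) * Complex.I = s n * x * Complex.I - s n * a * Complex.I := by
        push_cast; ring
      rw [this, Complex.exp_sub, e1, div_self (Complex.exp_ne_zero _)]
    obtain ⟨k, hk⟩ := Complex.exp_eq_one_iff.1 h2
    have h3 : s n * (x - a) = k * (2 * Real.pi) := by
      have := congrArg Complex.im hk
      simpa using this
    rw [h3, abs_mul, abs_of_pos Real.two_pi_pos] at hn
    have h4 : |(k : ℝ)| < 1 := by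
      by_contra! h4
      nlinarith [Real.two_pi_pos]
    have h5 : k = 0 := by
      rw [← Int.cast_abs] at h4
      have : |k| < 1 := by exact_mod_cast h4
      exact Int.abs_lt_one_iff.1 this
    rw [h5, Int.cast_zero, zero_mul] at h3
    rcases mul_eq_zero.1 h3 with h | h
    · exact hs0 n h
    · exact hd h
  have h1 := Measure.restrict_eq_self_of_ae_mem hae
  rw [Measure.restrict_singleton] at h1
  have h2 := congrArg (fun m => m Set.univ) h1
  simp only [Measure.smul_apply, measure_univ, smul_eq_mul, mul_one] at h2
  rw [← h2]; exact h1.symm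

theorem mpow_smul_dirac (b : ℝ≥0∞) (hb : b ≠ ⊤) (a : ℝ) (n : ℕ) :
    mpow (b • Measure.dirac a) n = b ^ n • Measure.dirac (n * a) := by
  have hf : IsFiniteMeasure (b • Measure.dirac a) := Measure.smul_finite _ hb
  induction n with
  | zero => simp [mpow]
  | succ n ih =>
    rw [mpow, ih, conv_smul_right, Measure.conv_smul_left, Measure.dirac_conv_dirac, smul_smul,
      pow_succ]
    congr 2
    push_cast; ring

variable {p : PMF ℕ} {c : ℕ → ℝ}

theorem survCoeff_eq (h1 : extProb p < 1) {l : ℕ} (hl : 1 ≤ l) :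
    survCoeff p l = shiftCoeff p (extProb p) l := by
  rw [survCoeff, if_pos hl, taylorCoeff_eq p h1]

theorem le_survCoeff (h1 : extProb p < 1) {l : ℕ} (hl : 1 ≤ l) : p l ≤ survCoeff p l := by
  rw [survCoeff_eq h1 hl, shiftCoeff]
  refine le_trans ?_ (ENNReal.le_tsum l)
  simp

theorem IsSenetaHeyde.survLaw_ne_zero (hc : IsSenetaHeyde p c) (hsup : 1 < mean p)
    (hfin : mean p < ⊤) : survLaw p c ≠ 0 := by
  intro h
  have := hc.survLaw_univ hsup hfin
  rw [h] at this
  exact (tsub_pos_of_lt hc.extProb_lt_one).ne this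

/-- A point mass at `a` in `map_survLaw` would give masses at the points `l * a` with `survCoeff p l
≠ 0`, all equal to `μ * a`; so `l = μ` for every such `l`. If `𝔠 = 0`, then `p 0 = 0` and `p` is
degenerate; if `𝔠 > 0`, then `l = 1` is one of them and `μ = 1`. -/
theorem IsSenetaHeyde.survLaw_ne_dirac (hc : IsSenetaHeyde p c) (hnd : p.support.Nontrivial)
    (hsup : 1 < mean p) (hfin : mean p < ⊤) (a : ℝ) :
    survLaw p c ≠ survLaw p c Set.univ • Measure.dirac a := by
  intro h
  have hmu := IsSenetaHeyde.mean_toReal_pos hsup hfin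
  set b := survLaw p c Set.univ with hb
  have hbt : b ≠ ⊤ := measure_ne_top _ _
  have hb0 : b ≠ 0 := by
    rw [hb, hc.survLaw_univ hsup hfin]; exact (tsub_pos_of_lt hc.extProb_lt_one).ne'
  have ha : 0 < a := by
    by_contra! ha
    have h1 : survLaw p c (Set.Ioi 0)ᶜ = 0 := by
      rw [survLaw, Measure.restrict_apply measurableSet_Ioi.compl,
        Set.compl_inter_self, measure_empty]
    rw [h] at h1
    simp [hb0, ha] at h1
  have h2 := congrArg (fun m => m {(mean p).toReal * a}ᶜ) (hc.map_survLaw hsup hfin)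
  have hms : MeasurableSet ({(mean p).toReal * a}ᶜ : Set ℝ) := (measurableSet_singleton _).compl
  simp only [Measure.sum_apply _ hms] at h2
  rw [h, Measure.map_smul, Measure.map_dirac' (by fun_prop : Measurable ((mean p).toReal * ·))] at h2
  simp only [mpow_smul_dirac b hbt] at h2
  have h3 : ∀ l, survCoeff p l ≠ 0 → (l : ℝ) = (mean p).toReal := by
    intro l hl
    have h4 : survCoeff p l * (b ^ l * Measure.dirac ((l : ℝ) * a) {(mean p).toReal * a}ᶜ) = 0 := by
      have h5 : (b • Measure.dirac ((mean p).toReal * a)) {(mean p).toReal * a}ᶜ = 0 := by simp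
      rw [h5] at h2
      simpa using ENNReal.tsum_eq_zero.1 h2.symm l
    by_contra hne
    have h6 : Measure.dirac ((l : ℝ) * a) {(mean p).toReal * a}ᶜ = 1 := by
      rw [Measure.dirac_apply' _ hms]
      have : (l : ℝ) * a ≠ (mean p).toReal * a := fun h => hne (mul_right_cancel₀ ha.ne' h)
      simp [this]
    rw [h6, mul_one] at h4
    exact mul_ne_zero hl (pow_ne_zero _ hb0) h4
  obtain ⟨k, hk, hpk⟩ := exists_two_le hsup
  have hk3 := h3 k (fun h0 => hpk (le_zero_iff.1 (h0 ▸ le_survCoeff hc.extProb_lt_one (by omega))))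
  by_cases hc0 : extProb p = 0
  · have hp0 : p 0 = 0 := by
      have := egf_extProb p
      rw [hc0, egf, tsum_eq_single 0] at this
      · simpa using this
      · intro j hj; simp [hj]
    refine hnd.not_subset_singleton (x := k) fun j hj => ?_
    have hj0 : j ≠ 0 := by rintro rfl; exact hj hp0
    have hj3 := h3 j (fun h0 => hj (le_zero_iff.1
      (h0 ▸ le_survCoeff hc.extProb_lt_one (by omega))))
    exact_mod_cast hj3.trans hk3.symm
  · have h7 := h3 1 (by
      rw [survCoeff_eq hc.extProb_lt_one le_rfl, shiftCoeff]
      refine fun h0 => ?_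
      have := ENNReal.tsum_eq_zero.1 h0 k
      refine mul_ne_zero (mul_ne_zero ?_ (pow_ne_zero _ hc0)) hpk this
      simp; omega)
    rw [← h7] at hmu
    simp at hmu

theorem IsSenetaHeyde.enorm_charFun_mul_le (hc : IsSenetaHeyde p c) (hsup : 1 < mean p)
    (hfin : mean p < ⊤) (t : ℝ) :
    ‖charFun (survLaw p c) ((mean p).toReal * t)‖ₑ ≤ sgf p ‖charFun (survLaw p c) t‖ₑ := by
  rw [← (hc.hasSum_charFun_survLaw hsup hfin t).tsum_eq, sgf]
  refine (enorm_tsum_le_tsum_enorm).trans (ENNReal.tsum_le_tsum fun l => ?_)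
  rw [enorm_mul, enorm_pow, ← ofReal_norm, Complex.norm_real, Real.norm_of_nonneg
    ENNReal.toReal_nonneg, ENNReal.ofReal_toReal (survCoeff_ne_top p l)]

theorem IsSenetaHeyde.real_survLaw_univ (hc : IsSenetaHeyde p c) (hsup : 1 < mean p)
    (hfin : mean p < ⊤) :
    (survLaw p c).real Set.univ = (1 - extProb p).toReal := by
  rw [measureReal_def, hc.survLaw_univ hsup hfin]

/-- Since `sgf p y < y` for `0 < y < 1 - 𝔠`, equality at `t` propagates to `t / μ`, hence to
frequencies tending to 0, and `survLaw` would be a point mass. -/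
theorem IsSenetaHeyde.enorm_charFun_lt (hc : IsSenetaHeyde p c) (hnd : p.support.Nontrivial)
    (hsup : 1 < mean p) (hfin : mean p < ⊤) {t : ℝ} (ht : t ≠ 0) :
    ‖charFun (survLaw p c) t‖ₑ < 1 - extProb p := by
  have hmu := IsSenetaHeyde.mean_toReal_pos hsup hfin
  have hmu0 : (mean p).toReal ≠ 0 := by positivity
  have hc1 := hc.extProb_lt_one
  have hle : ∀ t, ‖charFun (survLaw p c) t‖ₑ ≤ 1 - extProb p := fun t =>
    ENNReal.le_sub_of_add_le_left hc1.ne_top (hc.enorm_charFun_survLaw_le hsup hfin t)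
  refine (hle t).lt_of_ne fun heq => ?_
  have hback : ∀ s, ‖charFun (survLaw p c) ((mean p).toReal * s)‖ₑ = 1 - extProb p →
      ‖charFun (survLaw p c) s‖ₑ = 1 - extProb p := by
    intro s hs
    refine (hle s).eq_of_not_lt fun hlt => ?_
    have h1 := hc.enorm_charFun_mul_le hsup hfin s
    rw [hs] at h1
    set y := ‖charFun (survLaw p c) s‖ₑ
    rcases eq_or_ne y 0 with hy | hy
    · rw [hy, sgf] at h1
      have : ∑' l, survCoeff p l * 0 ^ l = 0 := by
        refine ENNReal.tsum_eq_zero.2 fun l => ?_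
        rcases l with _ | l <;> simp [survCoeff]
      rw [this] at h1
      exact (tsub_pos_of_lt hc1).not_ge h1
    · have h2 : extProb p + y < 1 := by
        have := ENNReal.add_lt_add_left hc1.ne_top hlt
        rwa [add_tsub_cancel_of_le hc1.le] at this
      have h3 := egf_lt_self hsup hfin (ENNReal.lt_add_right hc1.ne_top hy) h2
      rw [egf_extProb_add hc1, ENNReal.add_lt_add_iff_left hc1.ne_top] at h3
      exact absurd (h3.trans hlt) h1.not_gt
  have hall : ∀ n : ℕ, ‖charFun (survLaw p c) (t / (mean p).toReal ^ n)‖ₑ = 1 - extProb p := by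
    intro n
    induction n with
    | zero => simpa using heq
    | succ n ih =>
      refine hback _ ?_
      rw [← ih]; congr 2
      field_simp
      ring
  obtain ⟨a, ha⟩ := exists_eq_smul_dirac_of_norm_charFun (survLaw p c)
    (hc.survLaw_ne_zero hsup hfin) (s := fun n => t / (mean p).toReal ^ n)
    (fun n => div_ne_zero ht (pow_ne_zero _ hmu0))
    (tendsto_const_nhds.div_atTop (tendsto_pow_atTop_atTop_of_one_lt hmu)) fun n => by
      rw [hc.real_survLaw_univ hsup hfin, ← hall n, toReal_enorm]
  exact hc.survLaw_ne_dirac hnd hsup hfin a ha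

end Lattice

/-! ### Absolute continuity of the law of `W` on survival -/

section AbsolutelyContinuous

variable {p : PMF ℕ} {c : ℕ → ℝ}

/-- Compactness bounds the characteristic function by some `r < 1 - 𝔠` for `1 ≤ |t| ≤ μ`; each
multiplication of `t` by μ then gains a factor κ. -/
theorem IsSenetaHeyde.exists_charFun_decay (hc : IsSenetaHeyde p c) (hnd : p.support.Nontrivial)
    (hsup : 1 < mean p) (hfin : mean p < ⊤) :
    ∃ κ : ℝ≥0∞, κ < 1 ∧ ∀ n : ℕ, ∀ t : ℝ, (mean p).toReal ^ n ≤ |t| →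
      |t| ≤ (mean p).toReal ^ (n + 1) → ‖charFun (survLaw p c) t‖ₑ ≤ κ ^ n := by
  have hmu := IsSenetaHeyde.mean_toReal_pos hsup hfin
  have hmu0 : 0 < (mean p).toReal := by positivity
  have hc1 := hc.extProb_lt_one
  set m := (mean p).toReal
  have hK : IsCompact (Metric.closedBall (0 : ℝ) m \ Metric.ball 0 1) :=
    (isCompact_closedBall 0 m).diff Metric.isOpen_ball
  have hKne : (Metric.closedBall (0 : ℝ) m \ Metric.ball 0 1).Nonempty :=
    ⟨m, by simp [abs_of_pos hmu0, hmu.le]⟩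
  have hcont : Continuous fun t => ‖charFun (survLaw p c) t‖ₑ := by fun_prop
  obtain ⟨t0, ht0, hmax⟩ := hK.exists_isMaxOn hKne hcont.continuousOn
  have ht0' : t0 ≠ 0 := by
    rintro rfl
    simp at ht0
  have hlt := hc.enorm_charFun_lt hnd hsup hfin ht0'
  obtain ⟨r, hr1, hr2⟩ := exists_between hlt
  have hr0 : r ≠ 0 := (zero_le.trans_lt hr1).ne'
  have hr3 : extProb p + r < 1 := by
    have := ENNReal.add_lt_add_left hc1.ne_top hr2
    rwa [add_tsub_cancel_of_le hc1.le] at this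
  obtain ⟨κ, hκ, hκ2⟩ := exists_sgf_le_mul hsup hfin hc1 hr0 hr3
  refine ⟨κ, hκ, ?_⟩
  have hr4 : r ≤ 1 := (le_add_self.trans hr3.le)
  -- The factor `r` keeps the values in `[0, r]`, where the contraction by κ is available.
  suffices h : ∀ n : ℕ, ∀ t : ℝ, m ^ n ≤ |t| → |t| ≤ m ^ (n + 1) →
      ‖charFun (survLaw p c) t‖ₑ ≤ κ ^ n * r from fun n t h1 h2 =>
    (h n t h1 h2).trans (mul_le_of_le_one_right zero_le hr4)
  intro n
  induction n with
  | zero =>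
    intro t h1 h2
    rw [pow_zero, one_mul]
    refine (hmax (a := t) ?_).trans hr1.le
    simpa using And.intro h2 h1
  | succ n ih =>
    intro t h1 h2
    have h3 := ih (t / m) (by
      rw [abs_div, abs_of_pos hmu0, le_div_iff₀ hmu0, ← pow_succ]; exact h1) (by
      rw [abs_div, abs_of_pos hmu0, div_le_iff₀ hmu0, ← pow_succ]; exact h2)
    have h4 := hc.enorm_charFun_mul_le hsup hfin (t / m)
    rw [show m * (t / m) = t by field_simp] at h4
    refine h4.trans ((hκ2 _ (h3.trans (mul_le_of_le_one_left zero_le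
      (pow_le_one₀ zero_le hκ.le)))).trans ?_)
    calc _ ≤ κ * (κ ^ n * r) := by gcongr
      _ = κ ^ (n + 1) * r := by ring

theorem IsSenetaHeyde.exists_mpow_absolutelyContinuous (hc : IsSenetaHeyde p c)
    (hnd : p.support.Nontrivial) (hsup : 1 < mean p) (hfin : mean p < ⊤) :
    ∃ J : ℕ, ∀ n, J ≤ n → mpow (survLaw p c) n ≪ volume := by
  have hmu := IsSenetaHeyde.mean_toReal_pos hsup hfin
  have hmu0 : 0 < (mean p).toReal := by positivity
  obtain ⟨κ, hκ, hdec⟩ := hc.exists_charFun_decay hnd hsup hfin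
  set m := (mean p).toReal
  have hκt : κ.toReal < 1 := by
    simpa using (ENNReal.toReal_lt_toReal hκ.ne_top ENNReal.one_ne_top).2 hκ
  -- With `κ ^ J < μ ^ (-2)` the `J`-th power is `O(1 / t ^ 2)`, which is integrable.
  obtain ⟨J, hJ⟩ := exists_pow_lt_of_lt_one (y := κ.toReal) (x := (m ^ 2)⁻¹) (by positivity) hκt
  refine ⟨J, ?_⟩
  have hint : Integrable (charFun (mpow (survLaw p c) J)) := by
    have hg : Integrable fun t : ℝ => 2 * m ^ 2 * (1 + t ^ 2)⁻¹ :=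
      integrable_inv_one_add_sq.const_mul _
    refine hg.mono' (by fun_prop) (ae_of_all _ fun t => ?_)
    rw [charFun_mpow, norm_pow]
    have hle1 : ‖charFun (survLaw p c) t‖ ≤ 1 := by
      have h := hc.enorm_charFun_survLaw_le hsup hfin t
      have h2 : ‖charFun (survLaw p c) t‖ₑ ≤ 1 := le_add_self.trans h
      rw [← toReal_enorm]
      simpa using ENNReal.toReal_mono ENNReal.one_ne_top h2
    rw [← div_eq_mul_inv, le_div_iff₀ (by positivity)]
    have hm2 : 1 ≤ m ^ 2 := one_le_pow₀ hmu.le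
    rcases le_or_gt 1 |t| with ht | ht
    · obtain ⟨n, hn1, hn2⟩ := exists_nat_pow_near ht hmu
      have h1 := hdec n t hn1 hn2.le
      have h2 : ‖charFun (survLaw p c) t‖ ≤ κ.toReal ^ n := by
        rw [← toReal_enorm, ← ENNReal.toReal_pow]
        exact ENNReal.toReal_mono (ENNReal.pow_ne_top hκ.ne_top) h1
      have h3 : ‖charFun (survLaw p c) t‖ ^ J ≤ ((m ^ n) ^ 2)⁻¹ := by
        calc ‖charFun (survLaw p c) t‖ ^ J ≤ (κ.toReal ^ n) ^ J := by gcongr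
          _ = (κ.toReal ^ J) ^ n := by ring
          _ ≤ ((m ^ 2)⁻¹) ^ n := by gcongr
          _ = ((m ^ n) ^ 2)⁻¹ := by rw [inv_pow]; ring
      have h4 : 1 + t ^ 2 ≤ 2 * t ^ 2 := by
        have : 1 ≤ |t| ^ 2 := one_le_pow₀ ht
        rw [sq_abs] at this; linarith
      have h5 : t ^ 2 ≤ m ^ 2 * (m ^ n) ^ 2 := by
        rw [← sq_abs t, ← mul_pow, ← pow_succ']; gcongr
      calc ‖charFun (survLaw p c) t‖ ^ J * (1 + t ^ 2)
          ≤ ((m ^ n) ^ 2)⁻¹ * (2 * (m ^ 2 * (m ^ n) ^ 2)) := by gcongr; linarith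
        _ = 2 * m ^ 2 := by field_simp
    · have h1 : ‖charFun (survLaw p c) t‖ ^ J ≤ 1 := pow_le_one₀ (norm_nonneg _) hle1
      have h2 : t ^ 2 ≤ 1 := by rw [← sq_abs]; exact pow_le_one₀ (abs_nonneg _) ht.le
      nlinarith [sq_nonneg t]
  intro n hn
  obtain ⟨k, rfl⟩ := Nat.exists_eq_add_of_le hn
  rw [add_comm, mpow_add]
  exact Measure.conv_absolutelyContinuous
    (absolutelyContinuous_of_integrable_charFun _ hint)

/-- The `r`-fold iterate of the operator `Ψ ↦ (n ↦ ∑ l, a l * Ψ (n + l))`. -/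
def shiftSum (a : ℕ → ℝ≥0∞) : ℕ → (ℕ → ℝ≥0∞) → ℕ → ℝ≥0∞
  | 0, Ψ, n => Ψ n
  | r + 1, Ψ, n => ∑' l, a l * shiftSum a r Ψ (n + l)

theorem shiftSum_mono (a : ℕ → ℝ≥0∞) (r : ℕ) {Ψ Φ : ℕ → ℝ≥0∞} (h : ∀ n, Ψ n ≤ Φ n) (n : ℕ) :
    shiftSum a r Ψ n ≤ shiftSum a r Φ n := by
  induction r generalizing n with
  | zero => exact h n
  | succ r ih => exact ENNReal.tsum_le_tsum fun l => by gcongr; exact ih _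

/-- Geometric sequences are eigenvectors of the operator. -/
theorem shiftSum_geometric (a : ℕ → ℝ≥0∞) (r : ℕ) (K y : ℝ≥0∞) (n : ℕ) :
    shiftSum a r (fun k => K * y ^ k) n = K * y ^ n * (∑' l, a l * y ^ l) ^ r := by
  induction r generalizing n with
  | zero => simp [shiftSum]
  | succ r ih =>
    simp only [shiftSum, ih]
    rw [pow_succ', ← mul_assoc, ← ENNReal.tsum_mul_left, ← ENNReal.tsum_mul_right]
    exact tsum_congr fun l => by ring

/-- The factors `ν'` are expanded one at a time; the offset `j` counts the factors ν already
produced. -/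
theorem conv_mpow_sum_apply (ν ν' : Measure ℝ) [IsFiniteMeasure ν] [IsFiniteMeasure ν']
    (a : ℕ → ℝ≥0∞) (h : ν' = Measure.sum fun l => a l • mpow ν l) (r j : ℕ) {S : Set ℝ}
    (hS : MeasurableSet S) :
    ((mpow ν j).conv (mpow ν' r)) S = shiftSum a r (fun k => mpow ν k S) j := by
  induction r generalizing j with
  | zero => rw [mpow, Measure.conv_dirac_zero]; rfl
  | succ r ih =>
    have h1 : ∀ l, (mpow ν j).conv (a l • mpow ν l) = a l • mpow ν (j + l) := fun l => by
      rw [conv_smul_right, mpow_add]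
    have h2 : (mpow ν j).conv ν' = Measure.sum fun l => a l • mpow ν (j + l) := by
      rw [h, conv_sum_right]
      simp_rw [h1]
    rw [mpow, ← Measure.conv_assoc, h2]
    rw [Measure.conv, Measure.prod_sum_left, Measure.map_sum (by fun_prop),
      Measure.sum_apply _ hS]
    refine tsum_congr fun l => ?_
    rw [← ih, ← Measure.conv, Measure.conv_smul_left]
    rfl

theorem IsSenetaHeyde.mpow_image_mul (hc : IsSenetaHeyde p c) (hsup : 1 < mean p)
    (hfin : mean p < ⊤) (r : ℕ) {S : Set ℝ} (hS : MeasurableSet S) :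
    mpow (survLaw p c) r (((mean p).toReal * ·) ⁻¹' S)
      = shiftSum (survCoeff p) r (fun k => mpow (survLaw p c) k S) 0 := by
  have hm : Measurable ((mean p).toReal * ·) := by fun_prop
  have : IsFiniteMeasure ((survLaw p c).map ((mean p).toReal * ·)) := inferInstance
  rw [← conv_mpow_sum_apply _ _ _ (hc.map_survLaw hsup hfin) r 0 hS, mpow,
    Measure.dirac_zero_conv, ← map_mul_mpow, Measure.map_apply hm hS]

/-- A bootstrap over all convolution powers and all null sets at once. The bound `K * r ^ k` holds
because only the powers `k < J` can charge null sets; rescaling by μ and applying `map_survLaw`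
replaces `y` by `sgf p y ≤ κ * y` in a bound `K * y ^ k`, with the same `K`. Iterating, the mass of
a null set is at most `K * κ ^ n * r` for all `n`. -/
theorem IsSenetaHeyde.survLaw_absolutelyContinuous (hc : IsSenetaHeyde p c)
    (hnd : p.support.Nontrivial) (hsup : 1 < mean p) (hfin : mean p < ⊤) :
    survLaw p c ≪ volume := by
  have hmu := IsSenetaHeyde.mean_toReal_pos hsup hfin
  have hmu0 : 0 < (mean p).toReal := by positivity
  have hc1 := hc.extProb_lt_one
  obtain ⟨J, hJ⟩ := hc.exists_mpow_absolutelyContinuous hnd hsup hfin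
  obtain ⟨r, hr1, hr2⟩ := exists_between (tsub_pos_of_lt hc1)
  have hr3 : extProb p + r < 1 := by
    have := ENNReal.add_lt_add_left hc1.ne_top hr2
    rwa [add_tsub_cancel_of_le hc1.le] at this
  have hrt : r ≠ ⊤ := (le_add_self.trans_lt hr3).ne_top
  obtain ⟨κ, hκ, hκ2⟩ := exists_sgf_le_mul hsup hfin hc1 hr1.ne' hr3
  set m := (mean p).toReal
  set M := 1 - extProb p with hM
  have hMt : M ≠ ⊤ := ENNReal.sub_ne_top ENNReal.one_ne_top
  -- For `k < J` the total mass is `M ^ k = (M / r) ^ k * r ^ k`, and `M / r ≥ 1`.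
  set K := (M / r) ^ J with hKdef
  have hKt : K ≠ ⊤ := ENNReal.pow_ne_top (ENNReal.div_ne_top hMt hr1.ne')
  have hMr : 1 ≤ M / r := (ENNReal.le_div_iff_mul_le (Or.inl hr1.ne') (Or.inl hrt)).2
    (by rw [one_mul]; exact hr2.le)
  have hbase : ∀ N : Set ℝ, volume N = 0 → ∀ k, mpow (survLaw p c) k N ≤ K * r ^ k := by
    intro N hN k
    rcases le_or_gt J k with hk | hk
    · rw [hJ k hk hN]; exact zero_le
    · refine (measure_mono (Set.subset_univ N)).trans ?_
      rw [mpow_univ, hc.survLaw_univ hsup hfin]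
      calc M ^ k = (M / r) ^ k * r ^ k := by
            rw [← mul_pow, ENNReal.div_mul_cancel hr1.ne' hrt]
        _ ≤ K * r ^ k := by rw [hKdef]; gcongr
  have hiter : ∀ n : ℕ, ∀ N : Set ℝ, MeasurableSet N → volume N = 0 →
      ∀ k, mpow (survLaw p c) k N ≤ K * (κ ^ n * r) ^ k := by
    intro n
    induction n with
    | zero => intro N _ hN k; simpa using hbase N hN k
    | succ n ih =>
      intro N hNm hN k
      have hm0 : m ≠ 0 := hmu0.ne'
      set S := (m⁻¹ * ·) ⁻¹' N with hS
      have hSm : MeasurableSet S := (by fun_prop : Measurable (m⁻¹ * ·)) hNm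
      have hS0 : volume S = 0 := by
        rw [hS, Real.volume_preimage_mul_left (inv_ne_zero hm0), hN, mul_zero]
      have hNS : N = (m * ·) ⁻¹' S := by
        ext x; simp [hS, hm0]
      rw [hNS, hc.mpow_image_mul hsup hfin k hSm]
      refine (shiftSum_mono _ _ (ih S hSm hS0) 0).trans ?_
      rw [shiftSum_geometric, pow_zero, mul_one]
      have h1 : κ ^ n * r ≤ r := mul_le_of_le_one_left zero_le (pow_le_one₀ zero_le hκ.le)
      have h2 : ∑' l, survCoeff p l * (κ ^ n * r) ^ l ≤ κ ^ (n + 1) * r :=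
        (hκ2 _ h1).trans (by rw [pow_succ', mul_assoc])
      gcongr
  refine Measure.AbsolutelyContinuous.mk fun N hNm hN => ?_
  have hlim : Tendsto (fun n : ℕ => K * (κ ^ n * r)) atTop (𝓝 0) := by
    have h1 := ENNReal.tendsto_pow_atTop_nhds_zero_of_lt_one hκ
    have h2 := ENNReal.Tendsto.const_mul (a := K)
      (ENNReal.Tendsto.mul_const (b := r) h1 (Or.inr hrt)) (Or.inr hKt)
    simpa using h2
  refine le_zero_iff.1 (ge_of_tendsto' hlim fun n => ?_)
  have := hiter n N hNm hN 1
  rwa [mpow_one, pow_one] at this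

end AbsolutelyContinuous

/-! ### The density of the law of `W` and its convolution powers -/

section Density

variable {p : PMF ℕ} {c : ℕ → ℝ}

theorem measurable_w (p : PMF ℕ) (c : ℕ → ℝ) : Measurable (w p c) :=
  Measurable.ite measurableSet_Ioi (measurable_deriv _).ennreal_ofReal measurable_const

/-- The derivative of a distribution function is almost everywhere the density of the absolutely
continuous part, which here is everything. -/
theorem IsSenetaHeyde.survLaw_eq_withDensity (hc : IsSenetaHeyde p c)
    (hnd : p.support.Nontrivial) (hsup : 1 < mean p) (hfin : mean p < ⊤) :
    survLaw p c = volume.withDensity (w p c) := by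
  have := hc.isProbabilityMeasure_lawW hsup hfin
  have hcdf : (fun y => (gw p).real {t | W c t ≤ y}) = cdf (lawW p c) := by
    ext y
    rw [cdf_eq_real, lawW, measureReal_def, measureReal_def,
      Measure.map_apply_of_aemeasurable (hc.aemeasurable_W hsup hfin) measurableSet_Iic]
    rfl
  have h1 := (cdf (lawW p c)).ae_hasDerivAt
  rw [measure_cdf] at h1
  have h2 : w p c =ᵐ[volume] (survLaw p c).rnDeriv volume := by
    filter_upwards [h1, Measure.rnDeriv_restrict (lawW p c) volume measurableSet_Ioi,
      Measure.rnDeriv_lt_top (lawW p c) volume] with x hx1 hx2 hx3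
    rw [survLaw, hx2, w]
    by_cases hx : 0 < x
    · rw [if_pos hx, Set.indicator_of_mem (by exact hx), hcdf, hx1.deriv,
        ENNReal.ofReal_toReal hx3.ne]
    · rw [if_neg hx, Set.indicator_of_notMem (by exact hx)]
  rw [withDensity_congr_ae h2]
  exact (Measure.withDensity_rnDeriv_eq _ _
    (hc.survLaw_absolutelyContinuous hnd hsup hfin)).symm

theorem measurable_convPow {g : ℝ → ℝ≥0∞} (hg : Measurable g) (n : ℕ) :
    Measurable (convPow g n) := by
  induction n with
  | zero => exact measurable_const
  | succ n ih =>
    cases n with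
    | zero => exact hg
    | succ n => exact measurable_lconvolution volume hg ih

theorem mpow_eq_withDensity {ν : Measure ℝ} [IsFiniteMeasure ν] {g : ℝ → ℝ≥0∞} (hg : Measurable g)
    (h : ν = volume.withDensity g) (n : ℕ) :
    mpow ν (n + 1) = volume.withDensity (convPow g (n + 1)) := by
  induction n with
  | zero => rw [zero_add, mpow_one]; exact h
  | succ n ih =>
    rw [mpow, ih, convPow]
    conv_lhs => rw [h]
    exact conv_withDensity_eq_lconvolution hg (measurable_convPow hg _)

/-- With `a 0 = 0` each iteration raises the index by at least one. For `r ≥ 1` the conventional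
value of `convPow` at 0 is therefore never read. -/
theorem shiftSum_congr {a : ℕ → ℝ≥0∞} (ha : a 0 = 0) (r : ℕ) {Ψ Φ : ℕ → ℝ≥0∞} (n : ℕ)
    (h : ∀ k, n + r ≤ k → Ψ k = Φ k) : shiftSum a r Ψ n = shiftSum a r Φ n := by
  induction r generalizing n with
  | zero => exact h n le_rfl
  | succ r ih =>
    refine tsum_congr fun l => ?_
    rcases l with _ | l
    · rw [ha, zero_mul, zero_mul]
    · rw [ih _ fun k hk => h k (by omega)]

theorem shiftSum_const_mul (a : ℕ → ℝ≥0∞) (r : ℕ) (b : ℝ≥0∞) (Ψ : ℕ → ℝ≥0∞) (n : ℕ) :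
    shiftSum a r (fun k => b * Ψ k) n = b * shiftSum a r Ψ n := by
  induction r generalizing n with
  | zero => rfl
  | succ r ih =>
    simp only [shiftSum, ih]
    rw [← ENNReal.tsum_mul_left]
    exact tsum_congr fun l => by ring

theorem measurable_shiftSum (a : ℕ → ℝ≥0∞) (r : ℕ) {Ψ : ℕ → ℝ → ℝ≥0∞}
    (hΨ : ∀ k, Measurable (Ψ k)) (n : ℕ) : Measurable fun x => shiftSum a r (fun k => Ψ k x) n := by
  induction r generalizing n with
  | zero => exact hΨ n
  | succ r ih => exact Measurable.tsum fun l => (ih _).const_mul _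

theorem lintegral_shiftSum (a : ℕ → ℝ≥0∞) (r : ℕ) {Ψ : ℕ → ℝ → ℝ≥0∞}
    (hΨ : ∀ k, Measurable (Ψ k)) (μ : Measure ℝ) (n : ℕ) :
    ∫⁻ x, shiftSum a r (fun k => Ψ k x) n ∂μ = shiftSum a r (fun k => ∫⁻ x, Ψ k x ∂μ) n := by
  induction r generalizing n with
  | zero => rfl
  | succ r ih =>
    simp only [shiftSum]
    rw [lintegral_tsum fun l => ((measurable_shiftSum a r hΨ _).const_mul _).aemeasurable]
    exact tsum_congr fun l => by rw [lintegral_const_mul _ (measurable_shiftSum a r hΨ _), ih]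

theorem survCoeff_zero (p : PMF ℕ) : survCoeff p 0 = 0 := by simp [survCoeff]

theorem lintegral_comp_mul_left (f : ℝ → ℝ≥0∞) (hf : Measurable f) {m : ℝ} (hm : 0 < m) :
    ENNReal.ofReal m * ∫⁻ x, f (m * x) = ∫⁻ x, f x := by
  have h1 : ∫⁻ x, f (m * x) = ∫⁻ y, f y ∂(volume.map (m * ·)) :=
    (lintegral_map hf (by fun_prop)).symm
  rw [h1, Real.map_volume_mul_left hm.ne', lintegral_smul_measure, abs_of_pos (inv_pos.2 hm),
    smul_eq_mul, ← mul_assoc, ← ENNReal.ofReal_mul hm.le, mul_inv_cancel₀ hm.ne',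
    ENNReal.ofReal_one, one_mul]

theorem setLIntegral_comp_mul_left (f : ℝ → ℝ≥0∞) (hf : Measurable f) {m : ℝ} (hm : 0 < m)
    {S : Set ℝ} (hS : MeasurableSet S) :
    ENNReal.ofReal m * ∫⁻ x in (m * ·) ⁻¹' S, f (m * x) = ∫⁻ x in S, f x := by
  have hm' : Measurable (m * ·) := by fun_prop
  rw [← lintegral_indicator (hm' hS), ← lintegral_indicator hS,
    ← lintegral_comp_mul_left _ (hf.indicator hS) hm]
  rfl

/-- The density form of `mpow_image_mul`, obtained by comparing integrals over measurable sets,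
hence an identity almost everywhere; the factor μ is the Jacobian. For `r = 0` both sides are 0 by
convention. -/
theorem IsSenetaHeyde.ae_convPow_eq (hc : IsSenetaHeyde p c)
    (hnd : p.support.Nontrivial) (hsup : 1 < mean p) (hfin : mean p < ⊤) (r : ℕ) :
    ∀ᵐ x : ℝ, convPow (w p c) r x = mean p * shiftSum (survCoeff p) r
      (fun k => convPow (w p c) k ((mean p).toReal * x)) 0 := by
  have hmu0 : 0 < (mean p).toReal :=
    one_pos.trans (IsSenetaHeyde.mean_toReal_pos hsup hfin)
  set m := (mean p).toReal with hm
  have hm2 : ENNReal.ofReal m = mean p := ENNReal.ofReal_toReal hfin.ne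
  have hg := measurable_convPow (measurable_w p c)
  rcases r with _ | r
  · exact ae_of_all _ fun x => by simp [convPow, shiftSum]
  have hdens := mpow_eq_withDensity (measurable_w p c) (hc.survLaw_eq_withDensity hnd hsup hfin)
  have hmeas : Measurable fun x => mean p * shiftSum (survCoeff p) (r + 1)
      (fun k => convPow (w p c) k (m * x)) 0 :=
    (measurable_shiftSum _ _ (fun k => (hg k).comp (by fun_prop : Measurable (m * ·))) 0).const_mul _
  refine (withDensity_eq_iff (hg _).aemeasurable hmeas.aemeasurable ?_).1 ?_
  · have h1 : ∫⁻ x, convPow (w p c) (r + 1) x = mpow (survLaw p c) (r + 1) Set.univ := by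
      rw [hdens, withDensity_apply _ MeasurableSet.univ, Measure.restrict_univ]
    rw [h1]; exact measure_ne_top _ _
  · rw [← hdens]
    ext S hS
    set T := (m⁻¹ * ·) ⁻¹' S with hT
    have hTm : MeasurableSet T := (by fun_prop : Measurable (m⁻¹ * ·)) hS
    have hST : S = (m * ·) ⁻¹' T := by
      ext x; simp [hT, hmu0.ne']
    have hk : ∀ k, Measurable fun x => convPow (w p c) k (m * x) := fun k =>
      (hg k).comp (by fun_prop)
    rw [withDensity_apply _ hS, lintegral_const_mul _ (measurable_shiftSum _ _ hk 0),
      lintegral_shiftSum _ _ hk,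
      ← shiftSum_const_mul, hST, hc.mpow_image_mul hsup hfin _ hTm]
    refine shiftSum_congr (survCoeff_zero p) _ _ fun k hk => ?_
    obtain ⟨k, rfl⟩ : ∃ j, k = j + 1 := ⟨k - 1, by omega⟩
    rw [← hm2, setLIntegral_comp_mul_left _ (hg _) hmu0 hTm, hdens, withDensity_apply _ hTm]

/-- The density of `μ ^ (-h) * (W_1 + ... + W_r)` on the event that all the `W_i` are positive. -/
def scaledDensity (p : PMF ℕ) (c : ℕ → ℝ) (h r : ℕ) (θ : ℝ) : ℝ≥0∞ :=
  mean p ^ h * convPow (w p c) r ((mean p).toReal ^ h * θ)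

theorem ae_comp_mul_left {P : ℝ → Prop} (h : ∀ᵐ x : ℝ, P x) {a : ℝ} (ha : a ≠ 0) :
    ∀ᵐ x : ℝ, P (a * x) := by
  have h1 := Real.volume_preimage_mul_left ha {x | ¬ P x}
  rw [ae_iff.1 h, mul_zero] at h1
  exact h1

theorem IsSenetaHeyde.ae_scaledDensity (hc : IsSenetaHeyde p c)
    (hnd : p.support.Nontrivial) (hsup : 1 < mean p) (hfin : mean p < ⊤) :
    ∀ᵐ θ : ℝ, ∀ h r, scaledDensity p c h r θ ≠ ⊤ ∧
      scaledDensity p c h r θ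
        = shiftSum (survCoeff p) r (fun k => scaledDensity p c (h + 1) k θ) 0 := by
  have hmu0 : 0 < (mean p).toReal :=
    one_pos.trans (IsSenetaHeyde.mean_toReal_pos hsup hfin)
  have hg := measurable_convPow (measurable_w p c)
  have hdens := mpow_eq_withDensity (measurable_w p c) (hc.survLaw_eq_withDensity hnd hsup hfin)
  refine ae_all_iff.2 fun h => ae_all_iff.2 fun r => ?_
  have h1 : ∀ᵐ x : ℝ, convPow (w p c) r x < ⊤ := by
    rcases r with _ | r
    · exact ae_of_all _ fun x => by simp [convPow]
    · refine ae_lt_top (hg _) ?_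
      have h1 : ∫⁻ x, convPow (w p c) (r + 1) x = mpow (survLaw p c) (r + 1) Set.univ := by
        rw [hdens, withDensity_apply _ MeasurableSet.univ, Measure.restrict_univ]
      rw [h1]; exact measure_ne_top _ _
  filter_upwards [ae_comp_mul_left h1 (pow_ne_zero h hmu0.ne'),
    ae_comp_mul_left (hc.ae_convPow_eq hnd hsup hfin r) (pow_ne_zero h hmu0.ne')] with θ h1 h2
  refine ⟨ENNReal.mul_ne_top (ENNReal.pow_ne_top hfin.ne) h1.ne, ?_⟩
  simp only [scaledDensity, shiftSum_const_mul]
  rw [h2, pow_succ, mul_assoc]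
  simp_rw [pow_succ', mul_assoc]

end Density

/-! ### Exponential moments of `W` -/

section Zeta

variable {p : PMF ℕ} {c : ℕ → ℝ} {lam : ℝ}

/-- The part of `ζ_h` that comes from the event of survival. -/
def survZeta (p : PMF ℕ) (c : ℕ → ℝ) (lam : ℝ) (h : ℕ) : ℝ≥0∞ :=
  ∫⁻ x, ENNReal.ofReal (Real.exp (lam / (mean p).toReal ^ h * x)) ∂survLaw p c

theorem measurable_expWeight (a : ℝ) : Measurable fun x : ℝ => ENNReal.ofReal (Real.exp (a * x)) := by
  fun_prop

theorem IsSenetaHeyde.zeta_eq (hc : IsSenetaHeyde p c) (hsup : 1 < mean p) (hfin : mean p < ⊤)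
    (lam : ℝ) (h : ℕ) : zeta p c lam h = extProb p + survZeta p c lam h := by
  have h1 : zeta p c lam h
      = ∫⁻ x, ENNReal.ofReal (Real.exp (lam / (mean p).toReal ^ h * x)) ∂lawW p c := by
    rw [lawW, lintegral_map' (measurable_expWeight _).aemeasurable (hc.aemeasurable_W hsup hfin)]
    rfl
  rw [h1, hc.lawW_eq hsup hfin, lintegral_add_measure, lintegral_smul_measure,
    lintegral_dirac' _ (measurable_expWeight _)]
  simp [survZeta]

theorem IsSenetaHeyde.zeta_sub (hc : IsSenetaHeyde p c) (hsup : 1 < mean p) (hfin : mean p < ⊤)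
    (lam : ℝ) (h : ℕ) : zeta p c lam h - extProb p = survZeta p c lam h := by
  rw [hc.zeta_eq hsup hfin, ENNReal.add_sub_cancel_left hc.extProb_lt_one.ne_top]

theorem lintegral_exp_mpow (ν : Measure ℝ) [IsFiniteMeasure ν] (a : ℝ) (r : ℕ) :
    ∫⁻ x, ENNReal.ofReal (Real.exp (a * x)) ∂mpow ν r
      = (∫⁻ x, ENNReal.ofReal (Real.exp (a * x)) ∂ν) ^ r := by
  induction r with
  | zero => rw [mpow, lintegral_dirac' _ (measurable_expWeight a)]; simp
  | succ r ih =>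
    rw [mpow, Measure.lintegral_conv (measurable_expWeight a)]
    simp_rw [mul_add, Real.exp_add, ENNReal.ofReal_mul (Real.exp_pos _).le]
    simp_rw [lintegral_const_mul _ (measurable_expWeight a), ih]
    rw [lintegral_mul_const _ (measurable_expWeight a), pow_succ']

/-- Exponentials integrated against `map_survLaw`: convolution powers become powers. -/
theorem IsSenetaHeyde.survZeta_eq_sgf (hc : IsSenetaHeyde p c) (hsup : 1 < mean p)
    (hfin : mean p < ⊤) (lam : ℝ) (h : ℕ) :
    survZeta p c lam h = sgf p (survZeta p c lam (h + 1)) := by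
  have hmu0 : 0 < (mean p).toReal :=
    one_pos.trans (IsSenetaHeyde.mean_toReal_pos hsup hfin)
  have h1 : survZeta p c lam h
      = ∫⁻ x, ENNReal.ofReal (Real.exp (lam / (mean p).toReal ^ (h + 1) * x))
        ∂(survLaw p c).map ((mean p).toReal * ·) := by
    rw [lintegral_map (measurable_expWeight _) (by fun_prop), survZeta]
    refine lintegral_congr fun x => ?_
    congr 2
    field_simp
    ring
  rw [h1, hc.map_survLaw hsup hfin, lintegral_sum_measure, sgf]
  refine tsum_congr fun l => ?_
  rw [lintegral_smul_measure, lintegral_exp_mpow]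
  rfl

theorem IsSenetaHeyde.survZeta_ne_zero (hc : IsSenetaHeyde p c) (hsup : 1 < mean p)
    (hfin : mean p < ⊤) (lam : ℝ) (h : ℕ) : survZeta p c lam h ≠ 0 := by
  intro h0
  rw [survZeta, lintegral_eq_zero_iff (measurable_expWeight _)] at h0
  refine hc.survLaw_ne_zero hsup hfin ?_
  rw [← ae_eq_bot, ← eventually_false_iff_eq_bot]
  filter_upwards [h0] with x hx
  simp at hx
  exact absurd hx (not_le.2 (Real.exp_pos _))

theorem IsSenetaHeyde.survZeta_ne_top (hc : IsSenetaHeyde p c) (hsup : 1 < mean p)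
    (hfin : mean p < ⊤) (hlam : zeta p c lam 0 < ⊤) (h : ℕ) : survZeta p c lam h ≠ ⊤ := by
  have hmu := IsSenetaHeyde.mean_toReal_pos hsup hfin
  have h0 : survZeta p c lam 0 ≠ ⊤ := by
    rw [hc.zeta_eq hsup hfin] at hlam
    exact (le_add_self.trans_lt hlam).ne
  -- On the positive half-line the weight at rank `h` is at most 1 if `lam ≤ 0` and at most the
  -- weight at rank 0 otherwise; the sum of the two bounds covers both signs.
  refine ne_top_of_le_ne_top (ENNReal.add_ne_top.2 ⟨h0, measure_ne_top (survLaw p c) Set.univ⟩) ?_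
  rw [survZeta, survZeta, ← lintegral_one, ← lintegral_add_right _ measurable_const]
  refine lintegral_mono_ae ?_
  have hpos : ∀ᵐ x ∂survLaw p c, x ∈ Set.Ioi (0 : ℝ) := ae_restrict_mem measurableSet_Ioi
  filter_upwards [hpos] with x hx
  replace hx : 0 < x := hx
  rcases le_or_gt lam 0 with hl | hl
  · refine le_add_left (ENNReal.ofReal_le_one.2 (Real.exp_le_one_iff.2 ?_))
    exact mul_nonpos_of_nonpos_of_nonneg (div_nonpos_of_nonpos_of_nonneg hl (by positivity)) hx.le
  · refine le_add_right (ENNReal.ofReal_le_ofReal (Real.exp_le_exp.2 ?_))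
    rw [pow_zero, div_one]
    gcongr
    exact div_le_self hl.le (one_le_pow₀ hmu.le)

/-- The substitution `x = μ ^ n * θ` turns `scaledDensity` into the density of a convolution power,
whose exponential moment is a power of `survZeta`. For `r = 0` the convention `convPow _ 0 = 0`
gives 0 in place of 1, which `hq` makes harmless. -/
theorem IsSenetaHeyde.lintegral_thetaLaw (hc : IsSenetaHeyde p c)
    (hnd : p.support.Nontrivial) (hsup : 1 < mean p) (hfin : mean p < ⊤) (lam : ℝ)
    (n r : ℕ) (q : ℝ≥0∞) (hq : r = 0 → q = 0) {f : ℝ → ℝ≥0∞} (hf : Measurable f)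
    (h : ∀ᵐ θ : ℝ, w p c θ * f θ = scaledDensity p c n r θ * q) :
    ∫⁻ θ, f θ ∂thetaLaw p c lam = survZeta p c lam n ^ r * q / survZeta p c lam 0 := by
  have hmu0 : 0 < (mean p).toReal :=
    one_pos.trans (IsSenetaHeyde.mean_toReal_pos hsup hfin)
  have hw := measurable_w p c
  have hg := measurable_convPow hw
  rw [thetaLaw, hc.zeta_sub hsup hfin, lintegral_withDensity_eq_lintegral_mul _ (by fun_prop) hf]
  set v := survZeta p c lam 0
  have h1 : ∀ᵐ θ : ℝ, ((fun θ => w p c θ * ENNReal.ofReal (Real.exp (lam * θ)) / v) * f) θ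
      = (q / v) * (mean p ^ n * (convPow (w p c) r ((mean p).toReal ^ n * θ) *
        ENNReal.ofReal (Real.exp (lam / (mean p).toReal ^ n * ((mean p).toReal ^ n * θ))))) := by
    filter_upwards [h] with θ hθ
    simp only [Pi.mul_apply]
    rw [show lam / (mean p).toReal ^ n * ((mean p).toReal ^ n * θ) = lam * θ by field_simp]
    calc _ = (w p c θ * f θ) * (ENNReal.ofReal (Real.exp (lam * θ)) / v) := by
          simp only [div_eq_mul_inv]; ring
      _ = _ := by rw [hθ, scaledDensity]; simp only [div_eq_mul_inv]; ring
  have hm1 : Measurable fun x => convPow (w p c) r x *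
      ENNReal.ofReal (Real.exp (lam / (mean p).toReal ^ n * x)) :=
    (hg r).mul (measurable_expWeight _)
  have hm2 : mean p ^ n = ENNReal.ofReal ((mean p).toReal ^ n) := by
    rw [ENNReal.ofReal_pow hmu0.le, ENNReal.ofReal_toReal hfin.ne]
  rw [lintegral_congr_ae h1, lintegral_const_mul _ (by fun_prop), lintegral_const_mul _ (by fun_prop),
    hm2, lintegral_comp_mul_left (fun x => convPow (w p c) r x *
      ENNReal.ofReal (Real.exp (lam / (mean p).toReal ^ n * x))) hm1 (by positivity)]
  rcases r with _ | r
  · rw [hq rfl]; simp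
  · have hdens := mpow_eq_withDensity hw (hc.survLaw_eq_withDensity hnd hsup hfin) r
    have h2 := lintegral_exp_mpow (survLaw p c) (lam / (mean p).toReal ^ n) (r + 1)
    rw [hdens, lintegral_withDensity_eq_lintegral_mul _ (hg _) (measurable_expWeight _)] at h2
    simp only [Pi.mul_apply] at h2
    rw [h2, mul_comm, ← mul_div_assoc]
    rfl

end Zeta

/-! ### Products of mass functions along lists -/

section ListProd

variable {α β : Type}

theorem tsum_list (G : List α → ℝ≥0∞) : ∑' d, G d = G [] + ∑' b, ∑' d, G (b :: d) := by
  let e : Unit ⊕ (α × List α) ≃ List α :=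
    { toFun := Sum.elim (fun _ => []) fun x => x.1 :: x.2
      invFun := fun l => match l with
        | [] => Sum.inl ()
        | b :: d => Sum.inr (b, d)
      left_inv := fun o => by rcases o with _ | _ <;> rfl
      right_inv := fun l => by cases l <;> rfl }
  rw [← e.tsum_eq, Summable.tsum_sum ENNReal.summable ENNReal.summable]
  refine congrArg₂ (· + ·) ((tsum_fintype _).trans (by simp [e])) ?_
  exact ENNReal.tsum_prod (f := fun b d => G (b :: d))

/-- The product of the masses `m a b`, for lists of the same length. -/
def listProd (m : α → β → ℝ≥0∞) : List α → List β → ℝ≥0∞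
  | [], [] => 1
  | a :: g, b :: d => m a b * listProd m g d
  | [], _ :: _ => 0
  | _ :: _, [] => 0

theorem tsum_listProd_cons (m : α → β → ℝ≥0∞) (a : α) (g : List α) (F : List β → ℝ≥0∞) :
    ∑' d, listProd m (a :: g) d * F d
      = ∑' b, m a b * ∑' d, listProd m g d * F (b :: d) := by
  rw [tsum_list]
  simp only [listProd, zero_mul, zero_add, mul_assoc, ENNReal.tsum_mul_left]

theorem tsum_listProd_nil (m : α → β → ℝ≥0∞) (F : List β → ℝ≥0∞) :
    ∑' d, listProd m [] d * F d = F [] := by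
  rw [tsum_list]
  simp [listProd]

theorem independent_apply (off : α → PMF β) (g : List α) (d : List β) :
    independent off g d = listProd (fun a b => off a b) g d := by
  induction g generalizing d with
  | nil => cases d <;> simp [independent, listProd]
  | cons a g ih =>
    rw [independent, PMF.bind_apply]
    cases d with
    | nil =>
      simp only [listProd, ENNReal.tsum_eq_zero, mul_eq_zero]
      refine fun b => Or.inr ?_
      rw [PMF.map_apply]
      simp
    | cons b d =>
      rw [listProd, tsum_eq_single b, PMF.map_apply, tsum_eq_single d, if_pos rfl, ih]
      · intro d' hd; simp [hd.symm]
      · intro b' hb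
        rw [PMF.map_apply]
        simp [hb.symm]

end ListProd

/-! ### Weights of the typed offspring -/

section Types

instance : Fintype VType := ⟨{VType.s, VType.e}, fun t => by cases t <;> decide⟩

theorem tsum_vtype (F : VType → ℝ≥0∞) : ∑' t, F t = F VType.s + F VType.e := by
  rw [tsum_fintype, show (Finset.univ : Finset VType) = {VType.s, VType.e} from rfl,
    Finset.sum_pair (by decide)]

theorem tsum_choose_succ (k : ℕ) (F : ℕ → ℝ≥0∞) :
    ∑' l, ((k + 1).choose l : ℝ≥0∞) * F l
      = ∑' l, (k.choose l : ℝ≥0∞) * F (l + 1) + ∑' l, (k.choose l : ℝ≥0∞) * F l := by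
  rw [tsum_eq_zero_add' ENNReal.summable, tsum_eq_zero_add' (f := fun l => (k.choose l : ℝ≥0∞) * F l)
    ENNReal.summable]
  simp only [Nat.choose_succ_succ', Nat.cast_add, add_mul, Nat.choose_zero_right]
  rw [ENNReal.tsum_add]
  ring

theorem tsum_length_count (k : ℕ) (F : ℕ → ℝ≥0∞) :
    ∑' ts : List VType, (if ts.length = k then F (ts.count VType.s) else 0)
      = ∑' l, (k.choose l : ℝ≥0∞) * F l := by
  induction k generalizing F with
  | zero =>
    rw [tsum_list, tsum_eq_single (f := fun l => (Nat.choose 0 l : ℝ≥0∞) * F l) 0]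
    · simp
    · intro l hl
      obtain ⟨l, rfl⟩ := Nat.exists_eq_succ_of_ne_zero hl
      simp
  | succ k ih =>
    rw [tsum_list, tsum_vtype, tsum_choose_succ, ← ih, ← ih]
    simp

theorem tsum_count (F : ℕ → ℕ → ℝ≥0∞) :
    ∑' ts : List VType, F ts.length (ts.count VType.s)
      = ∑' k, ∑' l, (k.choose l : ℝ≥0∞) * F k l := by
  simp_rw [← tsum_length_count]
  rw [ENNReal.tsum_comm]
  refine tsum_congr fun ts => ?_
  rw [tsum_eq_single ts.length]
  · simp
  · intro k hk; simp [hk.symm]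

variable {p : PMF ℕ}

/-- The weight of the vertices whose children have types `ts`: `𝔠` to the number of children of
type `e`, times `p`, for a vertex of type `s`. -/
def typeMass (p : PMF ℕ) : VType → List VType → ℝ≥0∞
  | VType.s, ts => if 1 ≤ ts.count VType.s then
      extProb p ^ (ts.length - ts.count VType.s) * p ts.length else 0
  | VType.e, ts => extinctMass p ts

/-- There are `k.choose l` words of length `k` with `l` letters s; summing their common weight over
`k` gives the Taylor coefficient at 𝔠. -/
theorem tsum_typeMass_survivor (h1 : extProb p < 1) (Ψ : ℕ → ℝ≥0∞) :
    ∑' ts, typeMass p VType.s ts * Ψ (ts.count VType.s) = ∑' l, survCoeff p l * Ψ l := by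
  have := tsum_count fun k l => (if 1 ≤ l then extProb p ^ (k - l) * p k else 0) * Ψ l
  simp only [typeMass]
  rw [this, ENNReal.tsum_comm]
  refine tsum_congr fun l => ?_
  rw [survCoeff]
  split_ifs with h
  · rw [taylorCoeff_eq p h1, shiftCoeff, ← ENNReal.tsum_mul_right]
    exact tsum_congr fun k => by ring
  · simp

theorem taylorCoeff_mul_survivorMass (h1 : extProb p < 1) (ts : List VType)
    (h : 1 ≤ ts.count VType.s) :
    taylorCoeff p (ts.count VType.s) * survivorMass p ts = typeMass p VType.s ts := by
  have hle : ts.count VType.s ≤ ts.length := List.count_le_length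
  have hch : (ts.length.choose (ts.count VType.s) : ℝ≥0∞) ≠ 0 := by
    exact_mod_cast (Nat.choose_pos hle).ne'
  rw [survivorMass, biasedMass, if_pos hle, typeMass, if_pos h]
  set T := taylorCoeff p (ts.count VType.s) with hT
  have hTt : T ≠ ⊤ := ENNReal.ofReal_ne_top
  set C := (ts.length.choose (ts.count VType.s) : ℝ≥0∞) with hC
  have hCt : C ≠ ⊤ := ENNReal.natCast_ne_top _
  -- If the Taylor coefficient vanishes, the division in `biasedMass` is meaningless, but each
  -- nonnegative term of its series vanishes too, so both sides are 0.
  by_cases h0 : T = 0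
  · rw [h0, zero_mul]
    rw [hT, taylorCoeff_eq p h1, shiftCoeff, ENNReal.tsum_eq_zero] at h0
    have := h0 ts.length
    rw [← hC, mul_assoc] at this
    exact ((mul_eq_zero.1 this).resolve_left hch).symm
  · simp only [div_eq_mul_inv]
    calc _ = (T * T⁻¹) * (C * C⁻¹) * (extProb p ^ (ts.length - ts.count VType.s) * p ts.length) := by
          ring
      _ = _ := by
        rw [ENNReal.mul_inv_cancel h0 hTt, ENNReal.mul_inv_cancel hch hCt, one_mul, one_mul]

theorem count_eq_zero_of_extinctMass {ts : List VType} (h : extinctMass p ts ≠ 0) :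
    ts.count VType.s = 0 := by
  rw [extinctMass] at h
  exact List.count_eq_zero.2 fun hs => h (if_pos hs)

theorem tsum_extMass (p : PMF ℕ) : ∑' k, extMass p k = 1 := by
  by_cases h0 : extProb p = 0
  · simp only [extMass, if_pos h0]
    rw [tsum_ite_eq]
  · simp only [extMass, if_neg h0]
    have : ∀ k, extProb p ^ k / extProb p * p k = (p k * extProb p ^ k) * (extProb p)⁻¹ := by
      intro k; rw [div_eq_mul_inv]; ring
    simp_rw [this]
    rw [ENNReal.tsum_mul_right]
    change egf p (extProb p) * _ = 1
    rw [egf_extProb, ENNReal.mul_inv_cancel h0 ((extProb_le_one p).trans_lt ENNReal.one_lt_top).ne]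

theorem tsum_extinctMass (p : PMF ℕ) : ∑' ts, extinctMass p ts = 1 := by
  have h := tsum_count fun k l => if l = 0 then extMass p k else 0
  have h2 : ∀ ts, extinctMass p ts = if ts.count VType.s = 0 then extMass p ts.length else 0 := by
    intro ts
    rw [extinctMass]
    by_cases hs : VType.s ∈ ts
    · rw [if_pos hs, if_neg fun h => List.count_eq_zero.1 h hs]
    · rw [if_neg hs, if_pos (List.count_eq_zero.2 hs)]
  simp_rw [h2]
  rw [h, ← tsum_extMass p]
  refine tsum_congr fun k => ?_
  rw [tsum_eq_single 0]
  · simp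
  · intro l hl; simp [hl]

/-- The number of vertices of type `s`. -/
def survivors (g : List (List ℕ × VType)) : ℕ := (g.map Prod.snd).count VType.s

theorem survivors_cons (v : List ℕ × VType) (g : List (List ℕ × VType)) :
    survivors (v :: g) = survivors g + if v.2 = VType.s then 1 else 0 := by
  simp [survivors, List.count_cons]

theorem survivors_nextList_cons (v : List ℕ × VType) (g : List (List ℕ × VType)) (ts : List VType)
    (d : List (List VType)) :
    survivors (nextList (v :: g) (ts :: d)) = ts.count VType.s + survivors (nextList g d) := by
  rw [survivors, nextList_cons, List.map_append, List.count_append, map_snd_childrenOf]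
  rfl

/-- The weight of the lists of the types of the children of the vertices of `g`. -/
def pathMass (p : PMF ℕ) : List (List ℕ × VType) → List (List VType) → ℝ≥0∞ :=
  listProd fun v ts => typeMass p v.2 ts

/-- Each vertex of type s contributes one application of the operator in `shiftSum`; one of type e
has total weight 1 and no child of type s. The offset `n` counts the children of type s already
placed. -/
theorem tsum_pathMass (h1 : extProb p < 1) (g : List (List ℕ × VType)) (F : ℕ → ℝ≥0∞) (n : ℕ) :
    ∑' d, pathMass p g d * F (n + survivors (nextList g d))
      = shiftSum (survCoeff p) (survivors g) F n := by
  induction g generalizing n with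
  | nil =>
    rw [pathMass, tsum_listProd_nil]
    rfl
  | cons v g ih =>
    rw [pathMass, tsum_listProd_cons, survivors_cons]
    simp_rw [survivors_nextList_cons, ← add_assoc]
    have : ∀ k, ∑' d, listProd (fun v ts => typeMass p v.2 ts) g d *
        F (n + k + survivors (nextList g d)) = shiftSum (survCoeff p) (survivors g) F (n + k) :=
      fun k => ih _
    simp_rw [this]
    rcases v with ⟨u, t⟩
    cases t with
    | s =>
      rw [if_pos rfl, shiftSum,
        ← tsum_typeMass_survivor h1 fun l => shiftSum (survCoeff p) (survivors g) F (n + l)]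
    | e =>
      rw [if_neg (by simp), add_zero, ← one_mul (shiftSum _ _ _ _), ← tsum_extinctMass p,
        ← ENNReal.tsum_mul_right]
      refine tsum_congr fun ts => ?_
      by_cases h : extinctMass p ts = 0
      · simp [typeMass, h]
      · simp [typeMass, count_eq_zero_of_extinctMass h]

theorem survivors_le_of_pathMass (g : List (List ℕ × VType)) (d : List (List VType))
    (h : pathMass p g d ≠ 0) : survivors g ≤ survivors (nextList g d) := by
  induction g generalizing d with
  | nil => simp [survivors]
  | cons v g ih =>
    cases d with
    | nil => exact absurd rfl h
    | cons ts d =>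
      rw [pathMass, listProd] at h
      have h2 := ih d (right_ne_zero_of_mul h)
      rw [survivors_nextList_cons, survivors_cons]
      have h3 := left_ne_zero_of_mul h
      rcases v with ⟨u, t⟩
      cases t with
      | s =>
        have : 1 ≤ ts.count VType.s := by
          by_contra hh
          exact h3 (by simp only [typeMass]; rw [if_neg hh])
        simp; omega
      | e => simp; omega

theorem survivorCounts_cons (v : List ℕ × VType) (g : List (List ℕ × VType)) (ts : List VType)
    (d : List (List VType)) :
    survivorCounts (v :: g : List (List ℕ × VType)) (ts :: d)
      = if v.2 = VType.s then ts.count VType.s :: survivorCounts g d else survivorCounts g d := by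
  unfold survivorCounts
  rw [List.zip_cons_cons, List.filter_cons]
  simp only [decide_eq_true_eq]
  split_ifs <;> rfl

/-- The Taylor coefficients in ρ cancel the normalisations of `survivorMass` vertex by vertex. What
is left is a product of weights that involves neither θ nor `lam`. -/
theorem pathMass_eq (h1 : extProb p < 1) (g : List (List ℕ × VType)) (d : List (List VType)) :
    (if d.length = g.length then
      (if ∀ l ∈ survivorCounts g d, 1 ≤ l then ((survivorCounts g d).map (taylorCoeff p)).prod else 0)
        * ((List.zip g d).map fun x =>
            match x.1.2 with
            | VType.s => survivorMass p x.2
            | VType.e => extinctMass p x.2).prod else 0) = pathMass p g d := by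
  induction g generalizing d with
  | nil => cases d <;> simp [pathMass, listProd, survivorCounts]
  | cons v g ih =>
    cases d with
    | nil => simp [pathMass, listProd]
    | cons ts d =>
      rw [pathMass, listProd]
      change _ = _ * pathMass p g d
      rw [← ih d, survivorCounts_cons, List.zip_cons_cons]
      rcases v with ⟨u, t⟩
      by_cases hl : d.length = g.length
      · cases t with
        | s =>
          by_cases h : 1 ≤ ts.count VType.s
          · rw [← taylorCoeff_mul_survivorMass h1 ts h]
            simp only [List.length_cons, hl, if_true, List.mem_cons, forall_eq_or_imp, h, true_and,
              List.map_cons, List.prod_cons]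
            split_ifs
            · ring
            · simp
          · simp [h, typeMass]
        | e =>
          simp only [List.length_cons, hl, if_true, typeMass, List.map_cons, List.prod_cons,
            reduceCtorEq, if_false]
          ring
      · simp [hl]

theorem length_survivorCounts (g : List (List ℕ × VType)) (d : List (List VType))
    (h : pathMass p g d ≠ 0) : (survivorCounts g d).length = survivors g ∧
      (survivorCounts g d).sum = survivors (nextList g d) := by
  induction g generalizing d with
  | nil => simp [survivorCounts, survivors, nextList_nil]
  | cons v g ih =>
    cases d with
    | nil => exact absurd rfl h
    | cons ts d =>
      rw [pathMass, listProd] at h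
      have h2 := ih d (right_ne_zero_of_mul h)
      have h3 := left_ne_zero_of_mul h
      rw [survivors_nextList_cons, survivors_cons, survivorCounts_cons]
      rcases v with ⟨u, t⟩
      cases t with
      | s => simp [h2]
      | e => simp [h2, count_eq_zero_of_extinctMass h3]

end Types

/-! ### Transition probabilities of the two-type trees -/

section Transitions

variable {p : PMF ℕ} {c : ℕ → ℝ} {lam : ℝ}

theorem massLaw_apply {α : Type} [Inhabited α] {m : α → ℝ≥0∞} (h : ∑' a, m a = 1) (a : α) :
    massLaw m a = m a := by
  have h2 : HasSum m 1 := h ▸ ENNReal.summable.hasSum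
  have h3 : massLaw m = ⟨m, h2⟩ := dif_pos h2
  rw [h3]
  rfl

instance : DecidableEq (Gen VType) := inferInstanceAs (DecidableEq (List (List ℕ × VType)))

/-- The weight of a transition between two generations. -/
def stepMass (p : PMF ℕ) (g g' : Gen VType) : ℝ≥0∞ :=
  ∑' d, if nextGen g d = g' then pathMass p g.toList d else 0

theorem map_nextGen_apply (π : PMF (List (List VType))) (g g' : Gen VType) :
    π.map (nextGen g) g' = ∑' d, if nextGen g d = g' then π d else 0 := by
  rw [PMF.map_apply]
  refine tsum_congr fun d => ?_
  by_cases hd : nextGen g d = g'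
  · rw [if_pos hd.symm, if_pos hd]
  · rw [if_neg (Ne.symm hd), if_neg hd]

/-- The Doob transform passes from offspring lists to generations because the factor `b` depends on
the list only through the next generation. -/
theorem mul_map_nextGen {π : PMF (List (List VType))} {g : Gen VType} {a : ℝ≥0∞} {b : ℕ → ℝ≥0∞}
    (h : ∀ d, a * π d = b (survivors (nextGen g d).toList) * pathMass p g.toList d)
    (g' : Gen VType) :
    a * π.map (nextGen g) g' = b (survivors g'.toList) * stepMass p g g' := by
  rw [map_nextGen_apply, stepMass, ← ENNReal.tsum_mul_left, ← ENNReal.tsum_mul_left]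
  refine tsum_congr fun d => ?_
  split_ifs with hd
  · rw [h, hd]
  · simp

theorem survivors_le_of_stepMass {g g' : Gen VType} (h : stepMass p g g' ≠ 0) :
    survivors g.toList ≤ survivors g'.toList := by
  rw [stepMass, Ne, ENNReal.tsum_eq_zero] at h
  push Not at h
  obtain ⟨d, hd⟩ := h
  split_ifs at hd with hg
  · rw [← hg]
    exact survivors_le_of_pathMass _ _ hd
  · exact absurd rfl hd

theorem extremalStep_mass (h1 : extProb p < 1) (hm0 : mean p ≠ 0) (hmt : mean p ≠ ⊤) (θ : ℝ) (h : ℕ)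
    (g : List (List ℕ × VType)) (d : List (List VType)) :
    (if d.length = g.length then
      rho p c ((mean p).toReal ^ h * θ) (survivorCounts g d)
        * ((List.zip g d).map fun x =>
            match x.1.2 with
            | VType.s => survivorMass p x.2
            | VType.e => extinctMass p x.2).prod
    else 0)
      = scaledDensity p c (h + 1) (survivors (nextList g d)) θ
        / scaledDensity p c h (survivors g) θ * pathMass p g d := by
  have hm0' : mean p ^ h ≠ 0 := pow_ne_zero _ hm0
  have hmt' : mean p ^ h ≠ ⊤ := ENNReal.pow_ne_top hmt
  have h2 : ∀ κ : List ℕ, rho p c ((mean p).toReal ^ h * θ) κ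
      = scaledDensity p c (h + 1) κ.sum θ / scaledDensity p c h κ.length θ
        * if ∀ l ∈ κ, 1 ≤ l then (κ.map (taylorCoeff p)).prod else 0 := by
    intro κ
    rw [rho]
    split_ifs
    · congr 1
      rw [scaledDensity, scaledDensity, pow_succ, mul_assoc, ENNReal.mul_div_mul_left _ _ hm0' hmt',
        mul_div_assoc, pow_succ']
      simp only [mul_assoc]
    · simp
  have h3 := pathMass_eq h1 g d
  have h4 : pathMass p g d ≠ 0 → _ := length_survivorCounts g d
  trans scaledDensity p c (h + 1) (survivorCounts g d).sum θ
      / scaledDensity p c h (survivorCounts g d).length θ * pathMass p g d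
  · rw [← h3]
    by_cases hl : d.length = g.length
    · rw [if_pos hl, if_pos hl, h2, mul_assoc]
    · rw [if_neg hl, if_neg hl, mul_zero]
  · by_cases h0 : pathMass p g d = 0
    · rw [h0, mul_zero, mul_zero]
    · rw [(h4 h0).1, (h4 h0).2]

/-- The extremal chain is the Doob transform of `stepMass` by `scaledDensity`, whose harmonicity is
`ae_scaledDensity`. The product form avoids dividing by a density. -/
theorem IsSenetaHeyde.ae_extremalStep (hc : IsSenetaHeyde p c)
    (hnd : p.support.Nontrivial) (hsup : 1 < mean p) (hfin : mean p < ⊤) :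
    ∀ᵐ θ : ℝ, ∀ h g g', scaledDensity p c h (survivors (Gen.toList g)) θ
        * stepLaw (extremalStep p c θ) h g g'
      = scaledDensity p c (h + 1) (survivors (Gen.toList g')) θ * stepMass p g g' := by
  have h1 := hc.extProb_lt_one
  have hm0 : mean p ≠ 0 := (one_pos.trans hsup).ne'
  filter_upwards [hc.ae_scaledDensity hnd hsup hfin] with θ hθ h g g'
  refine mul_map_nextGen (b := fun k => scaledDensity p c (h + 1) k θ) (fun d => ?_) g'
  obtain ⟨ht, hs⟩ := hθ h (survivors g.toList)
  have h2 := tsum_pathMass h1 g.toList (fun k => scaledDensity p c (h + 1) k θ) 0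
  rw [← hs] at h2
  simp only [zero_add] at h2
  -- Here `massLaw` may fall back on its default value, but harmonicity makes every term on the
  -- right vanish as well.
  by_cases h0 : scaledDensity p c h (survivors g.toList) θ = 0
  · rw [h0, ENNReal.tsum_eq_zero] at h2
    rw [h0, zero_mul, mul_comm]
    exact (h2 d).symm
  · have hmass : extremalStep p c θ h g = massLaw fun d => scaledDensity p c (h + 1)
        (survivors (nextGen g d).toList) θ / scaledDensity p c h (survivors g.toList) θ
          * pathMass p g.toList d :=
      congrArg massLaw (funext fun d => extremalStep_mass h1 hm0 hfin.ne θ h g.toList d)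
    rw [hmass, massLaw_apply]
    · rw [← mul_assoc, ENNReal.mul_div_cancel h0 ht]
    · simp_rw [div_eq_mul_inv, mul_right_comm _ _⁻¹ (pathMass _ _ _), ENNReal.tsum_mul_right]
      simp_rw [mul_comm _ (pathMass _ _ _)]
      have h3 : ∑' d, pathMass p g.toList d * scaledDensity p c (h + 1) (survivors (nextGen g d).toList) θ
        = scaledDensity p c h (survivors g.toList) θ := h2
      rw [h3, ENNReal.mul_inv_cancel h0 ht]

/-- The product of the weights of the transitions of a path. -/
def weight (p : PMF ℕ) (x : ℕ → Gen VType) (n : ℕ) : ℝ≥0∞ :=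
  ∏ i ∈ Finset.range n, stepMass p (x i) (x (i + 1))

/-- The line of descent of type s never dies, which excludes the conventional value of `convPow` at
0 from the integrals over θ. -/
theorem survivors_ne_zero_of_weight {x : ℕ → Gen VType} (h0 : x 0 = rootGen VType.s) (n : ℕ)
    (h : survivors (x n).toList = 0) : weight p x n = 0 := by
  by_contra hw
  rw [weight, ← Ne, Finset.prod_ne_zero_iff] at hw
  have : ∀ k ≤ n, 1 ≤ survivors (x k).toList := by
    intro k hk
    induction k with
    | zero => rw [h0, toList_rootGen, survivors]; simp
    | succ k ih =>
      exact (ih (by omega)).trans (survivors_le_of_stepMass (hw k (Finset.mem_range.2 hk)))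
  have := this n le_rfl
  omega

/-- Telescoping of the Doob transform; the initial factor is `scaledDensity p c 0 1 θ = w p c θ`. -/
theorem IsSenetaHeyde.ae_extremal_pathSet (hc : IsSenetaHeyde p c)
    (hnd : p.support.Nontrivial) (hsup : 1 < mean p) (hfin : mean p < ⊤) :
    ∀ᵐ θ : ℝ, ∀ (x : ℕ → Gen VType), x 0 = rootGen VType.s → ∀ n,
      w p c θ * chainLaw (PMF.pure VType.s) (extremalStep p c θ) (pathSet n x)
        = scaledDensity p c n (survivors (x n).toList) θ * weight p x n := by
  filter_upwards [hc.ae_extremalStep hnd hsup hfin] with θ hθ x h0 n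
  induction n with
  | zero =>
    rw [chainLaw_pathSet_zero, PMF.pure_map, h0, PMF.pure_apply, if_pos rfl, weight,
      Finset.prod_range_zero, scaledDensity, toList_rootGen]
    simp [survivors, convPow]
  | succ n ih =>
    rw [chainLaw_pathSet_succ, ← mul_assoc, ih, mul_right_comm, hθ, weight, weight,
      Finset.prod_range_succ]
    ring

theorem IsSenetaHeyde.mul_typedOffspring (hc : IsSenetaHeyde p c)
    (hsup : 1 < mean p) (hfin : mean p < ⊤) (hlam : zeta p c lam 0 < ⊤) (h : ℕ) (ts : List VType) :
    survZeta p c lam h * typedOffspring p c lam h VType.s ts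
      = survZeta p c lam (h + 1) ^ ts.count VType.s * typeMass p VType.s ts := by
  have h1 := hc.extProb_lt_one
  have hz0 := hc.survZeta_ne_zero hsup hfin lam h
  have hzt := hc.survZeta_ne_top hsup hfin hlam h
  have hm : ∀ ts, survivorOffspring p c lam h (ts.count VType.s) * survivorMass p ts
      = (survZeta p c lam h)⁻¹ *
        (typeMass p VType.s ts * survZeta p c lam (h + 1) ^ ts.count VType.s) := by
    intro ts
    rw [survivorOffspring]
    split_ifs with hl
    · rw [hc.zeta_sub hsup hfin, hc.zeta_sub hsup hfin, ← taylorCoeff_mul_survivorMass h1 ts hl]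
      rw [div_eq_mul_inv]
      ring
    · rw [typeMass, if_neg hl]; simp
  rw [typedOffspring, massLaw_apply, hm, ← mul_assoc, ENNReal.mul_inv_cancel hz0 hzt, one_mul,
    mul_comm]
  simp_rw [hm]
  rw [ENNReal.tsum_mul_left, tsum_typeMass_survivor h1 fun l => survZeta p c lam (h + 1) ^ l]
  change _ * sgf p _ = 1
  rw [← hc.survZeta_eq_sgf hsup hfin, ENNReal.inv_mul_cancel hz0 hzt]

theorem typedOffspring_extinct (h : ℕ) (ts : List VType) :
    typedOffspring p c lam h VType.e ts = typeMass p VType.e ts := by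
  rw [typedOffspring, massLaw_apply (tsum_extinctMass p)]
  rfl

/-- The offspring laws of the two-type inhomogeneous tree. -/
def tiltedStep (p : PMF ℕ) (c : ℕ → ℝ) (lam : ℝ) (h : ℕ) (g : Gen VType) : PMF (List (List VType)) :=
  independent (fun v : List ℕ × VType => typedOffspring p c lam h v.2) g

/-- The counterpart of `ae_extremalStep`: the same `stepMass`, now transformed by `survZeta` to the
number of survivors, which factorises over the vertices. -/
theorem IsSenetaHeyde.mul_tiltedStep (hc : IsSenetaHeyde p c)
    (hsup : 1 < mean p) (hfin : mean p < ⊤) (hlam : zeta p c lam 0 < ⊤) (h : ℕ) (g g' : Gen VType) :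
    survZeta p c lam h ^ survivors g.toList * stepLaw (tiltedStep p c lam) h g g'
      = survZeta p c lam (h + 1) ^ survivors g'.toList * stepMass p g g' := by
  refine mul_map_nextGen (b := fun k => survZeta p c lam (h + 1) ^ k) (fun d => ?_) g'
  rw [toList_nextGen]
  change survZeta p c lam h ^ survivors g.toList * independent _ g.toList d = _
  rw [independent_apply]
  generalize g.toList = g
  induction g generalizing d with
  | nil => cases d <;> simp [listProd, pathMass, survivors, nextList_nil]
  | cons v g ih =>
    cases d with
    | nil => simp [listProd, pathMass]
    | cons ts d =>
      have ih := ih d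
      rw [pathMass] at ih ⊢
      rw [listProd, listProd, survivors_nextList_cons, survivors_cons, pow_add, pow_add]
      rcases v with ⟨u, t⟩
      cases t with
      | s =>
        have h3 := hc.mul_typedOffspring hsup hfin hlam h ts
        rw [if_pos rfl, pow_one]
        calc _ = (survZeta p c lam h * typedOffspring p c lam h VType.s ts) *
            (survZeta p c lam h ^ survivors g * listProd
              (fun (v : List ℕ × VType) ts => typedOffspring p c lam h v.2 ts) g d) := by ring
          _ = _ := by rw [h3, ih]; ring
      | e =>
        rw [if_neg (by simp), pow_zero, mul_one]
        simp only [typedOffspring_extinct]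
        rw [mul_left_comm, ih]
        by_cases hx : extinctMass p ts = 0
        · simp [typeMass, hx]
        · rw [count_eq_zero_of_extinctMass hx]; ring

theorem IsSenetaHeyde.zeta_ne_zero (hc : IsSenetaHeyde p c)
    (hsup : 1 < mean p) (hfin : mean p < ⊤) (lam : ℝ) (h : ℕ) : zeta p c lam h ≠ 0 := by
  rw [hc.zeta_eq hsup hfin]
  exact fun h0 => hc.survZeta_ne_zero hsup hfin lam h (add_eq_zero.1 h0).2

theorem IsSenetaHeyde.zeta_ne_top (hc : IsSenetaHeyde p c)
    (hsup : 1 < mean p) (hfin : mean p < ⊤) (hlam : zeta p c lam 0 < ⊤) (h : ℕ) :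
    zeta p c lam h ≠ ⊤ := by
  rw [hc.zeta_eq hsup hfin]
  exact ENNReal.add_ne_top.2 ⟨hc.extProb_lt_one.ne_top, hc.survZeta_ne_top hsup hfin hlam h⟩

/-- The law of the type of a vertex of generation `h`. -/
def typeLaw (p : PMF ℕ) (c : ℕ → ℝ) (lam : ℝ) (h : ℕ) : PMF VType :=
  massLaw fun
    | VType.s => (zeta p c lam h - extProb p) / zeta p c lam h
    | VType.e => extProb p / zeta p c lam h

theorem IsSenetaHeyde.typeLaw_apply (hc : IsSenetaHeyde p c)
    (hsup : 1 < mean p) (hfin : mean p < ⊤) (hlam : zeta p c lam 0 < ⊤) (h : ℕ) :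
    typeLaw p c lam h VType.s = survZeta p c lam h / zeta p c lam h ∧
      typeLaw p c lam h VType.e = extProb p / zeta p c lam h := by
  have h2 : ∑' t : VType, (match t with
    | VType.s => (zeta p c lam h - extProb p) / zeta p c lam h
    | VType.e => extProb p / zeta p c lam h) = 1 := by
    rw [tsum_vtype]
    simp only
    rw [hc.zeta_sub hsup hfin, ← ENNReal.add_div, add_comm, ← hc.zeta_eq hsup hfin,
      ENNReal.div_self (hc.zeta_ne_zero hsup hfin lam h) (hc.zeta_ne_top hsup hfin hlam h)]
  constructor
  · rw [typeLaw, massLaw_apply h2, hc.zeta_sub hsup hfin]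
  · rw [typeLaw, massLaw_apply h2]

theorem rootLaw_eq (p : PMF ℕ) (c : ℕ → ℝ) (lam : ℝ) : rootLaw p c lam = typeLaw p c lam 0 := rfl

theorem map_rootGen_apply (π : PMF VType) (t : VType) : π.map rootGen (rootGen t) = π t := by
  rw [PMF.map_apply, tsum_eq_single t]
  · simp
  · intro t' ht
    refine if_neg fun h => ht ?_
    have : ([([], t)] : List (List ℕ × VType)) = [([], t')] := h
    simpa using this.symm

theorem IsSenetaHeyde.tilted_pathSet (hc : IsSenetaHeyde p c)
    (hsup : 1 < mean p) (hfin : mean p < ⊤) (hlam : zeta p c lam 0 < ⊤)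
    (x : ℕ → Gen VType) (h0 : x 0 = rootGen VType.s) (n : ℕ) :
    chainLaw (rootLaw p c lam) (tiltedStep p c lam) (pathSet n x)
      = survZeta p c lam n ^ survivors (x n).toList * weight p x n / zeta p c lam 0 := by
  induction n with
  | zero =>
    rw [chainLaw_pathSet_zero, h0, map_rootGen_apply, rootLaw_eq,
      (hc.typeLaw_apply hsup hfin hlam 0).1, toList_rootGen]
    simp [survivors, weight]
  | succ n ih =>
    rw [chainLaw_pathSet_succ, ih]
    have := hc.mul_tiltedStep hsup hfin hlam n (x n) (x (n + 1))
    simp only [weight, Finset.prod_range_succ, div_eq_mul_inv]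
    calc _ = (survZeta p c lam n ^ survivors (x n).toList * stepLaw (tiltedStep p c lam) n (x n) (x (n + 1)))
          * (∏ i ∈ Finset.range n, stepMass p (x i) (x (i + 1))) * (zeta p c lam 0)⁻¹ := by ring
      _ = _ := by rw [this]; ring

/-- The choice between the mass function and the default law is made on the measurable event that
the total mass is 1. -/
theorem measurable_massLaw {α Θ : Type} [Inhabited α] [Countable α] [MeasurableSpace Θ]
    {m : Θ → α → ℝ≥0∞} (hm : ∀ a, Measurable fun θ => m θ a) (a : α) :
    Measurable fun θ => massLaw (m θ) a := by
  have h : ∀ θ, massLaw (m θ) a = if ∑' b, m θ b = 1 then m θ a else PMF.pure default a := by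
    intro θ
    split_ifs with hs
    · exact massLaw_apply hs a
    · have h2 : massLaw (m θ) = PMF.pure default := dif_neg fun h => hs (HasSum.tsum_eq h)
      rw [h2]
  simp_rw [h]
  exact Measurable.ite (Measurable.tsum hm (measurableSet_singleton _)) (hm a) measurable_const

theorem measurable_rho (p : PMF ℕ) (c : ℕ → ℝ) (κ : List ℕ) : Measurable fun θ => rho p c θ κ := by
  have hg := measurable_convPow (measurable_w p c)
  have hk : Measurable fun θ => convPow (w p c) κ.sum ((mean p).toReal * θ) :=
    (hg _).comp (by fun_prop)
  have := hg κ.length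
  unfold rho
  split_ifs
  · fun_prop
  · exact measurable_const

theorem measurable_extremalStep (p : PMF ℕ) (c : ℕ → ℝ) (h : ℕ) (g : Gen VType)
    (d : List (List VType)) : Measurable fun θ => extremalStep p c θ h g d := by
  refine measurable_massLaw (fun d => ?_) d
  split_ifs
  · exact ((measurable_rho p c _).comp (by fun_prop)).mul_const _
  · exact measurable_const

theorem measurable_chainLaw_extremal (p : PMF ℕ) (c : ℕ → ℝ) :
    Measurable fun θ => chainLaw (PMF.pure VType.s) (extremalStep p c θ) := by
  refine measurable_of_pathSet _ fun n x => ?_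
  induction n with
  | zero => simp_rw [chainLaw_pathSet_zero]; exact measurable_const
  | succ n ih =>
    simp_rw [chainLaw_pathSet_succ]
    refine ih.mul ?_
    simp_rw [stepLaw, map_nextGen_apply]
    refine Measurable.tsum fun d => ?_
    split_ifs
    · exact measurable_extremalStep p c n _ d
    · exact measurable_const

end Transitions

/-! ### The mixture of the two-type extremal trees -/

section Mixture

variable {p : PMF ℕ} {c : ℕ → ℝ} {lam : ℝ}

theorem tiltedTypedLaw_eq (p : PMF ℕ) (c : ℕ → ℝ) (lam : ℝ) :
    tiltedTypedLaw p c lam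
      = (chainLaw (rootLaw p c lam) (tiltedStep p c lam)).map treeOfGens := rfl

theorem measurableSet_root (t : VType) : MeasurableSet {x : ℕ → Gen VType | x 0 = rootGen t} :=
  measurable_pi_apply (X := fun _ : ℕ => Gen VType) 0 (t := {rootGen t}) trivial

theorem root_mem_treeOfGens {x : ℕ → Gen VType} (hx : ∀ n, IsLevel n (x n)) (t : VType) :
    ([], t) ∈ treeOfGens x ↔ List.Mem ([], t) (x 0) := by
  constructor
  · rintro ⟨n, hn⟩
    have h1 : [] ∈ (x n).toList.map Prod.fst := List.mem_map.2 ⟨_, hn, rfl⟩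
    have := (hx n).1 _ h1
    rw [List.length_nil] at this
    rwa [this]
  · exact fun h => ⟨0, h⟩

theorem mem_rootGen_iff (t t' : VType) :
    List.Mem ([], t) (rootGen t') ↔ (rootGen t' : Gen VType) = rootGen t := by
  constructor
  · intro h
    have h2 : (([], t) : List ℕ × VType) ∈ [([], t')] := h
    have : t = t' := by simpa using h2
    rw [this]
  · intro h
    rw [h]
    exact List.mem_singleton_self (([], t) : List ℕ × VType)

theorem ae_root_mem_iff (root : PMF VType) (step : ℕ → Gen VType → PMF (List (List VType))) :
    ∀ᵐ x ∂chainLaw root step, ([], VType.s) ∈ treeOfGens x ↔ x 0 = rootGen VType.s := by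
  filter_upwards [ae_isLevel root step, ae_step_mem_support root step] with x hx hx2
  have := hx2.1
  rw [PMF.support_map] at this
  obtain ⟨t, -, ht⟩ := this
  rw [root_mem_treeOfGens hx.1, ← ht]
  exact mem_rootGen_iff _ _

theorem IsSenetaHeyde.chainLaw_tilted_root (hc : IsSenetaHeyde p c)
    (hsup : 1 < mean p) (hfin : mean p < ⊤) (hlam : zeta p c lam 0 < ⊤) :
    chainLaw (rootLaw p c lam) (tiltedStep p c lam) {x | x 0 = rootGen VType.s}
      = survZeta p c lam 0 / zeta p c lam 0 := by
  rw [chainLaw_zero, map_rootGen_apply, rootLaw_eq, (hc.typeLaw_apply hsup hfin hlam 0).1]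

/-- On paths starting from a root of type s both sides equal `survZeta p c lam n ^ r * weight p x n
/ survZeta p c lam 0`, with `r` the number of survivors in generation `n`; the factor `zeta p c lam
0` of the root law cancels in the conditioning. Other paths have mass 0. -/
theorem IsSenetaHeyde.bind_chainLaw (hc : IsSenetaHeyde p c) (hnd : p.support.Nontrivial)
    (hsup : 1 < mean p) (hfin : mean p < ⊤) (hlam : zeta p c lam 0 < ⊤) :
    (thetaLaw p c lam).bind (fun θ => chainLaw (PMF.pure VType.s) (extremalStep p c θ))
      = cond (chainLaw (rootLaw p c lam) (tiltedStep p c lam)) {x | x 0 = rootGen VType.s} := by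
  symm
  refine measure_ext_of_pathSet fun n x => ?_
  have hz0 := hc.zeta_ne_zero hsup hfin lam 0
  have hzt := hc.zeta_ne_top hsup hfin hlam 0
  have hs0 := hc.survZeta_ne_zero hsup hfin lam 0
  have hst := hc.survZeta_ne_top hsup hfin hlam 0
  rw [Measure.bind_apply (measurableSet_pathSet n x)
    (measurable_chainLaw_extremal p c).aemeasurable, cond_apply (measurableSet_root _),
    hc.chainLaw_tilted_root hsup hfin hlam]
  by_cases h0 : x 0 = rootGen VType.s
  · have h1 : {x : ℕ → Gen VType | x 0 = rootGen VType.s} ∩ pathSet n x = pathSet n x := by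
      refine Set.inter_eq_right.2 fun y hy => ?_
      exact (hy 0 (Nat.zero_le n)).trans h0
    have h2 := hc.lintegral_thetaLaw hnd hsup hfin lam n
      (survivors (x n).toList) (weight p x n) (survivors_ne_zero_of_weight h0 n)
      (f := fun θ => chainLaw (PMF.pure VType.s) (extremalStep p c θ) (pathSet n x))
      ((Measure.measurable_coe (measurableSet_pathSet n x)).comp
        (measurable_chainLaw_extremal p c))
      (by filter_upwards [hc.ae_extremal_pathSet hnd hsup hfin] with θ hθ using hθ x h0 n)
    rw [h1, hc.tilted_pathSet hsup hfin hlam x h0, h2]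
    rw [ENNReal.inv_div (Or.inl hzt) (Or.inl hz0), div_eq_mul_inv, div_eq_mul_inv, div_eq_mul_inv]
    set A := survZeta p c lam n ^ survivors (x n).toList * weight p x n
    calc _ = (zeta p c lam 0 * (zeta p c lam 0)⁻¹) * (A * (survZeta p c lam 0)⁻¹) := by ring
      _ = _ := by rw [ENNReal.mul_inv_cancel hz0 hzt, one_mul]
  · have h1 : {x : ℕ → Gen VType | x 0 = rootGen VType.s} ∩ pathSet n x = ∅ := by
      ext y
      simp only [Set.mem_inter_iff, Set.mem_ofPred_eq, Set.mem_empty_iff_false, iff_false, not_and]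
      intro hy hy2
      exact h0 ((hy2 0 (Nat.zero_le n)).symm.trans hy)
    rw [h1, measure_empty, mul_zero]
    refine (lintegral_eq_zero_of_ae_eq_zero (ae_of_all _ fun θ => ?_)).symm
    refine measure_mono_null (t := {y | y 0 = x 0}) (fun y hy => hy 0 (Nat.zero_le n)) ?_
    rw [chainLaw_zero, PMF.pure_map, PMF.pure_apply, if_neg h0]

theorem bind_map {α β γ : Type} [MeasurableSpace α] [MeasurableSpace β] [MeasurableSpace γ]
    {m : Measure α} {κ : α → Measure β} {f : β → γ} (hκ : Measurable κ) (hf : Measurable f) :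
    m.bind (fun a => (κ a).map f) = (m.bind κ).map f := by
  ext s hs
  have h : Measurable fun a => (κ a).map f := (Measure.measurable_map f hf).comp hκ
  rw [Measure.bind_apply hs h.aemeasurable,
    Measure.map_apply hf hs, Measure.bind_apply (hf hs) hκ.aemeasurable]
  exact lintegral_congr fun a => Measure.map_apply hf hs

theorem map_cond {α β : Type} [MeasurableSpace α] [MeasurableSpace β] {μ : Measure α} {f : α → β}
    (hf : Measurable f) {s : Set α} {t : Set β} (ht : MeasurableSet t)
    (h : ∀ᵐ x ∂μ, f x ∈ t ↔ x ∈ s) : (cond μ s).map f = cond (μ.map f) t := by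
  have h2 : s =ᵐ[μ] f ⁻¹' t := by
    filter_upwards [h] with x hx
    exact propext hx.symm
  rw [ProbabilityTheory.cond, ProbabilityTheory.cond, Measure.map_smul, measure_congr h2,
    Measure.restrict_congr_set h2, Measure.restrict_map hf ht, Measure.map_apply hf ht]

theorem IsSenetaHeyde.bind_extremalTypedLaw (hc : IsSenetaHeyde p c) (hnd : p.support.Nontrivial)
    (hsup : 1 < mean p) (hfin : mean p < ⊤) (hlam : zeta p c lam 0 < ⊤) :
    (thetaLaw p c lam).bind (extremalTypedLaw p c)
      = cond (tiltedTypedLaw p c lam) {T | ([], VType.s) ∈ T} := by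
  have h1 := bind_map (m := thetaLaw p c lam) (measurable_chainLaw_extremal p c)
    measurable_treeOfGens
  refine h1.trans ?_
  rw [hc.bind_chainLaw hnd hsup hfin hlam, tiltedTypedLaw_eq]
  have hm : MeasurableSet {T : Set (List ℕ × VType) | ([], VType.s) ∈ T} :=
    (measurable_set_mem ([], VType.s) (t := {True}) trivial).congr (by ext; simp)
  exact map_cond measurable_treeOfGens hm (ae_root_mem_iff _ _)

end Mixture

/-! ### Forgetting the types of the inhomogeneous tree -/

section Label

variable {α β : Type}

theorem independent_append (off : α → PMF β) (a b : List α) :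
    independent off (a ++ b)
      = (independent off a).bind fun x => (independent off b).map fun y => x ++ y := by
  induction a with
  | nil =>
    rw [independent, PMF.pure_bind]
    exact (PMF.map_id _).symm
  | cons v a ih =>
    rw [List.cons_append, independent, independent, ih, PMF.bind_bind]
    congr 1; ext1 u
    rw [PMF.bind_map, PMF.map_bind]
    congr 1; ext1 x
    rw [PMF.map_comp]
    rfl

/-- The law of the next generation, on lists. -/
def nextLaw {σ : Type} (off : List ℕ × σ → PMF (List σ)) (g : List (List ℕ × σ)) :
    PMF (List (List ℕ × σ)) :=
  (independent off g).map (nextList g)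

theorem nextLaw_nil {σ : Type} (off : List ℕ × σ → PMF (List σ)) :
    nextLaw off [] = PMF.pure [] := by
  rw [nextLaw, independent, PMF.pure_map, nextList_nil]

theorem nextLaw_cons {σ : Type} (off : List ℕ × σ → PMF (List σ)) (v : List ℕ × σ)
    (g : List (List ℕ × σ)) :
    nextLaw off (v :: g)
      = (off v).bind fun ts => (nextLaw off g).map fun x => childrenOf v.1 ts ++ x := by
  rw [nextLaw, independent, PMF.map_bind]
  congr 1; ext1 ts
  rw [nextLaw, PMF.map_comp, PMF.map_comp]
  congr 1

/-- The law of the typed generation obtained from `g` by choosing the types independently. -/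
def label (π : PMF VType) (g : List (List ℕ × Unit)) : PMF (List (List ℕ × VType)) :=
  independent (fun v => π.map fun t => (v.1, t)) g

theorem label_zipIdx (π : PMF VType) (v : List ℕ) (k n : ℕ) :
    label π (((List.replicate k ()).zipIdx n).map fun x => (v ++ [x.2], x.1))
      = (independent (fun _ : Unit => π) (List.replicate k ())).map
        fun ts => (ts.zipIdx n).map fun x => (v ++ [x.2], x.1) := by
  induction k generalizing n with
  | zero =>
    simp only [List.replicate_zero, List.zipIdx_nil, List.map_nil, label, independent,
      PMF.pure_map]
  | succ k ih =>
    rw [List.replicate_succ, List.zipIdx_cons, List.map_cons, label, independent, independent,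
      PMF.bind_map, PMF.map_bind]
    congr 1; ext1 t
    have := ih (n + 1)
    rw [label] at this
    rw [Function.comp_apply, this, PMF.map_comp, PMF.map_comp]
    rfl

theorem label_childrenOf (π : PMF VType) (v : List ℕ) (k : ℕ) :
    label π (childrenOf v (List.replicate k ()))
      = (independent (fun _ : Unit => π) (List.replicate k ())).map (childrenOf v) :=
  label_zipIdx π v k 0

/-- Typing a generation and then reproducing has the same law as reproducing without types and then
typing the children. By independence this reduces to the one-vertex identity `h`. -/
theorem label_intertwining {π π' : PMF VType} {κ : VType → PMF (List VType)} {q : PMF ℕ}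
    (h : π.bind κ = q.bind fun k => independent (fun _ : Unit => π') (List.replicate k ()))
    (g : List (List ℕ × Unit)) :
    (label π g).bind (nextLaw fun v => κ v.2)
      = (nextLaw (fun _ => q.map fun k => List.replicate k ()) g).bind (label π') := by
  induction g with
  | nil => rw [label, independent, PMF.pure_bind, nextLaw_nil, nextLaw_nil, PMF.pure_bind]; rfl
  | cons v g ih =>
    have hl : (label π (v :: g)).bind (nextLaw fun v => κ v.2) = (π.bind κ).bind fun ts =>
        ((label π g).bind (nextLaw fun v => κ v.2)).map fun x => childrenOf v.1 ts ++ x := by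
      rw [label, independent, PMF.bind_map, PMF.bind_bind, PMF.bind_bind]
      congr 1; ext1 t
      rw [Function.comp_apply, PMF.bind_map]
      have : ((nextLaw fun v => κ v.2) ∘ fun l => (v.1, t) :: l)
          = fun l => (κ t).bind fun ts => (nextLaw (fun v => κ v.2) l).map
            fun x => childrenOf v.1 ts ++ x := by
        ext1 l; exact nextLaw_cons _ _ _
      rw [this, PMF.bind_comm]
      congr 1; ext1 ts
      rw [PMF.map_bind]
      rfl
    have hr : (nextLaw (fun _ => q.map fun k => List.replicate k ()) (v :: g)).bind (label π')
        = (q.bind fun k => independent (fun _ : Unit => π') (List.replicate k ())).bind fun ts =>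
          ((nextLaw (fun _ => q.map fun k => List.replicate k ()) g).bind (label π')).map
            fun x => childrenOf v.1 ts ++ x := by
      rw [nextLaw_cons, PMF.bind_map, PMF.bind_bind, PMF.bind_bind]
      congr 1; ext1 k
      rw [Function.comp_apply, PMF.bind_map]
      have : (label π' ∘ fun x => childrenOf v.1 (List.replicate k ()) ++ x)
          = fun x => (independent (fun _ : Unit => π') (List.replicate k ())).bind fun ts =>
            (label π' x).map fun y => childrenOf v.1 ts ++ y := by
        ext1 x
        rw [Function.comp_apply, label, independent_append]
        change (label π' _).bind _ = _
        rw [label_childrenOf, PMF.bind_map]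
        rfl
      rw [this, PMF.bind_comm]
      congr 1; ext1 ts
      rw [PMF.map_bind]
    rw [hl, hr, ih, h]

/-- The generation obtained by forgetting the types. -/
def erase (g : Gen VType) : Gen Unit := g.toList.map fun v => (v.1, ())

theorem erase_eq_of_label {π : PMF VType} {g : List (List ℕ × Unit)} {g' : List (List ℕ × VType)}
    (h : label π g g' ≠ 0) : g'.map (fun v => (v.1, ())) = g := by
  rw [label, independent_apply] at h
  induction g generalizing g' with
  | nil =>
    cases g' with
    | nil => rfl
    | cons b d => exact absurd rfl h
  | cons v g ih =>
    cases g' with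
    | nil => exact absurd rfl h
    | cons b d =>
      rw [listProd] at h
      have h1 := left_ne_zero_of_mul h
      rw [← PMF.mem_support_iff, PMF.support_map] at h1
      obtain ⟨t, -, rfl⟩ := h1
      rw [List.map_cons, ih (right_ne_zero_of_mul h)]

end Label

/-! ### Erasing the types along the whole chain -/

section Erase

variable {root : PMF VType} {κ : ℕ → VType → PMF (List VType)} {q : ℕ → PMF ℕ} {π : ℕ → PMF VType}

theorem label_rootGen (π : PMF VType) :
    label π [([], ())] = π.map fun t => [([], t)] := by
  rw [label, independent, PMF.bind_map]
  rw [← PMF.bind_pure_comp]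
  congr 1; ext1 t
  rw [Function.comp_apply, independent, PMF.pure_map]
  rfl

/-- Given the untyped generations up to `n`, the types in generation `n` are independent with law `π
n`. The last generation keeps its types so that the Markov property and the intertwining can drive
the induction. -/
theorem chainLaw_erase (h0 : root = π 0)
    (h : ∀ n, (π n).bind (κ n)
      = (q n).bind fun k => independent (fun _ : Unit => π (n + 1)) (List.replicate k ()))
    (x : ℕ → Gen Unit) (n : ℕ) (g : Gen VType) :
    chainLaw root (fun n g => independent (fun v : List ℕ × VType => κ n v.2) g)
        {y | (∀ i ≤ n, erase (y i) = x i) ∧ y n = g}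
      = chainLaw (PMF.pure ()) (gwStep q) (pathSet n x) * label (π n) (x n).toList g.toList := by
  set P := chainLaw root (fun n g => independent (fun v : List ℕ × VType => κ n v.2) g) with hP
  have hne : ∀ n (g : Gen VType), erase g ≠ x n →
      P {y | (∀ i ≤ n, erase (y i) = x i) ∧ y n = g}
        = chainLaw (PMF.pure ()) (gwStep q) (pathSet n x) * label (π n) (x n).toList g.toList := by
    intro n g hg
    have h1 : label (π n) (x n).toList g.toList = 0 := by
      by_contra h1
      exact hg (erase_eq_of_label h1)
    rw [h1, mul_zero]
    convert measure_empty (μ := P)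
    ext y
    simp only [Set.mem_ofPred_eq, Set.mem_empty_iff_false, iff_false, not_and]
    intro hy hy2
    exact hg (hy2 ▸ hy n le_rfl)
  induction n generalizing g with
  | zero =>
    by_cases hg : erase g = x 0
    · have h1 : {y : ℕ → Gen VType | (∀ i ≤ 0, erase (y i) = x i) ∧ y 0 = g} = {y | y 0 = g} := by
        ext y
        simp only [Set.mem_ofPred_eq, and_iff_right_iff_imp, Nat.le_zero, forall_eq]
        intro hy; rw [hy, hg]
      rw [h1, hP, chainLaw_zero, chainLaw_pathSet_zero, PMF.pure_map, PMF.pure_apply]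
      split_ifs with hx
      · rw [one_mul, hx, h0]
        exact (congrArg (fun m : PMF (List (List ℕ × VType)) => m g) (label_rootGen (π 0))).symm
      · rw [zero_mul]
        by_contra h2
        rw [← Ne, ← PMF.mem_support_iff, PMF.support_map] at h2
        obtain ⟨t, -, rfl⟩ := h2
        exact hx hg.symm
    · exact hne 0 g hg
  | succ n ih =>
    by_cases hg : erase g = x (n + 1)
    · set B : Set ((_ : Finset.Iic n) → Gen VType) := {z | ∀ i, erase (z i) = x i}
      have hB : MeasurableSet B := MeasurableSet.of_discrete
      have h1 : {y : ℕ → Gen VType | (∀ i ≤ n + 1, erase (y i) = x i) ∧ y (n + 1) = g}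
          = ⋃ g', {y | Preorder.frestrictLe (π := fun _ => Gen VType) n y ∈ B ∧ y n = g' ∧
            y (n + 1) = g} := by
        ext y
        simp only [B, Set.mem_ofPred_eq, Set.mem_iUnion, Subtype.forall, Finset.mem_Iic,
          Preorder.frestrictLe_apply]
        constructor
        · rintro ⟨h1, h2⟩
          exact ⟨y n, fun i hi => h1 i (by omega), rfl, h2⟩
        · rintro ⟨g', h1, -, h2⟩
          refine ⟨fun i hi => ?_, h2⟩
          rcases hi.lt_or_eq with hi | rfl
          · exact h1 i (by omega)
          · rw [h2, hg]
      have h2 : ∀ g', {y | Preorder.frestrictLe (π := fun _ => Gen VType) n y ∈ B ∧ y n = g'}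
          = {y | (∀ i ≤ n, erase (y i) = x i) ∧ y n = g'} := by
        intro g'
        ext y
        simp only [B, Set.mem_ofPred_eq, Subtype.forall, Finset.mem_Iic, Preorder.frestrictLe_apply]
      have hm : ∀ (n : ℕ) (g : Gen VType), MeasurableSet {x : ℕ → Gen VType | x n = g} := fun n g =>
        measurable_pi_apply (X := fun _ : ℕ => Gen VType) n (t := {g}) trivial
      rw [h1, measure_iUnion]
      · simp_rw [hP, chainLaw_step _ _ n hB, h2]
        simp_rw [← hP, ih, mul_assoc, ENNReal.tsum_mul_left]
        rw [chainLaw_pathSet_succ, mul_assoc]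
        congr 1
        have h3 := congrArg (fun m : PMF (List (List ℕ × VType)) => m g.toList)
          (label_intertwining (h n) (x n).toList)
        simp only [PMF.bind_apply] at h3
        refine h3.trans ?_
        rw [tsum_eq_single (x (n + 1)).toList]
        · rfl
        · intro g' hg'
          refine mul_eq_zero_of_right _ ?_
          by_contra h4
          exact hg' ((erase_eq_of_label h4).symm.trans hg)
      · intro a b hab
        exact Set.disjoint_left.2 fun y hy hy' => hab (hy.2.1.symm.trans hy'.2.1)
      · intro g'
        exact ((Preorder.measurable_frestrictLe n) hB).inter ((hm n g').inter (hm (n + 1) g))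
    · exact hne (n + 1) g hg

theorem map_erase_chainLaw (h0 : root = π 0)
    (h : ∀ n, (π n).bind (κ n)
      = (q n).bind fun k => independent (fun _ : Unit => π (n + 1)) (List.replicate k ())) :
    (chainLaw root (fun n g => independent (fun v : List ℕ × VType => κ n v.2) g)).map
        (fun y n => erase (y n)) = chainLaw (PMF.pure ()) (gwStep q) := by
  set P := chainLaw root (fun n g => independent (fun v : List ℕ × VType => κ n v.2) g) with hP
  have hm : Measurable fun (y : ℕ → Gen VType) n => erase (y n) :=
    measurable_pi_lambda _ fun n => (measurable_of_countable erase).comp (measurable_pi_apply n)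
  symm
  refine measure_ext_of_pathSet fun n x => ?_
  rw [Measure.map_apply hm (measurableSet_pathSet n x)]
  have h1 : (fun (y : ℕ → Gen VType) n => erase (y n)) ⁻¹' pathSet n x
      = ⋃ g, {y | (∀ i ≤ n, erase (y i) = x i) ∧ y n = g} := by
    ext y
    simp [pathSet]
  rw [h1, measure_iUnion]
  · simp_rw [hP, chainLaw_erase h0 h]
    rw [ENNReal.tsum_mul_left]
    have : ∑' g : Gen VType, label (π n) (x n).toList g.toList = 1 :=
      (label (π n) (x n).toList).tsum_coe
    rw [this, mul_one]
  · intro a b hab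
    exact Set.disjoint_left.2 fun y hy hy' => hab (hy.2.symm.trans hy'.2)
  · intro g
    have h2 : {y : ℕ → Gen VType | (∀ i ≤ n, erase (y i) = x i) ∧ y n = g}
        = ((fun (y : ℕ → Gen VType) n => erase (y n)) ⁻¹' pathSet n x) ∩ {y | y n = g} := rfl
    rw [h2]
    exact (hm (measurableSet_pathSet n x)).inter
      (measurable_pi_apply (X := fun _ : ℕ => Gen VType) n (t := {g}) trivial)

theorem skeleton_treeOfGens_erase (y : ℕ → Gen VType) :
    skeleton (treeOfGens fun n => erase (y n)) = skeleton (treeOfGens y) := by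
  ext u
  simp only [skeleton, treeOfGens, Set.mem_image, Set.mem_ofPred_eq]
  constructor
  · rintro ⟨v, ⟨n, hv⟩, rfl⟩
    obtain ⟨v', hv', rfl⟩ := List.mem_map.1 hv
    exact ⟨v', ⟨n, hv'⟩, rfl⟩
  · rintro ⟨v, ⟨n, hv⟩, rfl⟩
    exact ⟨(v.1, ()), ⟨n, List.mem_map.2 ⟨v, hv, rfl⟩⟩, rfl⟩

end Erase

/-! ### Survival of the inhomogeneous tree -/

section Survival

variable {p : PMF ℕ} {c : ℕ → ℝ} {lam : ℝ}

theorem listProd_iid {π : PMF VType} (k : ℕ) (ts : List VType) (h : ts.length = k) :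
    listProd (fun (_ : Unit) t => π t) (List.replicate k ()) ts
      = π VType.s ^ ts.count VType.s * π VType.e ^ (ts.length - ts.count VType.s) := by
  induction k generalizing ts with
  | zero => rw [List.length_eq_zero_iff.1 h]; simp [listProd]
  | succ k ih =>
    cases ts with
    | nil => simp at h
    | cons t ts =>
      have hle : ts.count VType.s ≤ ts.length := List.count_le_length
      rw [List.replicate_succ, listProd, ih ts (by simpa using h)]
      cases t with
      | s => simp; ring
      | e =>
        rw [List.count_cons_of_ne (by decide), List.length_cons, Nat.succ_sub hle, pow_succ]
        ring

theorem listProd_iid_eq_zero {π : PMF VType} (k : ℕ) (ts : List VType) (h : ts.length ≠ k) :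
    listProd (fun (_ : Unit) t => π t) (List.replicate k ()) ts = 0 := by
  induction k generalizing ts with
  | zero =>
    cases ts with
    | nil => simp at h
    | cons t ts => rfl
  | succ k ih =>
    cases ts with
    | nil => rfl
    | cons t ts => rw [List.replicate_succ, listProd, ih ts (by simpa using h), mul_zero]

theorem IsSenetaHeyde.egf_zeta (hc : IsSenetaHeyde p c)
    (hsup : 1 < mean p) (hfin : mean p < ⊤) (lam : ℝ) (h : ℕ) :
    egf p (zeta p c lam (h + 1)) = zeta p c lam h := by
  rw [hc.zeta_eq hsup hfin, hc.zeta_eq hsup hfin, egf_extProb_add hc.extProb_lt_one,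
    ← hc.survZeta_eq_sgf hsup hfin]

theorem IsSenetaHeyde.tiltedOffspring_apply (hc : IsSenetaHeyde p c)
    (hsup : 1 < mean p) (hfin : mean p < ⊤) (hlam : zeta p c lam 0 < ⊤) (h k : ℕ) :
    tiltedOffspring p c lam h k = (zeta p c lam h)⁻¹ * (p k * zeta p c lam (h + 1) ^ k) := by
  have hm : ∀ k, zeta p c lam (h + 1) ^ k / zeta p c lam h * p k
      = (zeta p c lam h)⁻¹ * (p k * zeta p c lam (h + 1) ^ k) := fun k => by
    rw [div_eq_mul_inv]; ring
  rw [tiltedOffspring, massLaw_apply, hm]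
  simp_rw [hm]
  rw [ENNReal.tsum_mul_left]
  change _ * egf p _ = 1
  rw [hc.egf_zeta hsup hfin, ENNReal.inv_mul_cancel (hc.zeta_ne_zero hsup hfin lam h)
    (hc.zeta_ne_top hsup hfin hlam h)]

theorem extProb_mul_extMass (p : PMF ℕ) (k : ℕ) : extProb p * extMass p k = extProb p ^ k * p k := by
  by_cases h0 : extProb p = 0
  · rw [h0, zero_mul]
    -- When `𝔠 = 0`, the case `k = 0` needs `p 0 = 0`, which follows from `f(0) = 0`.
    rcases k with _ | k
    · have h1 := egf_extProb p
      rw [h0, egf, ENNReal.tsum_eq_zero] at h1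
      simpa using (h1 0).symm
    · simp
  · have ht : extProb p ≠ ⊤ := ((extProb_le_one p).trans_lt ENNReal.one_lt_top).ne
    rw [extMass, if_neg h0, ← mul_assoc, ENNReal.mul_div_cancel h0 ht]

/-- With `l` letters s among `k` children, both sides give `(ζ_{h+1} - 𝔠)^l 𝔠^(k-l) p(k) / ζ_h`. For
`l ≥ 1` the parent is of type s, for `l = 0` of type e. -/
theorem IsSenetaHeyde.typeLaw_bind (hc : IsSenetaHeyde p c)
    (hsup : 1 < mean p) (hfin : mean p < ⊤) (hlam : zeta p c lam 0 < ⊤) (h : ℕ) :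
    (typeLaw p c lam h).bind (typedOffspring p c lam h)
      = (tiltedOffspring p c lam h).bind fun k =>
        independent (fun _ : Unit => typeLaw p c lam (h + 1)) (List.replicate k ()) := by
  have hz0 := hc.zeta_ne_zero hsup hfin lam (h + 1)
  have hzt := hc.zeta_ne_top hsup hfin hlam (h + 1)
  ext ts
  have hle : ts.count VType.s ≤ ts.length := List.count_le_length
  rw [PMF.bind_apply, PMF.bind_apply, tsum_vtype, tsum_eq_single ts.length, independent_apply,
    listProd_iid _ _ rfl, hc.tiltedOffspring_apply hsup hfin hlam,
    (hc.typeLaw_apply hsup hfin hlam h).1, (hc.typeLaw_apply hsup hfin hlam h).2,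
    (hc.typeLaw_apply hsup hfin hlam (h + 1)).1, (hc.typeLaw_apply hsup hfin hlam (h + 1)).2,
    typedOffspring_extinct, div_eq_mul_inv, mul_right_comm,
    hc.mul_typedOffspring hsup hfin hlam]
  · set l := ts.count VType.s
    set k := ts.length
    set z := zeta p c lam (h + 1)
    set y := survZeta p c lam (h + 1)
    have hr : (zeta p c lam h)⁻¹ * (p k * z ^ k) * ((y / z) ^ l * (extProb p / z) ^ (k - l))
        = (zeta p c lam h)⁻¹ * (y ^ l * (extProb p ^ (k - l) * p k)) := by
      have hk : z ^ k = z ^ l * z ^ (k - l) := by rw [← pow_add]; congr 1; omega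
      have h1 : ∀ n, z ^ n * z⁻¹ ^ n = 1 := fun n => by
        rw [← mul_pow, ENNReal.mul_inv_cancel hz0 hzt, one_pow]
      rw [hk, div_eq_mul_inv, div_eq_mul_inv, mul_pow, mul_pow]
      calc _ = (zeta p c lam h)⁻¹ * (y ^ l * (extProb p ^ (k - l) * p k))
            * (z ^ l * z⁻¹ ^ l) * (z ^ (k - l) * z⁻¹ ^ (k - l)) := by ring
        _ = _ := by rw [h1, h1, mul_one, mul_one]
    rw [hr]
    by_cases hl : 1 ≤ l
    · have h1 : typeMass p VType.e ts = 0 := by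
        by_contra h1
        have := count_eq_zero_of_extinctMass h1
        omega
      rw [h1, typeMass, if_pos hl]
      ring
    · have hl0 : l = 0 := by omega
      have h1 : typeMass p VType.e ts = extMass p k := by
        rw [typeMass, extinctMass, if_neg (List.count_eq_zero.1 hl0)]
      rw [h1, typeMass, if_neg hl, hl0, mul_zero, zero_mul, zero_add, pow_zero, one_mul, Nat.sub_zero,
        ← extProb_mul_extMass, div_eq_mul_inv]
      ring
  · intro k hk
    rw [independent_apply, listProd_iid_eq_zero _ _ hk.symm, mul_zero]

theorem IsSenetaHeyde.map_skeleton_tiltedTypedLaw (hc : IsSenetaHeyde p c)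
    (hsup : 1 < mean p) (hfin : mean p < ⊤) (hlam : zeta p c lam 0 < ⊤) :
    (tiltedTypedLaw p c lam).map skeleton = tiltedLaw p c lam := by
  have h := map_erase_chainLaw (rootLaw_eq p c lam) (hc.typeLaw_bind hsup hfin hlam)
  have hm : Measurable fun (y : ℕ → Gen VType) n => erase (y n) :=
    measurable_pi_lambda _ fun n => (measurable_of_countable erase).comp (measurable_pi_apply n)
  rw [tiltedLaw, gwLaw_eq, ← h, tiltedTypedLaw_eq,
    Measure.map_map measurable_skeleton measurable_treeOfGens,
    Measure.map_map measurable_skeleton measurable_treeOfGens,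
    Measure.map_map (measurable_skeleton.comp measurable_treeOfGens) hm]
  refine congrArg₂ _ ?_ rfl
  ext1 y
  exact (skeleton_treeOfGens_erase y).symm

/-- The tilted offspring generating functions are `f` conjugated by the scalings `ζ_h`, so those of
the generation sizes are the iterates of `f` rescaled. At 0, extinction by generation `n` has the
untilted probability divided by `ζ_0`. -/
theorem IsSenetaHeyde.tiltedLaw_height_lt_top (hc : IsSenetaHeyde p c)
    (hsup : 1 < mean p) (hfin : mean p < ⊤) (hlam : zeta p c lam 0 < ⊤) :
    tiltedLaw p c lam {t | height t < ⊤} = extProb p / zeta p c lam 0 := by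
  have h1 : ∀ n x, egf (sizeLaw (tiltedOffspring p c lam) n) (x / zeta p c lam n)
      = egf (sizeLaw (fun _ => p) n) x / zeta p c lam 0 := by
    intro n
    induction n with
    | zero =>
      intro x
      rw [egf, egf, sizeLaw, sizeLaw, tsum_pure_mul, tsum_pure_mul, pow_one, pow_one]
    | succ n ih =>
      intro x
      have hz0 := hc.zeta_ne_zero hsup hfin lam (n + 1)
      have hzt := hc.zeta_ne_top hsup hfin hlam (n + 1)
      rw [egf_sizeLaw_succ, egf_sizeLaw_succ, ← ih]
      congr 1
      rw [egf, egf, div_eq_mul_inv _ (zeta p c lam n), ← ENNReal.tsum_mul_right]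
      refine tsum_congr fun k => ?_
      rw [hc.tiltedOffspring_apply hsup hfin hlam, div_eq_mul_inv, mul_pow]
      calc _ = p k * x ^ k * (zeta p c lam n)⁻¹
            * (zeta p c lam (n + 1) * (zeta p c lam (n + 1))⁻¹) ^ k := by rw [mul_pow]; ring
        _ = _ := by rw [ENNReal.mul_inv_cancel hz0 hzt, one_pow, mul_one]
  have h2 : ∀ q : PMF ℕ, egf q 0 = q 0 := by
    intro q
    rw [egf, tsum_eq_single 0]
    · simp
    · intro k hk; simp [hk]
  have h3 := gwLaw_height_lt_top (tiltedOffspring p c lam)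
  have h4 := gwLaw_height_lt_top fun _ => p
  refine tendsto_nhds_unique h3 ?_
  refine (ENNReal.Tendsto.div_const h4 (Or.inr (hc.zeta_ne_zero hsup hfin lam 0))).congr fun n => ?_
  have := h1 n 0
  rw [ENNReal.zero_div, h2, h2] at this
  exact this.symm

/-- A root of type s always leaves descendants of type s, so the height is infinite almost surely.
That the converse holds almost surely is seen from the probabilities, both equal to `(ζ_0 - 𝔠) /
ζ_0`. -/
theorem IsSenetaHeyde.ae_height_iff (hc : IsSenetaHeyde p c)
    (hsup : 1 < mean p) (hfin : mean p < ⊤) (hlam : zeta p c lam 0 < ⊤) :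
    ∀ᵐ x ∂chainLaw (rootLaw p c lam) (tiltedStep p c lam),
      skeleton (treeOfGens x) ∈ {t | height t = ⊤} ↔ x 0 = rootGen VType.s := by
  set P := chainLaw (rootLaw p c lam) (tiltedStep p c lam)
  have hms := measurable_skeleton.comp (measurable_treeOfGens (σ := VType))
  have h1 : ∀ᵐ x ∂P, x 0 = rootGen VType.s → height (skeleton (treeOfGens x)) = ⊤ := by
    filter_upwards [ae_isLevel (rootLaw p c lam) (tiltedStep p c lam),
      ae_step_mem_support (rootLaw p c lam) (tiltedStep p c lam)] with x hx hx2 h0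
    rw [height_treeOfGens_eq_top_iff hx.1 fun n => (hx.2 n).imp fun d hd => hd.2]
    have h2 : ∀ n, 1 ≤ survivors (x n).toList := by
      intro n
      induction n with
      | zero => rw [h0, toList_rootGen, survivors]; simp
      | succ n ih =>
        refine ih.trans (survivors_le_of_stepMass (p := p) ?_)
        have h3 := hc.mul_tiltedStep hsup hfin hlam n (x n) (x (n + 1))
        have h4 := (PMF.mem_support_iff _ _).1 (hx2.2 n)
        refine right_ne_zero_of_mul (h3 ▸ mul_ne_zero (pow_ne_zero _ ?_) h4)
        exact hc.survZeta_ne_zero hsup hfin lam n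
    intro n hn
    have := h2 n
    rw [List.length_eq_zero_iff.1 hn] at this
    simp [survivors] at this
  have h2 : P {x | height (skeleton (treeOfGens x)) = ⊤} = survZeta p c lam 0 / zeta p c lam 0 := by
    have h3 : P {x | height (skeleton (treeOfGens x)) = ⊤} = tiltedLaw p c lam {t | height t = ⊤} := by
      rw [← hc.map_skeleton_tiltedTypedLaw hsup hfin hlam, tiltedTypedLaw_eq,
        Measure.map_map measurable_skeleton measurable_treeOfGens,
        Measure.map_apply hms measurableSet_height_eq_top]
      rfl
    have h4 : IsProbabilityMeasure (tiltedLaw p c lam) := by unfold tiltedLaw; infer_instance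
    have h5 := prob_add_prob_compl (μ := tiltedLaw p c lam) measurableSet_height_eq_top
    have h6 : {t : Set (List ℕ) | height t = ⊤}ᶜ = {t | height t < ⊤} := by
      ext t; simp [lt_top_iff_ne_top]
    have hz0 := hc.zeta_ne_zero hsup hfin lam 0
    have hzt := hc.zeta_ne_top hsup hfin hlam 0
    rw [h6, hc.tiltedLaw_height_lt_top hsup hfin hlam] at h5
    have h7 : survZeta p c lam 0 / zeta p c lam 0 + extProb p / zeta p c lam 0 = 1 := by
      rw [← ENNReal.add_div, add_comm, ← hc.zeta_eq hsup hfin, ENNReal.div_self hz0 hzt]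
    rw [h3]
    exact (ENNReal.add_left_inj (ENNReal.div_ne_top hc.extProb_lt_one.ne_top hz0)).1
      (h5.trans h7.symm)
  have h3 : {x : ℕ → Gen VType | x 0 = rootGen VType.s}
      =ᵐ[P] {x | height (skeleton (treeOfGens x)) = ⊤} := by
    refine ae_eq_of_ae_subset_of_measure_ge h1 ?_ (measurableSet_root _).nullMeasurableSet
      (measure_ne_top _ _)
    rw [h2, hc.chainLaw_tilted_root hsup hfin hlam]
  filter_upwards [h3] with x hx
  exact (iff_of_eq hx).symm

theorem IsSenetaHeyde.bind_extremalLaw (hc : IsSenetaHeyde p c) (hnd : p.support.Nontrivial)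
    (hsup : 1 < mean p) (hfin : mean p < ⊤) (hlam : zeta p c lam 0 < ⊤) :
    (thetaLaw p c lam).bind (extremalLaw p c)
      = cond (tiltedLaw p c lam) {t | height t = ⊤} := by
  have hms := measurable_skeleton.comp (measurable_treeOfGens (σ := VType))
  have h1 : extremalLaw p c = fun θ =>
      (chainLaw (PMF.pure VType.s) (extremalStep p c θ)).map (skeleton ∘ treeOfGens) := by
    ext1 θ
    exact Measure.map_map measurable_skeleton measurable_treeOfGens
  rw [h1, bind_map (measurable_chainLaw_extremal p c) hms, hc.bind_chainLaw hnd hsup hfin hlam,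
    map_cond hms measurableSet_height_eq_top (s := {x | x 0 = rootGen VType.s})
      (hc.ae_height_iff hsup hfin hlam),
    ← hc.map_skeleton_tiltedTypedLaw hsup hfin hlam, tiltedTypedLaw_eq,
    Measure.map_map measurable_skeleton measurable_treeOfGens]

end Survival

end

end GWTree

theorem proposition8p5 (p : PMF ℕ) (hnd : p.support.Nontrivial)
    (hsup : 1 < GWTree.mean p) (hfin : GWTree.mean p < ⊤)
    (c : ℕ → ℝ) (hc : GWTree.IsSenetaHeyde p c)
    (lam : ℝ) (hlam : GWTree.zeta p c lam 0 < ⊤) :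
    (GWTree.thetaLaw p c lam).bind (GWTree.extremalLaw p c)
        = ProbabilityTheory.cond (GWTree.tiltedLaw p c lam) {t | GWTree.height t = ⊤} ∧
      (GWTree.thetaLaw p c lam).bind (GWTree.extremalTypedLaw p c)
        = ProbabilityTheory.cond (GWTree.tiltedTypedLaw p c lam)
            {T | ([], GWTree.VType.s) ∈ T} :=
  ⟨hc.bind_extremalLaw hnd hsup hfin hlam, hc.bind_extremalTypedLaw hnd hsup hfin hlam⟩
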